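/- Let $\{X(p)\}_{p\text{ prime}}$ be independent random variables, each uniformly distributed on the unit circle $\{|w|=1\}\subset\mathbb C$. With probability $1$ the products and sums $$L(1,X)=\lim_{y\to\infty}\prod_{p\le y}\Bigl(1-\frac{X(p)}p\Bigr)^{-1},\qquad \log L(1,X)=\lim_{y\to\infty}\sum_{p\le y}-\log\Bigl(1-\frac{X(p)}p\Bigr)$$ (principal logarithms in the sum) converge, and $\exp(\log L(1,X))=L(1,X)$. Put $L(1,X)^{z}=\exp(z\log L(1,X))$ and $\overline{L(1,X)}^{\,z}=\exp(z\,\overline{\log L(1,X)})$. For $z\in\mathbb C$ let $d_z(n)$ be the multiplicative function with $d_z(p^a)=z(z+1)\cdots(z+a-1)/a!$ $\bigl(=\Gamma(z+a)/(\Gamma(z)\,a!)\bigr)$. For real $t\ne0$ let $\zeta(1+it)^z=\exp(z\log\zeta(1+it))$, where $\log\zeta(1+it)$ is defined by continuous variation along the straight lines joining $2$, $2+it$ and $1+it$, starting with the real value $\log\zeta(2)$. Then for all $z_1,z_2\in\mathbb C$ the random variable $L(1,X)^{z_1}\overline{L(1,X)}^{\,z_2}$ is integrable and $$\mathbb E\Bigl(L(1,X)^{z_1}\overline{L(1,X)}^{\,z_2}\Bigr)=\sum_{n=1}^\infty\frac{d_{z_1}(n)\,d_{z_2}(n)}{n^2},$$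 where the series converges absolutely. Moreover, as $T\to\infty$, uniformly for all complex numbers $z_1,z_2$ with $|z_1|,|z_2|\le \dfrac{\log T}{50(\log\log T)^2}$, $$\frac1T\int_T^{2T}\zeta(1+it)^{z_1}\zeta(1-it)^{z_2}\,dt=\mathbb E\Bigl(L(1,X)^{z_1}\overline{L(1,X)}^{\,z_2}\Bigr)+O\Bigl(\exp\Bigl(-\frac{\log T}{2\log\log T}\Bigr)\Bigr),$$ where the implied constant is absolute. -/

import Mathlib

open MeasureTheory ProbabilityTheory Filter Topology Complex
open scoped ComplexConjugate Real

/-- `log ζ(1 + it)` for real `t ≠ 0`, by continuous variation along the straight lines joining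
`2`, `2 + it` and `1 + it`, starting from the real value `log ζ(2)`: the starting value plus
the integral of `ζ'/ζ` along this path. There are no zeros of `ζ` on the path. -/
noncomputable def logZetaOneLine (t : ℝ) : ℂ :=
  Complex.log (riemannZeta 2)
    + (∫ u in (0 : ℝ)..t, logDeriv riemannZeta (2 + u * I) * I)
    - ∫ σ in (1 : ℝ)..2, logDeriv riemannZeta (σ + t * I)

/-- The power `ζ(1 + it) ^ z`, for real `t ≠ 0`. -/
noncomputable def zetaOneLinePow (t : ℝ) (z : ℂ) : ℂ :=
  Complex.exp (z * logZetaOneLine t)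

/-- If `ζ` has neither a pole nor a zero on a line segment, then `ζ` at its end is `ζ` at its start
times the exponential of the integral of `ζ'/ζ` along it. -/
theorem riemannZeta_segment (a b : ℝ) (s v : ℂ)
    (h : ∀ u ∈ Set.uIcc a b, s + u * v ≠ 1 ∧ riemannZeta (s + u * v) ≠ 0) :
    riemannZeta (s + b * v) = riemannZeta (s + a * v) *
      Complex.exp (∫ u in a..b, logDeriv riemannZeta (s + u * v) * v) := by
  have hline : ∀ u : ℝ, HasDerivAt (fun u : ℝ => s + u * v) v u := fun u => by
    simpa using ((Complex.ofRealCLM.hasDerivAt (x := u)).mul_const v).const_add s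
  have hz : ∀ u ∈ Set.uIcc a b, HasDerivAt (fun u : ℝ => riemannZeta (s + u * v))
      (deriv riemannZeta (s + u * v) * v) u := fun u hu =>
    ((differentiableAt_riemannZeta (h u hu).1).hasDerivAt).comp u (hline u)
  have hopen : IsOpen {w : ℂ | w ≠ 1} := isOpen_ne
  have han : ∀ w : ℂ, w ≠ 1 → AnalyticAt ℂ riemannZeta w := fun w hw =>
    (DifferentiableOn.analyticOnNhd (s := {w : ℂ | w ≠ 1})
      (fun x hx => (differentiableAt_riemannZeta hx).differentiableWithinAt) hopen) w hw
  have hcont : ContinuousOn (fun u : ℝ => logDeriv riemannZeta (s + u * v) * v)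
      (Set.uIcc a b) := by
    intro u hu
    apply ContinuousAt.continuousWithinAt
    have h1 : ContinuousAt (logDeriv riemannZeta) (s + u * v) :=
      ((han _ (h u hu).1).deriv.continuousAt).div (han _ (h u hu).1).continuousAt (h u hu).2
    exact (ContinuousAt.comp (f := fun u : ℝ => s + u * v) h1
      (hline u).continuousAt).mul continuousAt_const
  set F : ℝ → ℂ := fun x => ∫ u in a..x, logDeriv riemannZeta (s + u * v) * v with hF
  have hFd : ∀ x ∈ Set.uIcc a b, HasDerivWithinAt F (logDeriv riemannZeta (s + x * v) * v)
      (Set.uIcc a b) x := by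
    intro x hx
    have : Fact (x ∈ Set.uIcc a b) := ⟨hx⟩
    exact intervalIntegral.integral_hasDerivWithinAt_right
      ((hcont.mono (Set.uIcc_subset_uIcc_left hx)).intervalIntegrable)
      (hcont.stronglyMeasurableAtFilter_nhdsWithin measurableSet_uIcc x) (hcont x hx)
  have hG : ∀ x ∈ Set.uIcc a b, HasDerivWithinAt
      (fun x : ℝ => riemannZeta (s + x * v) * Complex.exp (-F x)) 0 (Set.uIcc a b) x := by
    intro x hx
    refine ((hz x hx).hasDerivWithinAt.mul (hFd x hx).neg.cexp).congr_deriv ?_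
    have := (h x hx).2
    simp only [logDeriv, Pi.div_apply]
    field_simp
    ring
  have hconst := (convex_uIcc a b).is_const_of_fderivWithin_eq_zero (𝕜 := ℝ)
    (f := fun x : ℝ => riemannZeta (s + x * v) * Complex.exp (-F x))
    (fun x hx => (hG x hx).differentiableWithinAt)
    (fun x hx => by
      by_cases hu : UniqueDiffWithinAt ℝ (Set.uIcc a b) x
      · have := (hG x hx).hasFDerivWithinAt.fderivWithin hu
        rw [this]; ext; simp
      · exact fderivWithin_zero_of_not_uniqueDiffWithinAt hu)
    Set.left_mem_uIcc Set.right_mem_uIcc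
  simp only [hF, intervalIntegral.integral_same, neg_zero, Complex.exp_zero, mul_one] at hconst
  rw [hconst, mul_assoc, ← Complex.exp_add]
  simp

/-- `logZetaOneLine t` is a logarithm of `ζ(1 + it)`. -/
theorem exp_logZetaOneLine (t : ℝ) (ht : t ≠ 0) :
    Complex.exp (logZetaOneLine t) = riemannZeta (1 + t * I) := by
  have h1 := riemannZeta_segment 0 t 2 I (fun u _ =>
    ⟨fun h => by simpa using congrArg Complex.re h,
      riemannZeta_ne_zero_of_one_le_re (by simp)⟩)
  have h2 := riemannZeta_segment 1 2 (t * I) 1 (fun u hu =>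
    ⟨fun h => ht (by simpa using congrArg Complex.im h),
      riemannZeta_ne_zero_of_one_le_re (by
        rw [Set.uIcc_of_le (by norm_num)] at hu
        simpa using hu.1)⟩)
  have h3 : riemannZeta 2 ≠ 0 := riemannZeta_ne_zero_of_one_le_re (by simp)
  simp only [Complex.ofReal_zero, zero_mul, add_zero, mul_one, Complex.ofReal_one,
    Complex.ofReal_ofNat] at h1 h2
  rw [logZetaOneLine, Complex.exp_sub, Complex.exp_add, Complex.exp_log h3, ← h1,
    add_comm (2 : ℂ), h2, add_comm (1 : ℂ)]
  simp only [add_comm _ ((t : ℂ) * I)]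
  field_simp

/-- The `z`-th divisor function: `d_z(n)` is multiplicative in `n`, and
`d_z(p ^ a) = Γ(z + a) / (Γ(z) a!) = z (z + 1) ⋯ (z + a - 1) / a!`; the second form is used, since
it makes sense at the poles of `Γ` as well. The value at `n = 0` is set to `0`. -/
noncomputable def divisorFun (z : ℂ) (n : ℕ) : ℂ :=
  if n = 0 then 0 else
    ∏ p ∈ n.primeFactors,
      (ascPochhammer ℂ (n.factorization p)).eval z / (Nat.factorial (n.factorization p) : ℂ)

/-- The uniform probability measure on the unit circle of `ℂ`: the law of `exp (iθ)` with `θ`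
uniformly distributed on `(0, 2π]`. -/
noncomputable def uniformCircle : Measure ℂ :=
  (ENNReal.ofReal (2 * π))⁻¹ •
    Measure.map (fun θ : ℝ => Complex.exp (θ * I)) (volume.restrict (Set.Ioc (0 : ℝ) (2 * π)))

/-- The primes `p ≤ y`. -/
def primesUpTo (y : ℕ) : Finset Nat.Primes :=
  Finset.subtype Nat.Prime (Finset.Iic y)

/-- The truncated Euler product `∏_{p ≤ y} (1 - x(p) / p)⁻¹`. -/
noncomputable def eulerProductUpTo (x : Nat.Primes → ℂ) (y : ℕ) : ℂ :=
  ∏ p ∈ primesUpTo y, (1 - x p / ((p : ℕ) : ℂ))⁻¹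

/-- `L(1, x) = lim_{y → ∞} ∏_{p ≤ y} (1 - x(p) / p)⁻¹`. -/
noncomputable def eulerL (x : Nat.Primes → ℂ) : ℂ :=
  limUnder atTop (eulerProductUpTo x)

/-- The logarithm of the truncated Euler product, with the principal branch for every factor
(`1 - x(p) / p` has positive real part when `|x(p)| = 1`). -/
noncomputable def logEulerProductUpTo (x : Nat.Primes → ℂ) (y : ℕ) : ℂ :=
  ∑ p ∈ primesUpTo y, -Complex.log (1 - x p / ((p : ℕ) : ℂ))

/-- `log L(1, x) = lim_{y → ∞} ∑_{p ≤ y} -log (1 - x(p) / p)`. -/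
noncomputable def logEulerL (x : Nat.Primes → ℂ) : ℂ :=
  limUnder atTop (logEulerProductUpTo x)

/-- The power `L(1, x) ^ z`. -/
noncomputable def eulerLPow (x : Nat.Primes → ℂ) (z : ℂ) : ℂ :=
  Complex.exp (z * logEulerL x)

/-- The power `(conj L(1, x)) ^ z`, with `log (conj L(1, x)) = conj (log L(1, x))`. -/
noncomputable def eulerLConjPow (x : Nat.Primes → ℂ) (z : ℂ) : ℂ :=
  Complex.exp (z * conj (logEulerL x))

/-! Random side. For one prime, the binomial series of (1 - w/p)^(-z₁) and of the conjugate factor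
are multiplied and integrated over the circle; Parseval leaves ∑ₐ d_{z₁}(p^a) d_{z₂}(p^a) p^(-2a)
(`integral_exp_eulerFactorLog`). Independence multiplies these factors over p ≤ y and
multiplicativity reassembles the divisor series. The limit y → ∞ uses that log L(1, X) is a sum of
independent centred terms of size O(1/p), hence a martingale bounded in L², and that the truncated
powers are bounded in L² because their squared moduli are again truncated moments
(`integrable_and_hasSum_moment`).

Zeta side. Put L = log T, l = log L and k = L/(50 l²), the bound for |z₁|, |z₂|. Comparing `ζ` times
a mollifier with 1 in mean square shows that, for t ∈ [T, 2T] outside a set of relative measure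
O(T^(-1/8) L), `ζ` has no zero with Re s ≥ 0.97 within L + 2 of height t
(`exists_measurableSet_riemannZeta_ne_zero`). Near such t, Borel–Carathéodory gives log ζ = O(L),
and the three circles theorem, with the trivial bound log(1 + l) at Re s = 1 + 1/l on the other
side, improves this to O(log l) for Re s ≥ 1 - 4/l
(`differentiableAt_and_norm_logZetaHorizontal_le`).

Cauchy's formula with the kernel exp(w² + Uw)/w, U = L/4, shifted to Re w = -4/l, then replaces ζ(1
+ it)^z by a smoothed Dirichlet series of effective length T^(1/4)
(`norm_zetaOneLinePow_sub_smoothedSeries_le`). The shift saves exp(-4U/l) = exp(-L/l), while k ·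
O(log l) is a small fraction of L/l; half of the saving is what the theorem states. In the mean
value of the product of two such series (`norm_integral_smoothedSeries_sub_le`) the off-diagonal
terms contribute T^(-1/4 + o(1)). Removing the cutoff from the diagonal costs a factor n^(4/l),
which is affordable because ∑ d_k(n)² n^(-2σ) grows only like the exponential of a power of k barely
above the first when σ is near 1 (`summable_and_tsum_divisorFunReal_sq_le`).

On the exceptional set the classical log ζ(1 + it) = O(log log t) and a pointwise bound for the
smoothed series give exp(O(L/l)), which is negligible against T^(-1/8). -/

section PrimePowFun

/-! ### Multiplicative functions whose values at p^a do not depend on p -/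

variable {R : Type*} [CommSemiring R]

/-- The multiplicative function with value `g a` at `p ^ a` for every prime `p`. -/
noncomputable def primePowFun (g : ℕ → R) (n : ℕ) : R :=
  if n = 0 then 0 else ∏ p ∈ n.primeFactors, g (n.factorization p)

@[simp] lemma primePowFun_zero (g : ℕ → R) : primePowFun g 0 = 0 := by simp [primePowFun]

@[simp] lemma primePowFun_one (g : ℕ → R) : primePowFun g 1 = 1 := by simp [primePowFun]

lemma primePowFun_mul (g : ℕ → R) {m n : ℕ} (h : m.Coprime n) :
    primePowFun g (m * n) = primePowFun g m * primePowFun g n := by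
  rcases eq_or_ne m 0 with rfl | hm
  · simp
  rcases eq_or_ne n 0 with rfl | hn
  · simp
  simp only [primePowFun, hm, hn, mul_eq_zero, or_self, if_false]
  rw [h.primeFactors_mul, Finset.prod_union h.disjoint_primeFactors,
    Nat.factorization_mul_of_coprime h]
  congr 1
  · refine Finset.prod_congr rfl fun p hp => ?_
    have : p ∉ n.primeFactors := fun h' =>
      Finset.disjoint_left.1 h.disjoint_primeFactors hp h'
    rw [Finsupp.add_apply, ← Nat.support_factorization, Finsupp.notMem_support_iff] at *
    rw [this, add_zero]
  · refine Finset.prod_congr rfl fun p hp => ?_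
    have : p ∉ m.primeFactors := fun h' =>
      Finset.disjoint_left.1 h.disjoint_primeFactors h' hp
    rw [Finsupp.add_apply, ← Nat.support_factorization, Finsupp.notMem_support_iff] at *
    rw [this, zero_add]

lemma primePowFun_prime_pow (g : ℕ → R) (h0 : g 0 = 1) {p : ℕ} (hp : p.Prime) (a : ℕ) :
    primePowFun g (p ^ a) = g a := by
  rcases eq_or_ne a 0 with rfl | ha
  · simp [h0]
  · rw [primePowFun, if_neg (pow_ne_zero _ hp.ne_zero), Nat.primeFactors_prime_pow ha hp]
    simp [hp.factorization_self]

end PrimePowFun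

/-! ### Generalised divisor functions and their local factors -/

/-- The coefficient of `x ^ a` in `(1 - x) ^ (-z)`. -/
noncomputable def negBinomCoeff (z : ℂ) (a : ℕ) : ℂ :=
  (ascPochhammer ℂ a).eval z / (Nat.factorial a : ℂ)

/-- The coefficient of `x ^ a` in `(1 - x) ^ (-k)` for real `k`. -/
noncomputable def negBinomCoeffReal (k : ℝ) (a : ℕ) : ℝ :=
  (ascPochhammer ℝ a).eval k / (Nat.factorial a : ℝ)

/-- The divisor function `d_k` for real `k`, as a real number. -/
noncomputable def divisorFunReal (k : ℝ) (n : ℕ) : ℝ := primePowFun (negBinomCoeffReal k) n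

lemma divisorFun_eq_primePowFun (z : ℂ) (n : ℕ) :
    divisorFun z n = primePowFun (negBinomCoeff z) n := rfl

@[simp] lemma negBinomCoeff_zero (z : ℂ) : negBinomCoeff z 0 = 1 := by simp [negBinomCoeff]

@[simp] lemma negBinomCoeffReal_zero (k : ℝ) : negBinomCoeffReal k 0 = 1 := by
  simp [negBinomCoeffReal]

lemma negBinomCoeff_succ (z : ℂ) (a : ℕ) :
    negBinomCoeff z (a + 1) = negBinomCoeff z a * ((z + a) / (a + 1)) := by
  have : (a : ℂ) + 1 ≠ 0 := by exact_mod_cast Nat.succ_ne_zero a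
  rw [negBinomCoeff, negBinomCoeff, ascPochhammer_succ_eval, Nat.factorial_succ]
  push_cast
  field_simp

lemma negBinomCoeffReal_succ (k : ℝ) (a : ℕ) :
    negBinomCoeffReal k (a + 1) = negBinomCoeffReal k a * ((k + a) / (a + 1)) := by
  rw [negBinomCoeffReal, negBinomCoeffReal, ascPochhammer_succ_eval, Nat.factorial_succ]
  push_cast
  field_simp

lemma negBinomCoeff_ofReal (k : ℝ) (a : ℕ) :
    negBinomCoeff (k : ℂ) a = (negBinomCoeffReal k a : ℂ) := by
  induction a with
  | zero => simp
  | succ a ih => rw [negBinomCoeff_succ, negBinomCoeffReal_succ, ih]; push_cast; ring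

lemma negBinomCoeffReal_nonneg {k : ℝ} (hk : 0 ≤ k) (a : ℕ) : 0 ≤ negBinomCoeffReal k a := by
  induction a with
  | zero => simp
  | succ a ih => rw [negBinomCoeffReal_succ]; positivity

/-- Each step of the recursion multiplies by (z + a)/(a + 1), and |z + a| ≤ k + a. Through this
majorant every estimate for complex z becomes one for a real parameter k ≥ 0. -/
lemma norm_negBinomCoeff_le {z : ℂ} {k : ℝ} (h : ‖z‖ ≤ k) (a : ℕ) :
    ‖negBinomCoeff z a‖ ≤ negBinomCoeffReal k a := by
  have hk : 0 ≤ k := (norm_nonneg z).trans h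
  induction a with
  | zero => simp
  | succ a ih =>
    rw [negBinomCoeff_succ, negBinomCoeffReal_succ, norm_mul, norm_div]
    have h1 : ‖(a : ℂ) + 1‖ = a + 1 := by
      rw [← Nat.cast_succ, Complex.norm_natCast]; push_cast; rfl
    have h2 : ‖z + a‖ ≤ k + a := (norm_add_le _ _).trans (by simpa using h)
    rw [h1]
    gcongr
    exact negBinomCoeffReal_nonneg hk a

/-- The ratios of consecutive terms compare because (k² + a)(a + 1) - (k + a)² = a(k - 1)² ≥ 0. -/
lemma negBinomCoeffReal_sq_le {k : ℝ} (hk : 1 ≤ k) (a : ℕ) :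
    negBinomCoeffReal k a ^ 2 ≤ negBinomCoeffReal (k ^ 2) a := by
  induction a with
  | zero => simp
  | succ a ih =>
    rw [negBinomCoeffReal_succ, negBinomCoeffReal_succ, mul_pow]
    refine mul_le_mul ih ?_ (by positivity) (negBinomCoeffReal_nonneg (by positivity) a)
    rw [div_pow, div_le_div_iff₀ (by positivity) (by positivity)]
    have ha : (0 : ℝ) ≤ a := Nat.cast_nonneg a
    have h : (k + a) ^ 2 ≤ (k ^ 2 + a) * (a + 1) := by nlinarith [mul_nonneg ha (sq_nonneg (k - 1))]
    nlinarith

lemma hasSum_negBinomCoeff (z : ℂ) {x : ℂ} (hx : ‖x‖ < 1) :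
    HasSum (fun a => negBinomCoeff z a * x ^ a) (exp (z * -log (1 - x))) := by
  have h := (one_div_one_sub_cpow_hasFPowerSeriesOnBall_zero z).hasSum (y := x)
    (by rw [← ENNReal.ofReal_one, Metric.eball_ofReal]; simpa using hx)
  have hne : (1 - x) ≠ 0 := fun h0 => by
    rw [sub_eq_zero] at h0; rw [← h0] at hx; simp at hx
  rw [zero_add, cpow_def_of_ne_zero hne, one_div, ← Complex.exp_neg] at h
  convert! h using 1
  · ext a
    simp only [FormalMultilinearSeries.ofScalars_apply_eq, smul_eq_mul]
    congr 1
    rw [negBinomCoeff, div_eq_iff (by exact_mod_cast Nat.factorial_ne_zero a)]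
    have := Ring.factorial_nsmul_multichoose_eq_ascPochhammer z a
    -- The coefficient in the library's series is `Ring.choose (z + a - 1) a`, which unfolds to a
    -- multichoose of `z`.
    rw [Ring.choose, show z + a - 1 - a + 1 = z by ring, mul_comm, ← nsmul_eq_mul, this,
      Polynomial.ascPochhammer_smeval_eq_eval]
  · ring_nf

lemma hasSum_negBinomCoeffReal (k : ℝ) {x : ℝ} (hx : |x| < 1) :
    HasSum (fun a => negBinomCoeffReal k a * x ^ a) (Real.exp (k * -Real.log (1 - x))) := by
  have h := hasSum_negBinomCoeff (k : ℂ) (x := (x : ℂ)) (by simpa using hx)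
  rw [← Complex.hasSum_ofReal]
  convert! h using 1
  · ext a; rw [negBinomCoeff_ofReal]; push_cast; rfl
  · push_cast
    rw [Complex.ofReal_log (by linarith [(abs_lt.1 hx).2])]
    push_cast; rfl

lemma neg_log_one_sub_le {x : ℝ} (hx0 : 0 ≤ x) (hx : x ≤ 3 / 4) : -Real.log (1 - x) ≤ 4 * x := by
  have h := Real.one_sub_inv_le_log_of_pos (x := 1 - x) (by linarith)
  have : (1 - x)⁻¹ - 1 ≤ 4 * x := by
    rw [sub_le_iff_le_add, inv_le_comm₀ (by linarith) (by linarith), inv_le_iff_one_le_mul₀ (by linarith)]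
    nlinarith
  linarith

lemma neg_log_one_sub_nonneg {x : ℝ} (hx0 : 0 ≤ x) (hx : x < 1) : 0 ≤ -Real.log (1 - x) := by
  have := Real.log_nonpos (x := 1 - x) (by linarith) (by linarith)
  linarith

/-- The squares of the coefficients: both the bound by the square of the sum and the bound by the
series for `k ^ 2` are used. -/
lemma summable_and_tsum_negBinomCoeffReal_sq_le {k x r : ℝ} (hk : 1 ≤ k) (hx0 : 0 < x)
    (hx : x ≤ 3 / 4) (hr1 : 1 ≤ r) (hr2 : r ≤ 2) :
    Summable (fun a => negBinomCoeffReal k a ^ 2 * (x ^ 2) ^ a) ∧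
    ∑' a, negBinomCoeffReal k a ^ 2 * (x ^ 2) ^ a ≤ Real.exp (8 * (k * x) ^ r) := by
  have hx2 : x ^ 2 ≤ 3 / 4 := by nlinarith
  have hnn := negBinomCoeffReal_nonneg (zero_le_one.trans hk)
  have h1 := hasSum_negBinomCoeffReal (k ^ 2) (x := x ^ 2) (by rw [abs_of_nonneg (by positivity)]; linarith)
  have hle1 : ∀ a, negBinomCoeffReal k a ^ 2 * (x ^ 2) ^ a ≤
      negBinomCoeffReal (k ^ 2) a * (x ^ 2) ^ a := fun a => by
    gcongr; exact negBinomCoeffReal_sq_le hk a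
  have hsum : Summable (fun a => negBinomCoeffReal k a ^ 2 * (x ^ 2) ^ a) :=
    Summable.of_nonneg_of_le (fun a => by positivity) hle1 h1.summable
  refine ⟨hsum, ?_⟩
  have b1 : ∑' a, negBinomCoeffReal k a ^ 2 * (x ^ 2) ^ a ≤ Real.exp (8 * (k * x) ^ 2) := by
    refine (hsum.tsum_le_tsum hle1 h1.summable).trans ?_
    rw [h1.tsum_eq]
    refine Real.exp_le_exp.2 ?_
    have := neg_log_one_sub_le (sq_nonneg x) hx2
    nlinarith [mul_le_mul_of_nonneg_left this (sq_nonneg k), sq_nonneg (k * x)]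
  -- The terms of the series for (1 - x)^(-k) are nonnegative, so each is at most the sum; hence the
  -- sum of squares is at most (1 - x)^(-2k).
  have b2 : ∑' a, negBinomCoeffReal k a ^ 2 * (x ^ 2) ^ a ≤ Real.exp (8 * (k * x)) := by
    have h2 := hasSum_negBinomCoeffReal k (x := x) (by rw [abs_of_pos hx0]; linarith)
    have hterm : ∀ a, 0 ≤ negBinomCoeffReal k a * x ^ a := fun a => mul_nonneg (hnn a) (by positivity)
    have hle : ∀ a, negBinomCoeffReal k a ^ 2 * (x ^ 2) ^ a ≤
        Real.exp (k * -Real.log (1 - x)) * (negBinomCoeffReal k a * x ^ a) := fun a => by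
      have := h2.summable.le_tsum a fun b _ => hterm b
      rw [h2.tsum_eq] at this
      calc _ = (negBinomCoeffReal k a * x ^ a) * (negBinomCoeffReal k a * x ^ a) := by ring
        _ ≤ _ := mul_le_mul_of_nonneg_right this (hterm a)
    refine (hsum.tsum_le_tsum hle (h2.summable.mul_left _)).trans ?_
    rw [tsum_mul_left, h2.tsum_eq, ← Real.exp_add]
    refine Real.exp_le_exp.2 ?_
    have := neg_log_one_sub_le hx0.le hx
    nlinarith
  have hkx : 0 < k * x := by positivity
  -- (kx)^r dominates kx when kx ≥ 1 and dominates (kx)² when kx ≤ 1, so the better of the two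
  -- bounds is always below the claim.
  rcases le_total 1 (k * x) with h | h
  · refine b2.trans ?_
    gcongr
    simpa using Real.rpow_le_rpow_of_exponent_le h hr1
  · refine b1.trans ?_
    gcongr
    simpa using Real.rpow_le_rpow_of_exponent_ge hkx h hr2

lemma divisorFunReal_nonneg {k : ℝ} (hk : 0 ≤ k) (n : ℕ) : 0 ≤ divisorFunReal k n := by
  rw [divisorFunReal, primePowFun]
  split_ifs
  · exact le_rfl
  · exact Finset.prod_nonneg fun p _ => negBinomCoeffReal_nonneg hk _

lemma norm_divisorFun_le {z : ℂ} {k : ℝ} (h : ‖z‖ ≤ k) (n : ℕ) :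
    ‖divisorFun z n‖ ≤ divisorFunReal k n := by
  rw [divisorFun_eq_primePowFun, divisorFunReal, primePowFun, primePowFun]
  split_ifs
  · simp
  · rw [norm_prod]
    exact Finset.prod_le_prod (fun p _ => norm_nonneg _) fun p _ => norm_negBinomCoeff_le h _

lemma divisorFun_mul (z : ℂ) {m n : ℕ} (h : m.Coprime n) :
    divisorFun z (m * n) = divisorFun z m * divisorFun z n :=
  primePowFun_mul (negBinomCoeff z) h

lemma divisorFunReal_mul (k : ℝ) {m n : ℕ} (h : m.Coprime n) :
    divisorFunReal k (m * n) = divisorFunReal k m * divisorFunReal k n :=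
  primePowFun_mul _ h

@[simp] lemma divisorFun_zero (z : ℂ) : divisorFun z 0 = 0 := primePowFun_zero (negBinomCoeff z)
@[simp] lemma divisorFun_one (z : ℂ) : divisorFun z 1 = 1 := primePowFun_one (negBinomCoeff z)
@[simp] lemma divisorFunReal_zero (k : ℝ) : divisorFunReal k 0 = 0 := primePowFun_zero _
@[simp] lemma divisorFunReal_one (k : ℝ) : divisorFunReal k 1 = 1 := primePowFun_one _

lemma divisorFun_prime_pow (z : ℂ) {p : ℕ} (hp : p.Prime) (a : ℕ) :
    divisorFun z (p ^ a) = negBinomCoeff z a :=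
  primePowFun_prime_pow (negBinomCoeff z) (by simp) hp a

lemma divisorFunReal_prime_pow (k : ℝ) {p : ℕ} (hp : p.Prime) (a : ℕ) :
    divisorFunReal k (p ^ a) = negBinomCoeffReal k a := primePowFun_prime_pow _ (by simp) hp a

/-- Bound for the sum of a nonnegative multiplicative function by its Euler factors. -/
lemma summable_and_tsum_le_exp_of_prime_pow_le {f : ℕ → ℝ} (hf0 : f 0 = 0) (hf1 : f 1 = 1)
    (hmul : ∀ {m n : ℕ}, m.Coprime n → f (m * n) = f m * f n) (hnn : ∀ n, 0 ≤ f n)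
    {b : Nat.Primes → ℝ} (hb : ∀ p, 0 ≤ b p) (hbs : Summable b)
    (hsum : ∀ p : Nat.Primes, Summable fun a : ℕ => f ((p : ℕ) ^ a))
    (hle : ∀ p : Nat.Primes, ∑' a : ℕ, f ((p : ℕ) ^ a) ≤ Real.exp (b p)) :
    Summable f ∧ ∑' n, f n ≤ Real.exp (∑' p, b p) := by
  have key : ∀ N : ℕ, ∑ n ∈ Finset.range N, f n ≤ Real.exp (∑' p, b p) := by
    intro N
    obtain ⟨h1, h2⟩ := EulerProduct.summable_and_hasSum_smoothNumbers_prod_primesBelow_tsum hf1 hmul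
      (fun {p} hp => by
        simpa only [Real.norm_of_nonneg (hnn _)] using hsum ⟨p, hp⟩) N
    -- Every positive n < N has only prime factors below N, so the partial sum is dominated by a
    -- finite Euler product.
    have h3 : ∑ n ∈ Finset.range N, f n ≤ ∑' m : N.smoothNumbers, f m := by
      rw [tsum_subtype N.smoothNumbers f]
      have hs : Summable (N.smoothNumbers.indicator f) := by
        rw [← summable_subtype_iff_indicator]; exact h2.summable
      refine le_trans (le_of_eq ?_) (hs.sum_le_tsum (Finset.range N)
        fun n _ => Set.indicator_nonneg (fun n _ => hnn n) n)
      refine Finset.sum_congr rfl fun n hn => ?_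
      rcases eq_or_ne n 0 with rfl | h0
      · rw [Set.indicator_of_notMem (by simp [Nat.mem_smoothNumbers]), hf0]
      · rw [Set.indicator_of_mem
          (Nat.mem_smoothNumbers_of_lt (Nat.pos_of_ne_zero h0) (Finset.mem_range.1 hn))]
    refine h3.trans ?_
    rw [h2.tsum_eq]
    obtain ⟨s, hs⟩ : ∃ s : Finset Nat.Primes, s = N.primesBelow.subtype Nat.Prime := ⟨_, rfl⟩
    have h4 : ∏ p ∈ N.primesBelow, ∑' a : ℕ, f (p ^ a) ≤ ∏ p ∈ s, Real.exp (b p) := by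
      rw [Finset.prod_subtype_of_mem (s := N.primesBelow) (p := Nat.Prime)
        (f := fun p => ∑' a : ℕ, f (p ^ a))
        (fun p hp => Nat.prime_of_mem_primesBelow hp) |>.symm, hs]
      exact Finset.prod_le_prod (fun p _ => tsum_nonneg fun a => hnn _) fun p _ => hle p
    refine h4.trans ?_
    rw [← Real.exp_sum]
    gcongr
    exact hbs.sum_le_tsum _ fun p _ => hb p
  have hs : Summable f := summable_of_sum_range_le hnn key
  exact ⟨hs, hs.tsum_le_of_sum_range_le key⟩

/-! ### The logarithm of `ζ` as a sum over primes, and Dirichlet series of divisor functions -/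

/-- `∑ₚ -log (1 - p ^ (-s))`, the logarithm of `ζ(s)` for `Re s > 1`. -/
noncomputable def logZetaEuler (s : ℂ) : ℂ :=
  ∑' p : Nat.Primes, -Complex.log (1 - ((p : ℕ) : ℂ) ^ (-s))

/-- `∑ₚ -log (1 - p ^ (-σ))` for real `σ`. -/
noncomputable def logZetaReal (σ : ℝ) : ℝ :=
  ∑' p : Nat.Primes, -Real.log (1 - ((p : ℕ) : ℝ) ^ (-σ))

lemma norm_prime_cpow (p : Nat.Primes) (s : ℂ) :
    ‖((p : ℕ) : ℂ) ^ (-s)‖ = ((p : ℕ) : ℝ) ^ (-s.re) := by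
  rw [Complex.norm_natCast_cpow_of_pos p.prop.pos, neg_re]

lemma prime_rpow_pos (p : Nat.Primes) (σ : ℝ) : 0 < ((p : ℕ) : ℝ) ^ (-σ) :=
  Real.rpow_pos_of_pos (by exact_mod_cast p.prop.pos) _

lemma prime_rpow_le {σ : ℝ} (hσ : 1 / 2 ≤ σ) (p : Nat.Primes) :
    ((p : ℕ) : ℝ) ^ (-σ) ≤ 3 / 4 := by
  have hp : (2 : ℝ) ≤ (p : ℕ) := by exact_mod_cast p.prop.two_le
  calc ((p : ℕ) : ℝ) ^ (-σ) ≤ ((p : ℕ) : ℝ) ^ (-(1 / 2 : ℝ)) :=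
        Real.rpow_le_rpow_of_exponent_le (by linarith) (by linarith)
    _ ≤ (2 : ℝ) ^ (-(1 / 2 : ℝ)) := Real.rpow_le_rpow_of_nonpos (by norm_num) hp (by norm_num)
    _ ≤ 3 / 4 := by
      rw [Real.rpow_neg (by norm_num), ← Real.sqrt_eq_rpow, inv_le_comm₀ (by positivity) (by norm_num)]
      apply Real.le_sqrt_of_sq_le; norm_num

lemma summable_prime_rpow {σ : ℝ} (hσ : 1 < σ) :
    Summable fun p : Nat.Primes => ((p : ℕ) : ℝ) ^ (-σ) :=
  Nat.Primes.summable_rpow.2 (by linarith)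

lemma neg_log_prime_nonneg {σ : ℝ} (hσ : 1 / 2 ≤ σ) (p : Nat.Primes) :
    0 ≤ -Real.log (1 - ((p : ℕ) : ℝ) ^ (-σ)) :=
  neg_log_one_sub_nonneg (prime_rpow_pos p σ).le (by linarith [prime_rpow_le hσ p])

lemma summable_neg_log_prime {σ : ℝ} (hσ : 1 < σ) :
    Summable fun p : Nat.Primes => -Real.log (1 - ((p : ℕ) : ℝ) ^ (-σ)) :=
  Summable.of_nonneg_of_le (neg_log_prime_nonneg (by linarith))
    (fun p => neg_log_one_sub_le (prime_rpow_pos p σ).le (prime_rpow_le (by linarith) p))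
    ((summable_prime_rpow hσ).mul_left 4)

lemma logZetaReal_nonneg {σ : ℝ} (hσ : 1 < σ) : 0 ≤ logZetaReal σ :=
  tsum_nonneg (neg_log_prime_nonneg (by linarith))

/-- The Taylor coefficients 1/n of -log(1 - x) are nonnegative, so the series at |x| majorises the
one at x. -/
lemma norm_neg_log_one_sub_le {x : ℂ} (hx : ‖x‖ < 1) :
    ‖-Complex.log (1 - x)‖ ≤ -Real.log (1 - ‖x‖) := by
  have h1 := Complex.hasSum_taylorSeries_neg_log hx
  have h2 : HasSum (fun n : ℕ => ‖x‖ ^ n / n) (-Real.log (1 - ‖x‖)) := by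
    rw [← Complex.hasSum_ofReal]
    convert! Complex.hasSum_taylorSeries_neg_log (z := (‖x‖ : ℂ)) (by simpa using hx) using 1
    · ext n; push_cast; rfl
    · push_cast; rw [Complex.ofReal_log (by linarith)]; push_cast; rfl
  rw [← h1.tsum_eq, ← h2.tsum_eq]
  refine tsum_of_norm_bounded h2.summable.hasSum fun n => ?_
  simp

lemma norm_neg_log_prime_le {s : ℂ} (hs : 1 / 2 ≤ s.re) (p : Nat.Primes) :
    ‖-Complex.log (1 - ((p : ℕ) : ℂ) ^ (-s))‖ ≤ -Real.log (1 - ((p : ℕ) : ℝ) ^ (-s.re)) := by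
  rw [← norm_prime_cpow]
  apply norm_neg_log_one_sub_le
  rw [norm_prime_cpow]
  linarith [prime_rpow_le hs p]

lemma hasSum_logZetaEuler {s : ℂ} (hs : 1 < s.re) :
    HasSum (fun p : Nat.Primes => -Complex.log (1 - ((p : ℕ) : ℂ) ^ (-s))) (logZetaEuler s) :=
  (Summable.of_norm_bounded (summable_neg_log_prime hs)
    (norm_neg_log_prime_le (by linarith))).hasSum

lemma norm_logZetaEuler_le {s : ℂ} (hs : 1 < s.re) : ‖logZetaEuler s‖ ≤ logZetaReal s.re :=
  tsum_of_norm_bounded (summable_neg_log_prime hs).hasSum (norm_neg_log_prime_le (by linarith))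

lemma exp_logZetaEuler {s : ℂ} (hs : 1 < s.re) : exp (logZetaEuler s) = riemannZeta s :=
  riemannZeta_eulerProduct_exp_log hs

lemma logZetaEuler_ofReal {σ : ℝ} (hσ : 1 < σ) : logZetaEuler σ = logZetaReal σ := by
  rw [logZetaEuler, logZetaReal, Complex.ofReal_tsum]
  refine tsum_congr fun p => ?_
  rw [Complex.ofReal_neg, Complex.ofReal_log (by linarith [prime_rpow_le (σ := σ) (by linarith) p])]
  push_cast
  rw [Complex.ofReal_cpow (by positivity)]
  simp

/-- ζ(σ) - 1/(σ - 1) equals 1 - σ · `ZetaAsymptotics.termTSum σ`, and the last sum has nonnegative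
terms. -/
lemma exp_logZetaReal_le {σ : ℝ} (hσ : 1 < σ) :
    Real.exp (logZetaReal σ) ≤ 1 + 1 / (σ - 1) := by
  have h := exp_logZetaEuler (s := (σ : ℂ)) (by simpa using hσ)
  rw [logZetaEuler_ofReal hσ, zeta_eq_tsum_one_div_nat_add_one_cpow (by simpa using hσ)] at h
  have h2 : Real.exp (logZetaReal σ) = ∑' n : ℕ, 1 / ((n : ℝ) + 1) ^ σ := by
    have : ((Real.exp (logZetaReal σ) : ℝ) : ℂ) = ((∑' n : ℕ, 1 / ((n : ℝ) + 1) ^ σ : ℝ) : ℂ) := by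
      push_cast
      rw [h]
      refine tsum_congr fun n => ?_
      rw [Complex.ofReal_cpow (by positivity)]
      push_cast; rfl
    exact_mod_cast this
  have h3 := ZetaAsymptotics.zeta_limit_aux1 hσ
  have h4 : 0 ≤ ZetaAsymptotics.termTSum σ := tsum_nonneg fun n => ZetaAsymptotics.term_nonneg _ _
  rw [h2]
  nlinarith [mul_nonneg (zero_le_one.trans hσ.le) h4]

lemma logZetaReal_le_log {σ : ℝ} (hσ : 1 < σ) : logZetaReal σ ≤ Real.log (1 + 1 / (σ - 1)) := by
  have : 0 < 1 / (σ - 1) := by have := sub_pos.2 hσ; positivity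
  rw [Real.le_log_iff_exp_le (by linarith)]
  exact exp_logZetaReal_le hσ

lemma logZetaReal_antitone {σ τ : ℝ} (hσ : 1 < σ) (h : σ ≤ τ) : logZetaReal τ ≤ logZetaReal σ := by
  refine (summable_neg_log_prime (by linarith)).tsum_le_tsum (fun p => ?_) (summable_neg_log_prime hσ)
  have h1 := prime_rpow_le (σ := σ) (by linarith) p
  have : ((p : ℕ) : ℝ) ^ (-τ) ≤ ((p : ℕ) : ℝ) ^ (-σ) :=
    Real.rpow_le_rpow_of_exponent_le (by exact_mod_cast p.prop.one_le) (by linarith)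
  have := Real.log_le_log (x := 1 - ((p : ℕ) : ℝ) ^ (-σ)) (y := 1 - ((p : ℕ) : ℝ) ^ (-τ)) (by linarith) (by linarith)
  linarith

lemma differentiableOn_logZetaEuler : DifferentiableOn ℂ logZetaEuler {s | 1 < s.re} := by
  have key : ∀ σ : ℝ, 1 < σ → DifferentiableOn ℂ logZetaEuler {s | σ < s.re} := fun σ hσ => by
    refine differentiableOn_tsum_of_summable_norm (summable_neg_log_prime hσ) (fun p => ?_)
      (Complex.isOpen_re_gt σ) (fun p s hs => ?_)
    · intro s hs
      have hs : σ < s.re := hs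
      have hp : ((p : ℕ) : ℂ) ≠ 0 := by exact_mod_cast p.prop.ne_zero
      refine DifferentiableAt.differentiableWithinAt ?_
      refine (DifferentiableAt.clog ?_ ?_).neg
      · exact (differentiableAt_const _).sub ((differentiableAt_id.neg).const_cpow (Or.inl hp))
      · refine Or.inl ?_
        have h1 := (abs_re_le_norm (((p : ℕ) : ℂ) ^ (-s)))
        rw [norm_prime_cpow] at h1
        have := prime_rpow_le (σ := s.re) (by linarith) p
        simp only [sub_re, one_re]
        linarith [(abs_le.1 h1).2]
    · have hs : σ < s.re := hs
      refine (norm_neg_log_prime_le (by linarith) p).trans ?_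
      have h1 := prime_rpow_le (σ := σ) (by linarith) p
      have : ((p : ℕ) : ℝ) ^ (-s.re) ≤ ((p : ℕ) : ℝ) ^ (-σ) :=
        Real.rpow_le_rpow_of_exponent_le (by exact_mod_cast p.prop.one_le) (by linarith)
      have := Real.log_le_log (x := 1 - ((p : ℕ) : ℝ) ^ (-σ)) (y := 1 - ((p : ℕ) : ℝ) ^ (-s.re)) (by linarith) (by linarith)
      linarith
  intro s hs
  have hs : 1 < s.re := hs
  refine DifferentiableAt.differentiableWithinAt ?_
  exact (key ((1 + s.re) / 2) (by linarith)).differentiableAt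
    ((Complex.isOpen_re_gt _).mem_nhds (show (1 + s.re) / 2 < s.re by linarith))

lemma hasDerivAt_logZetaEuler {s : ℂ} (hs : 1 < s.re) :
    HasDerivAt logZetaEuler (logDeriv riemannZeta s) s := by
  have h1 : DifferentiableAt ℂ logZetaEuler s :=
    differentiableOn_logZetaEuler.differentiableAt ((Complex.isOpen_re_gt 1).mem_nhds hs)
  have h2 : HasDerivAt riemannZeta (exp (logZetaEuler s) * deriv logZetaEuler s) s := by
    refine h1.hasDerivAt.cexp.congr_of_eventuallyEq ?_
    filter_upwards [(Complex.isOpen_re_gt 1).mem_nhds hs] with w hw using (exp_logZetaEuler hw).symm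
  have h3 : logDeriv riemannZeta s = deriv logZetaEuler s := by
    rw [logDeriv_apply, h2.deriv, ← exp_logZetaEuler hs, mul_div_cancel_left₀ _ (exp_ne_zero _)]
  rw [h3]
  exact h1.hasDerivAt

lemma rpow_natCast_mul (m n : ℕ) (σ : ℝ) :
    ((m * n : ℕ) : ℝ) ^ σ = (m : ℝ) ^ σ * (n : ℝ) ^ σ := by
  rw [Nat.cast_mul, Real.mul_rpow (by positivity) (by positivity)]

lemma rpow_natCast_pow (m n : ℕ) (σ : ℝ) : ((m ^ n : ℕ) : ℝ) ^ σ = ((m : ℝ) ^ σ) ^ n := by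
  rw [Nat.cast_pow, ← Real.rpow_natCast, ← Real.rpow_natCast, ← Real.rpow_mul (by positivity),
    ← Real.rpow_mul (by positivity), mul_comm]

/-- The series is ζ(σ)^k: its Euler factor at p is (1 - p^(-σ))^(-k). Only the upper bound is
needed. -/
lemma summable_and_tsum_divisorFunReal_le {k σ : ℝ} (hk : 0 ≤ k) (hσ : 1 < σ) :
    Summable (fun n : ℕ => divisorFunReal k n * (n : ℝ) ^ (-σ)) ∧
    ∑' n : ℕ, divisorFunReal k n * (n : ℝ) ^ (-σ) ≤ Real.exp (k * logZetaReal σ) := by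
  have hp : ∀ p : Nat.Primes, HasSum (fun a : ℕ => divisorFunReal k ((p : ℕ) ^ a) *
      (((p : ℕ) ^ a : ℕ) : ℝ) ^ (-σ)) (Real.exp (k * -Real.log (1 - ((p : ℕ) : ℝ) ^ (-σ)))) := by
    intro p
    have := hasSum_negBinomCoeffReal k (x := ((p : ℕ) : ℝ) ^ (-σ)) (by
      rw [abs_of_pos (prime_rpow_pos p σ)]; linarith [prime_rpow_le (σ := σ) (by linarith) p])
    convert! this using 2 with a
    rw [divisorFunReal_prime_pow _ p.prop, rpow_natCast_pow]
  rw [logZetaReal, ← tsum_mul_left]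
  refine summable_and_tsum_le_exp_of_prime_pow_le (by simp) (by simp) (fun {m n} h => ?_)
    (fun n => mul_nonneg (divisorFunReal_nonneg hk n) (by positivity))
    (fun p => mul_nonneg hk (neg_log_prime_nonneg (by linarith) p))
    ((summable_neg_log_prime hσ).mul_left k) (fun p => (hp p).summable) (fun p => (hp p).tsum_eq.le)
  rw [divisorFunReal_mul k h, rpow_natCast_mul]; ring

/-- The exponent r of k is free in [1, 2] as long as rσ > 1. Close to σ = 1 it may be taken just
above 1, and this almost linear growth in k is what allows k as large as log T/(50 (log log T)²).
For fixed k the choice r = 2 suffices. -/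
lemma summable_and_tsum_divisorFunReal_sq_le {k σ r : ℝ} (hk : 1 ≤ k) (hσ : 1 / 2 ≤ σ)
    (hr1 : 1 ≤ r) (hr2 : r ≤ 2) (hrσ : 1 < r * σ) :
    Summable (fun n : ℕ => divisorFunReal k n ^ 2 * ((n : ℝ) ^ (-σ)) ^ 2) ∧
    ∑' n : ℕ, divisorFunReal k n ^ 2 * ((n : ℝ) ^ (-σ)) ^ 2 ≤
      Real.exp (8 * k ^ r * logZetaReal (r * σ)) := by
  have hp : ∀ p : Nat.Primes, ∀ a : ℕ, divisorFunReal k ((p : ℕ) ^ a) ^ 2 *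
      ((((p : ℕ) ^ a : ℕ) : ℝ) ^ (-σ)) ^ 2 =
      negBinomCoeffReal k a ^ 2 * ((((p : ℕ) : ℝ) ^ (-σ)) ^ 2) ^ a := fun p a => by
    rw [divisorFunReal_prime_pow _ p.prop, rpow_natCast_pow]; ring
  have hx := fun p : Nat.Primes => summable_and_tsum_negBinomCoeffReal_sq_le hk (prime_rpow_pos p σ)
    (prime_rpow_le hσ p) hr1 hr2
  have hs2 : Summable fun p : Nat.Primes => 8 * k ^ r * ((p : ℕ) : ℝ) ^ (-(r * σ)) :=
    (summable_prime_rpow hrσ).mul_left _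
  obtain ⟨h1, h2⟩ := summable_and_tsum_le_exp_of_prime_pow_le
    (f := fun n : ℕ => divisorFunReal k n ^ 2 * ((n : ℝ) ^ (-σ)) ^ 2)
    (b := fun p => 8 * k ^ r * ((p : ℕ) : ℝ) ^ (-(r * σ))) (by simp) (by simp)
    (fun {m n} h => by rw [divisorFunReal_mul k h, rpow_natCast_mul]; ring)
    (fun n => by positivity)
    (fun p => by positivity) hs2
    (fun p => by simp only [hp]; exact (hx p).1)
    (fun p => by
      simp only [hp]
      refine (hx p).2.trans (le_of_eq ?_)
      rw [Real.mul_rpow (by positivity) (prime_rpow_pos p σ).le, ← Real.rpow_mul (by positivity)]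
      ring_nf)
  refine ⟨h1, h2.trans (Real.exp_le_exp.2 ?_)⟩
  rw [tsum_mul_left]
  refine mul_le_mul_of_nonneg_left ?_ (by positivity)
  refine (summable_prime_rpow hrσ).tsum_le_tsum (fun p => ?_) (summable_neg_log_prime hrσ)
  have := Real.log_le_sub_one_of_pos (x := 1 - ((p : ℕ) : ℝ) ^ (-(r * σ)))
    (by linarith [prime_rpow_le (σ := r * σ) (by linarith) p])
  linarith

/-- The Dirichlet series of `d_z`. -/
lemma hasSum_divisorFun_cpow (z : ℂ) {s : ℂ} (hs : 1 < s.re) :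
    HasSum (fun n : ℕ => divisorFun z n * (n : ℂ) ^ (-s)) (exp (z * logZetaEuler s)) := by
  have hnorm : Summable fun n : ℕ => ‖divisorFun z n * (n : ℂ) ^ (-s)‖ := by
    refine Summable.of_nonneg_of_le (fun n => norm_nonneg _) (fun n => ?_)
      (summable_and_tsum_divisorFunReal_le (norm_nonneg z) hs).1
    rcases Nat.eq_zero_or_pos n with rfl | hn
    · simp
    · rw [norm_mul, Complex.norm_natCast_cpow_of_pos hn, neg_re]
      gcongr
      exact norm_divisorFun_le le_rfl n
  have h1 := EulerProduct.eulerProduct_hasProd (f := fun n : ℕ => divisorFun z n * (n : ℂ) ^ (-s))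
    (by simp) (fun {m n} h => by
      rw [divisorFun_mul z h, Nat.cast_mul, Complex.natCast_mul_natCast_cpow]; ring)
    hnorm (by simp)
  have h2 : HasProd (fun p : Nat.Primes => ∑' e : ℕ, divisorFun z ((p : ℕ) ^ e) *
      (((p : ℕ) ^ e : ℕ) : ℂ) ^ (-s)) (exp (z * logZetaEuler s)) := by
    have := ((hasSum_logZetaEuler hs).mul_left z).cexp
    convert! this using 2 with p
    have hlt : ‖((p : ℕ) : ℂ) ^ (-s)‖ < 1 := by
      rw [norm_prime_cpow]; linarith [prime_rpow_le (σ := s.re) (by linarith) p]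
    simp only [Function.comp_apply]
    rw [← (hasSum_negBinomCoeff z hlt).tsum_eq]
    refine tsum_congr fun a => ?_
    rw [divisorFun_prime_pow z p.prop, Nat.cast_pow, ← Complex.natCast_cpow_natCast_mul,
      ← Complex.cpow_nat_mul]
  rw [h2.unique h1]
  exact hnorm.of_norm.hasSum

lemma summable_norm_divisorFun_mul_divisorFun (z₁ z₂ : ℂ) :
    Summable fun n : ℕ => ‖divisorFun z₁ n * divisorFun z₂ n / (n : ℂ) ^ 2‖ := by
  set k : ℝ := max 1 (max ‖z₁‖ ‖z₂‖) with hk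
  refine Summable.of_nonneg_of_le (fun n => norm_nonneg _) (fun n => ?_)
    (summable_and_tsum_divisorFunReal_sq_le (k := k) (σ := 1) (r := 2) (le_max_left _ _)
      (by norm_num) (by norm_num) le_rfl (by norm_num)).1
  rw [norm_div, norm_mul, norm_pow, Complex.norm_natCast, Real.rpow_neg_one, inv_pow, sq,
    ← div_eq_mul_inv]
  have h1 := norm_divisorFun_le (k := k) ((le_max_left ‖z₁‖ ‖z₂‖).trans (le_max_right _ _)) n
  have h2 := norm_divisorFun_le (k := k) ((le_max_right ‖z₁‖ ‖z₂‖).trans (le_max_right _ _)) n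
  have := divisorFunReal_nonneg (k := k) (zero_le_one.trans (le_max_left _ _)) n
  rw [sq (divisorFunReal k n)]
  gcongr

/-- The finite products are written in the shape in which the truncated random moments appear, so
that both limits can be identified. -/
lemma tendsto_prod_tsum_negBinomCoeff (z₁ z₂ : ℂ) :
    Tendsto (fun N : ℕ => ∏ p ∈ N.primesBelow,
      ∑' a : ℕ, negBinomCoeff z₁ a * negBinomCoeff z₂ a * (((p : ℂ) ^ 2)⁻¹) ^ a) atTop
      (𝓝 (∑' n : ℕ, divisorFun z₁ n * divisorFun z₂ n / (n : ℂ) ^ 2)) := by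
  have h := EulerProduct.eulerProduct
    (f := fun n : ℕ => divisorFun z₁ n * divisorFun z₂ n / (n : ℂ) ^ 2)
    (by simp) (fun {m n} h => by
      rw [divisorFun_mul _ h, divisorFun_mul _ h]; push_cast; ring)
    (summable_norm_divisorFun_mul_divisorFun z₁ z₂) (by simp)
  refine h.congr fun N => Finset.prod_congr rfl fun p hp => tsum_congr fun a => ?_
  have := Nat.prime_of_mem_primesBelow hp
  rw [divisorFun_prime_pow _ this, divisorFun_prime_pow _ this]
  push_cast
  rw [inv_pow, ← pow_mul, ← pow_mul, mul_comm a 2, div_eq_mul_inv]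

/-! ### Parseval's formula on the circle and the moments of one Euler factor -/

instance isProbabilityMeasure_uniformCircle : IsProbabilityMeasure uniformCircle := by
  constructor
  rw [uniformCircle, Measure.smul_apply, Measure.map_apply (by fun_prop) MeasurableSet.univ]
  simp only [Set.preimage_univ, Measure.restrict_apply MeasurableSet.univ, Set.univ_inter,
    Real.volume_Ioc, sub_zero, smul_eq_mul]
  exact ENNReal.inv_mul_cancel (by simp [Real.pi_pos]) ENNReal.ofReal_ne_top

lemma ae_norm_eq_one_uniformCircle : ∀ᵐ w ∂uniformCircle, ‖w‖ = 1 := by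
  rw [uniformCircle]
  refine Measure.ae_smul_measure ?_ _
  rw [ae_map_iff (by fun_prop) (measurableSet_eq_fun (by fun_prop) (by fun_prop))]
  exact Eventually.of_forall fun θ => Complex.norm_exp_ofReal_mul_I θ

lemma integral_uniformCircle {f : ℂ → ℂ} (hf : Measurable f) :
    ∫ w, f w ∂uniformCircle = (2 * π)⁻¹ • ∫ θ in (0 : ℝ)..2 * π, f (exp (θ * I)) := by
  rw [uniformCircle, integral_smul_measure, integral_map (by fun_prop) hf.aestronglyMeasurable,
    intervalIntegral.integral_of_le (by positivity), ENNReal.toReal_inv,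
    ENNReal.toReal_ofReal (by positivity)]

lemma integral_pow_mul_conj_pow_uniformCircle (a b : ℕ) :
    ∫ w, w ^ a * conj w ^ b ∂uniformCircle = if a = b then 1 else 0 := by
  rw [integral_uniformCircle (by fun_prop)]
  have h : ∀ θ : ℝ, exp (θ * I) ^ a * conj (exp (θ * I)) ^ b =
      exp (((a : ℂ) - b) * I * θ) := fun θ => by
    rw [← Complex.exp_conj, ← Complex.exp_nat_mul, ← Complex.exp_nat_mul, ← Complex.exp_add]
    congr 1
    simp
    ring
  simp only [h]
  split_ifs with hab
  · subst hab
    simp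
    field_simp
  · have hne : ((a : ℂ) - b) * I ≠ 0 :=
      mul_ne_zero (sub_ne_zero.2 (by exact_mod_cast hab)) I_ne_zero
    rw [integral_exp_mul_complex hne]
    have : exp (((a : ℂ) - b) * I * ((2 * π : ℝ) : ℂ)) = 1 := by
      rw [Complex.exp_eq_one_iff]
      exact ⟨(a : ℤ) - b, by push_cast; ring⟩
    rw [this]
    simp

/-- Parseval's formula for absolutely convergent power series on the unit circle. -/
lemma integral_tsum_mul_tsum_conj_uniformCircle {α β : ℕ → ℂ} (hα : Summable fun a => ‖α a‖)
    (hβ : Summable fun a => ‖β a‖) :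
    ∫ w, (∑' a, α a * w ^ a) * (∑' b, β b * conj w ^ b) ∂uniformCircle = ∑' a, α a * β a := by
  have hmeas : ∀ i : ℕ × ℕ, AEStronglyMeasurable
      (fun w : ℂ => (α i.1 * w ^ i.1) * (β i.2 * conj w ^ i.2)) uniformCircle := fun i =>
    Measurable.aestronglyMeasurable (by fun_prop)
  have hnorm : ∀ i : ℕ × ℕ, ∀ᵐ w ∂uniformCircle,
      ‖(α i.1 * w ^ i.1) * (β i.2 * conj w ^ i.2)‖ = ‖α i.1‖ * ‖β i.2‖ := fun i => by
    filter_upwards [ae_norm_eq_one_uniformCircle] with w hw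
    simp [hw]
  have h := hasSum_integral_of_summable_integral_norm (μ := uniformCircle)
    (F := fun (i : ℕ × ℕ) (w : ℂ) => (α i.1 * w ^ i.1) * (β i.2 * conj w ^ i.2))
    (fun i => Integrable.of_bound (hmeas i) (‖α i.1‖ * ‖β i.2‖) ((hnorm i).mono fun w hw => hw.le))
    (by
      have : Summable fun i : ℕ × ℕ => ‖α i.1‖ * ‖β i.2‖ :=
        hα.mul_of_nonneg hβ (fun _ => norm_nonneg _) fun _ => norm_nonneg _
      refine this.congr fun i => ?_
      rw [integral_congr_ae (hnorm i)]
      simp)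
  have h1 : ∫ w, (∑' a, α a * w ^ a) * (∑' b, β b * conj w ^ b) ∂uniformCircle =
      ∫ w, ∑' i : ℕ × ℕ, (α i.1 * w ^ i.1) * (β i.2 * conj w ^ i.2) ∂uniformCircle := by
    refine integral_congr_ae ?_
    filter_upwards [ae_norm_eq_one_uniformCircle] with w hw
    exact tsum_mul_tsum_of_summable_norm (by simpa [hw] using hα) (by simpa [hw] using hβ)
  rw [h1, ← h.tsum_eq]
  have h2 : ∀ i : ℕ × ℕ, ∫ w, (α i.1 * w ^ i.1) * (β i.2 * conj w ^ i.2) ∂uniformCircle =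
      if i.1 = i.2 then α i.1 * β i.2 else 0 := fun i => by
    have : ∀ w : ℂ, (α i.1 * w ^ i.1) * (β i.2 * conj w ^ i.2) =
      (α i.1 * β i.2) * (w ^ i.1 * conj w ^ i.2) := fun w => by ring
    simp only [this]
    rw [integral_const_mul, integral_pow_mul_conj_pow_uniformCircle]
    simp
  simp only [h2]
  have hinj : Function.Injective fun a : ℕ => (a, a) := fun a b h => (Prod.mk.inj h).1
  rw [← hinj.tsum_eq (f := fun i : ℕ × ℕ => if i.1 = i.2 then α i.1 * β i.2 else 0)]
  · simp
  · intro i hi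
    simp only [Function.mem_support, ne_eq, ite_eq_right_iff, not_forall] at hi
    exact ⟨i.1, Prod.ext rfl hi.1⟩

lemma conj_negBinomCoeff (z : ℂ) (a : ℕ) :
    conj (negBinomCoeff z a) = negBinomCoeff (conj z) a := by
  induction a with
  | zero => simp
  | succ a ih => rw [negBinomCoeff_succ, negBinomCoeff_succ, map_mul, ih]; simp

lemma summable_norm_negBinomCoeff (z : ℂ) {x : ℝ} (hx0 : 0 ≤ x) (hx : x < 1) :
    Summable fun a => ‖negBinomCoeff z a * (x : ℂ) ^ a‖ := by
  refine Summable.of_nonneg_of_le (fun a => norm_nonneg _) (fun a => ?_)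
    (hasSum_negBinomCoeffReal ‖z‖ (x := x) (by rwa [abs_of_nonneg hx0])).summable
  rw [norm_mul, norm_pow, Complex.norm_real, Real.norm_of_nonneg hx0]
  gcongr
  exact norm_negBinomCoeff_le le_rfl a

/-- `-log (1 - w x)`, the logarithm of an Euler factor. -/
noncomputable def eulerFactorLog (x : ℝ) (w : ℂ) : ℂ := -Complex.log (1 - w * x)

@[fun_prop]
lemma measurable_eulerFactorLog (x : ℝ) : Measurable (eulerFactorLog x) := by
  unfold eulerFactorLog; fun_prop

/-- The second factor is the conjugate of exp(conj z₂ · (-log(1 - wx))). Both factors are then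
binomial series in w and in conj w, and Parseval keeps the diagonal. -/
lemma integral_exp_eulerFactorLog (z₁ z₂ : ℂ) {x : ℝ} (hx0 : 0 ≤ x) (hx : x < 1) :
    ∫ w, exp (z₁ * eulerFactorLog x w) * exp (z₂ * conj (eulerFactorLog x w)) ∂uniformCircle =
      ∑' a, negBinomCoeff z₁ a * negBinomCoeff z₂ a * ((x : ℂ) ^ 2) ^ a := by
  have hone : ∀ z w : ℂ, ‖w‖ = 1 → exp (z * eulerFactorLog x w) =
      ∑' a, negBinomCoeff z a * (x : ℂ) ^ a * w ^ a := fun z w hw => by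
    rw [eulerFactorLog, ← (hasSum_negBinomCoeff z (x := w * x)
      (by simpa [hw, abs_of_nonneg hx0] using hx)).tsum_eq]
    exact tsum_congr fun a => by ring
  have h : ∀ᵐ w ∂uniformCircle,
      exp (z₁ * eulerFactorLog x w) * exp (z₂ * conj (eulerFactorLog x w)) =
      (∑' a, negBinomCoeff z₁ a * (x : ℂ) ^ a * w ^ a) *
        (∑' a, negBinomCoeff z₂ a * (x : ℂ) ^ a * conj w ^ a) := by
    filter_upwards [ae_norm_eq_one_uniformCircle] with w hw
    have : exp (z₂ * conj (eulerFactorLog x w)) =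
        conj (exp (conj z₂ * eulerFactorLog x w)) := by
      rw [← Complex.exp_conj]; simp
    rw [hone z₁ w hw, this, hone (conj z₂) w hw, Complex.conj_tsum]
    congr 1
    refine tsum_congr fun a => ?_
    simp [conj_negBinomCoeff]
  rw [integral_congr_ae h, integral_tsum_mul_tsum_conj_uniformCircle
    (summable_norm_negBinomCoeff z₁ hx0 hx) (summable_norm_negBinomCoeff z₂ hx0 hx)]
  exact tsum_congr fun a => by ring

/-- The Taylor series of -log(1 - wx) has no constant term: Parseval is applied against the constant
1, and the term a = 0 is x^0/0 = 0 by convention. This centring gives almost sure convergence over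
the primes although ∑ 1/p diverges. -/
lemma integral_eulerFactorLog {x : ℝ} (hx0 : 0 ≤ x) (hx : x < 1) :
    ∫ w, eulerFactorLog x w ∂uniformCircle = 0 := by
  have hβ : Summable fun b : ℕ => ‖(if b = 0 then 1 else 0 : ℂ)‖ :=
    summable_of_ne_finset_zero (s := {0}) fun b hb => by simp at hb; simp [hb]
  have hα : Summable fun a : ℕ => ‖(x : ℂ) ^ a / a‖ := by
    refine Summable.of_nonneg_of_le (fun a => norm_nonneg _) (fun a => ?_)
      (summable_geometric_of_lt_one hx0 hx)
    rw [norm_div, norm_pow, Complex.norm_real, Real.norm_of_nonneg hx0, Complex.norm_natCast]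
    rcases Nat.eq_zero_or_pos a with rfl | ha
    · simp
    · exact div_le_self (by positivity) (by exact_mod_cast ha)
  have h := integral_tsum_mul_tsum_conj_uniformCircle hα hβ
  have h1 : ∫ w, eulerFactorLog x w ∂uniformCircle = ∫ w, (∑' a : ℕ, (x : ℂ) ^ a / a * w ^ a) *
      (∑' b : ℕ, (if b = 0 then 1 else 0 : ℂ) * conj w ^ b) ∂uniformCircle := by
    refine integral_congr_ae ?_
    filter_upwards [ae_norm_eq_one_uniformCircle] with w hw
    have e : (∑' b : ℕ, (if b = 0 then 1 else 0 : ℂ) * conj w ^ b) = 1 := by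
      rw [tsum_eq_single 0 (fun b hb => by simp [hb])]; simp
    rw [e, mul_one, eulerFactorLog, ← (Complex.hasSum_taylorSeries_neg_log (z := w * x)
      (by simpa [hw, abs_of_nonneg hx0] using hx)).tsum_eq]
    exact tsum_congr fun a => by ring
  rw [h1, h]
  refine (tsum_congr fun a => ?_).trans tsum_zero
  rcases Nat.eq_zero_or_pos a with rfl | ha
  · simp
  · simp [ha.ne']

lemma norm_eulerFactorLog_le {x : ℝ} (hx0 : 0 ≤ x) (hx : x ≤ 3 / 4) {w : ℂ} (hw : ‖w‖ = 1) :
    ‖eulerFactorLog x w‖ ≤ 4 * x := by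
  have hn : ‖w * x‖ = x := by simp [hw, abs_of_nonneg hx0]
  refine (norm_neg_log_one_sub_le (x := w * x) (by rw [hn]; linarith)).trans ?_
  rw [hn]
  exact neg_log_one_sub_le hx0 hx

/-! ### Almost sure convergence of random series, and passage to the limit in expectations -/

section Convergence

variable {Ω : Type*} [MeasurableSpace Ω] {P : Measure Ω} [IsProbabilityMeasure P]

/-- Almost sure convergence of a series of independent centered random variables with summable
second moments. -/
lemma ae_exists_tendsto_sum_of_iIndepFun {ξ : ℕ → Ω → ℝ} (hm : ∀ i, Measurable (ξ i))
    (hind : iIndepFun ξ P) {c : ℕ → ℝ} (hb : ∀ i, ∀ᵐ ω ∂P, ‖ξ i ω‖ ≤ c i)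
    (h0 : ∀ i, ∫ ω, ξ i ω ∂P = 0) (hc : Summable fun i => c i ^ 2) :
    ∀ᵐ ω ∂P, ∃ l, Tendsto (fun n => ∑ i ∈ Finset.range n, ξ i ω) atTop (𝓝 l) := by
  have hL2 : ∀ i, MemLp (ξ i) 2 P := fun i =>
    MemLp.of_bound (hm i).aestronglyMeasurable (c i) (hb i)
  -- The index n is included, so that `M n` is adapted to `ℱ n`; the shift by one is undone at the
  -- end.
  set M : ℕ → Ω → ℝ := fun n => ∑ i ∈ Finset.range (n + 1), ξ i with hM
  set ℱ := Filtration.natural ξ fun i => (hm i).stronglyMeasurable with hℱ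
  have hML2 : ∀ n, MemLp (M n) 2 P := fun n => memLp_finsetSum' _ fun i _ => hL2 i
  have hMint : ∀ n, Integrable (M n) P := fun n => (hML2 n).integrable (by norm_num)
  have hadξ : StronglyAdapted ℱ ξ := Filtration.stronglyAdapted_natural _
  have hadM : StronglyAdapted ℱ M := fun n =>
    Finset.stronglyMeasurable_sum _ fun i hi =>
      (hadξ i).mono (ℱ.mono (Nat.lt_succ_iff.1 (Finset.mem_range.1 hi)))
  have hmart : Martingale M ℱ P := by
    refine martingale_nat hadM hMint fun n => ?_
    have e1 : M (n + 1) = M n + ξ (n + 1) := by rw [hM]; simp only; rw [Finset.sum_range_succ]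
    have e2 := hind.condExp_natural_ae_eq_of_lt (fun i => (hm i).stronglyMeasurable) (Nat.lt_succ_self n)
    rw [e1]
    have e3 := condExp_add (hMint n) ((hL2 (n + 1)).integrable (by norm_num)) (ℱ n)
    have e4 : P[M n | ℱ n] = M n := condExp_of_stronglyMeasurable (ℱ.le n) (hadM n) (hMint n)
    filter_upwards [e2, e3] with ω h2 h3
    rw [h3, Pi.add_apply, e4, h2, h0, add_zero]
  have hvar : ∀ n, Var[M n; P] ≤ ∑' i, c i ^ 2 := by
    intro n
    rw [hM, IndepFun.variance_sum (fun i _ => hL2 i) fun i _ j _ hij => hind.indepFun hij]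
    refine le_trans (Finset.sum_le_sum fun i _ => ?_) (hc.sum_le_tsum (Finset.range (n + 1)) fun i _ => sq_nonneg _)
    rw [variance_of_integral_eq_zero (hm i).aemeasurable (h0 i)]
    have : ∫ ω, ξ i ω ^ 2 ∂P ≤ ∫ ω, c i ^ 2 ∂P := by
      refine integral_mono_ae (hL2 i).integrable_sq (integrable_const _) ?_
      filter_upwards [hb i] with ω hω
      exact sq_le_sq' (by linarith [(abs_le.1 hω).1]) ((le_abs_self _).trans hω)
    simpa using this
  -- Martingale convergence asks for a bound in L¹. On a probability space it follows from the L²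
  -- bound, that is, from the variance of a sum of independent centred variables.
  have hbdd : ∀ n, eLpNorm (M n) 1 P ≤ ((∑' i, c i ^ 2).sqrt.toNNReal : NNReal) := by
    intro n
    refine (eLpNorm_le_eLpNorm_of_exponent_le (by norm_num) (hMint n).aestronglyMeasurable).trans
      (b := eLpNorm (M n) 2 P) ?_
    have hM0 : ∫ ω, M n ω ∂P = 0 := by
      simp only [hM, Finset.sum_apply]
      rw [integral_finsetSum _ fun i _ => (hL2 i).integrable (by norm_num)]
      exact Finset.sum_eq_zero fun i _ => h0 i
    have h := hvar n
    rw [variance_of_integral_eq_zero (hMint n).aemeasurable hM0] at h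
    rw [(hML2 n).eLpNorm_eq_integral_rpow_norm (by norm_num) (by norm_num)]
    rw [← ENNReal.ofReal]
    refine ENNReal.ofReal_le_ofReal ?_
    have e : ∫ ω, ‖M n ω‖ ^ (2 : ENNReal).toReal ∂P = ∫ ω, M n ω ^ 2 ∂P := by
      refine integral_congr_ae (Eventually.of_forall fun ω => ?_)
      simp
    rw [e, Real.sqrt_eq_rpow]
    simp only [ENNReal.toReal_ofNat]
    rw [one_div]
    exact Real.rpow_le_rpow (integral_nonneg fun _ => sq_nonneg _) h (by norm_num)
  filter_upwards [hmart.submartingale.exists_ae_tendsto_of_bdd hbdd] with ω hω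
  obtain ⟨l, hl⟩ := hω
  refine ⟨l, (tendsto_add_atTop_iff_nat 1).1 ?_⟩
  simpa [hM] using hl

/-- Convergence of integrals along an almost surely convergent sequence bounded in `L²`. -/
lemma integrable_and_tendsto_integral_of_sq_bounded {f : ℕ → Ω → ℂ} {g : Ω → ℂ} {R : ℝ}
    (hf : ∀ n, AEStronglyMeasurable (f n) P) (hint : ∀ n, Integrable (fun ω => ‖f n ω‖ ^ 2) P)
    (hR : ∀ n, ∫ ω, ‖f n ω‖ ^ 2 ∂P ≤ R)
    (hlim : ∀ᵐ ω ∂P, Tendsto (fun n => f n ω) atTop (𝓝 (g ω))) :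
    Integrable g P ∧ Tendsto (fun n => ∫ ω, f n ω ∂P) atTop (𝓝 (∫ ω, g ω ∂P)) := by
  have hR0 : 0 ≤ R := (integral_nonneg fun _ => sq_nonneg _).trans (hR 0)
  have hl : ∀ n, ∫⁻ ω, ENNReal.ofReal (‖f n ω‖ ^ 2) ∂P ≤ ENNReal.ofReal R := fun n => by
    rw [← ofReal_integral_eq_lintegral_ofReal (hint n) (Eventually.of_forall fun _ => sq_nonneg _)]
    exact ENNReal.ofReal_le_ofReal (hR n)
  have hfL1 : ∀ n, Integrable (f n) P := fun n =>
    ((memLp_two_iff_integrable_sq_norm (hf n)).2 (hint n)).integrable (by norm_num)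
  have hgm : AEStronglyMeasurable g P := aestronglyMeasurable_of_tendsto_ae atTop hf hlim
  have hf1 : ∀ n, eLpNorm (f n) 1 P ≤ ENNReal.ofReal (1 + R) := fun n => by
    rw [eLpNorm_one_eq_lintegral_enorm, ← ofReal_integral_norm_eq_lintegral_enorm (hfL1 n)]
    refine ENNReal.ofReal_le_ofReal ?_
    calc ∫ ω, ‖f n ω‖ ∂P ≤ ∫ ω, (1 + ‖f n ω‖ ^ 2) ∂P :=
          integral_mono (hfL1 n).norm ((integrable_const _).add (hint n)) fun ω => by
            nlinarith [sq_nonneg (‖f n ω‖ - 1), norm_nonneg (f n ω)]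
      _ = 1 + ∫ ω, ‖f n ω‖ ^ 2 ∂P := by
          rw [integral_add (integrable_const _) (hint n)]; simp
      _ ≤ 1 + R := by linarith [hR n]
  have hg1 : MemLp g 1 P := by
    refine ⟨hgm, (Lp.eLpNorm_lim_le_liminf_eLpNorm hf g hlim).trans_lt ?_⟩
    refine lt_of_le_of_lt (liminf_le_of_frequently_le' (Frequently.of_forall hf1)) ENNReal.ofReal_lt_top
  refine ⟨memLp_one_iff_integrable.1 hg1, tendsto_integral_of_L1' g hgm (Eventually.of_forall hfL1)
    (tendsto_Lp_finite_of_tendsto_ae le_rfl (by norm_num) hf hg1 ?_ hlim)⟩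
  refine unifIntegrable_of le_rfl (by norm_num) hf fun ε hε => ?_
  -- Where |f| ≥ C one has |f| ≤ |f|²/C, so the tail is at most R/C, and C = R/ε + 1 makes this at
  -- most ε.
  refine ⟨(R / ε + 1).toNNReal, fun n => ?_⟩
  set C : ℝ := R / ε + 1 with hC
  have hC0 : 0 < C := by positivity
  rw [eLpNorm_one_eq_lintegral_enorm]
  have hpt : ∀ ω, ‖({x | C.toNNReal ≤ ‖f n x‖₊}.indicator (f n)) ω‖ₑ ≤
      ENNReal.ofReal C⁻¹ * ENNReal.ofReal (‖f n ω‖ ^ 2) := fun ω => by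
    by_cases h : ω ∈ {x | C.toNNReal ≤ ‖f n x‖₊}
    · rw [Set.indicator_of_mem h, ← ofReal_norm, ← ENNReal.ofReal_mul (by positivity)]
      refine ENNReal.ofReal_le_ofReal ?_
      have h' : C ≤ ‖f n ω‖ := by
        have := NNReal.coe_le_coe.2 (show C.toNNReal ≤ ‖f n ω‖₊ from h)
        rwa [Real.coe_toNNReal _ hC0.le, coe_nnnorm] at this
      rw [inv_mul_eq_div, le_div_iff₀ hC0]
      nlinarith [norm_nonneg (f n ω)]
    · rw [Set.indicator_of_notMem h]; simp
  refine (lintegral_mono hpt).trans ?_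
  rw [lintegral_const_mul' _ _ ENNReal.ofReal_ne_top]
  refine (mul_le_mul_right (hl n) _).trans ?_
  rw [← ENNReal.ofReal_mul (by positivity)]
  refine ENNReal.ofReal_le_ofReal ?_
  rw [inv_mul_le_iff₀ hC0, hC]
  have : R / ε * ε = R := by field_simp
  nlinarith

end Convergence

/-! ### The random Euler product and its complex moments -/

section EulerProduct

lemma mem_primesUpTo {y : ℕ} {p : Nat.Primes} : p ∈ primesUpTo y ↔ (p : ℕ) ≤ y := by
  rw [primesUpTo]
  exact Finset.mem_subtype.trans Finset.mem_Iic

lemma prod_primesUpTo {M : Type*} [CommMonoid M] (f : ℕ → M) (y : ℕ) :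
    ∏ p ∈ primesUpTo y, f p = ∏ p ∈ (y + 1).primesBelow, f p := by
  refine Finset.prod_bij (fun p _ => (p : ℕ)) (fun p hp => ?_) (fun p _ q _ h => Subtype.ext h)
    (fun p hp => ?_) fun p _ => rfl
  · exact Nat.mem_primesBelow.2 ⟨Nat.lt_succ_iff.2 (mem_primesUpTo.1 hp), p.prop⟩
  · obtain ⟨h1, h2⟩ := Nat.mem_primesBelow.1 hp
    exact ⟨⟨p, h2⟩, mem_primesUpTo.2 (Nat.lt_succ_iff.1 h1), rfl⟩

/-- The `n`-th prime, counted from `0`. -/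
noncomputable def nthPrime (n : ℕ) : Nat.Primes := ⟨Nat.nth Nat.Prime n, Nat.prime_nth_prime n⟩

lemma nthPrime_injective : Function.Injective nthPrime := fun _ _ h =>
  Nat.nth_injective Nat.infinite_setOfPred_prime (Subtype.ext_iff.1 h)

/-- Enumerating the primes turns truncation at y into partial sums of a series over ℕ, the form
needed by the martingale argument. -/
lemma sum_primesUpTo {M : Type*} [AddCommMonoid M] (f : Nat.Primes → M) (y : ℕ) :
    ∑ p ∈ primesUpTo y, f p = ∑ i ∈ Finset.range (Nat.count Nat.Prime (y + 1)), f (nthPrime i) := by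
  symm
  refine Finset.sum_bij (fun i _ => nthPrime i) (fun i hi => ?_) (fun i _ j _ h => nthPrime_injective h)
    (fun p hp => ?_) fun i _ => rfl
  · rw [mem_primesUpTo]
    exact Nat.lt_succ_iff.1 (Nat.nth_lt_of_lt_count (Finset.mem_range.1 hi))
  · refine ⟨Nat.count Nat.Prime p, Finset.mem_range.2 ?_, Subtype.ext (Nat.nth_count p.prop)⟩
    exact Nat.count_strict_mono p.prop (Nat.lt_succ_iff.2 (mem_primesUpTo.1 hp))

lemma tendsto_count_prime : Tendsto (fun y => Nat.count Nat.Prime (y + 1)) atTop atTop := by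
  refine tendsto_atTop_mono' _ ?_ (tendsto_atTop_atTop_of_monotone (Nat.count_monotone Nat.Prime)
    fun b => ⟨Nat.nth Nat.Prime b, ?_⟩)
  · exact Eventually.of_forall fun y => Nat.count_monotone _ (Nat.le_succ y)
  · rw [Nat.count_nth_of_infinite Nat.infinite_setOfPred_prime]

variable {Ω : Type*} [MeasurableSpace Ω] {P : Measure Ω} [IsProbabilityMeasure P]
  {X : Nat.Primes → Ω → ℂ}

lemma logEulerProductUpTo_eq (x : Nat.Primes → ℂ) (y : ℕ) :
    logEulerProductUpTo x y = ∑ p ∈ primesUpTo y, eulerFactorLog (((p : ℕ) : ℝ)⁻¹) (x p) := by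
  refine Finset.sum_congr rfl fun p _ => ?_
  rw [eulerFactorLog]
  push_cast
  rw [div_eq_mul_inv]

lemma inv_prime_le (p : Nat.Primes) : (((p : ℕ) : ℝ)⁻¹) ≤ 3 / 4 := by
  have := prime_rpow_le (σ := 1) (by norm_num) p
  rwa [Real.rpow_neg_one] at this

lemma summable_sq_inv_nthPrime : Summable fun i => (4 * (((nthPrime i : Nat.Primes) : ℕ) : ℝ)⁻¹) ^ 2 := by
  have h := (summable_prime_rpow (σ := 2) (by norm_num)).comp_injective nthPrime_injective
  refine (h.mul_left 16).congr fun i => ?_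
  simp only [Function.comp_apply]
  rw [Real.rpow_neg (by positivity), mul_pow, inv_pow]
  norm_num

lemma ae_norm_eq_one (hX : ∀ p, Measurable (X p)) (hlaw : ∀ p, P.map (X p) = uniformCircle) :
    ∀ᵐ ω ∂P, ∀ p, ‖X p ω‖ = 1 := by
  rw [ae_all_iff]
  intro p
  have := ae_norm_eq_one_uniformCircle
  rw [← hlaw p] at this
  exact ae_of_ae_map (hX p).aemeasurable this

/-- Real and imaginary parts are series of independent centred variables bounded by 4/p, and ∑ 1/p²
converges. -/
lemma ae_exists_tendsto_logEulerProductUpTo (hX : ∀ p, Measurable (X p))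
    (hlaw : ∀ p, P.map (X p) = uniformCircle) (hind : iIndepFun X P) :
    ∀ᵐ ω ∂P, ∃ l, Tendsto (logEulerProductUpTo fun p => X p ω) atTop (𝓝 l) := by
  set x : ℕ → ℝ := fun i => (((nthPrime i : Nat.Primes) : ℕ) : ℝ)⁻¹ with hx
  have hx0 : ∀ i, 0 ≤ x i := fun i => by positivity
  have hx1 : ∀ i, x i ≤ 3 / 4 := fun i => inv_prime_le _
  have hnorm := ae_norm_eq_one hX hlaw
  have hind' : iIndepFun (fun i => X (nthPrime i)) P := hind.precomp nthPrime_injective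
  have hzero : ∀ i, ∫ ω, eulerFactorLog (x i) (X (nthPrime i) ω) ∂P = 0 := fun i => by
    rw [← integral_map (φ := X (nthPrime i)) (f := eulerFactorLog (x i)) (hX _).aemeasurable
      (measurable_eulerFactorLog _).aestronglyMeasurable, hlaw,
      integral_eulerFactorLog (hx0 i) (by linarith [hx1 i])]
  have hint : ∀ i, Integrable (fun ω => eulerFactorLog (x i) (X (nthPrime i) ω)) P := fun i =>
    Integrable.of_bound ((measurable_eulerFactorLog _).comp (hX _)).aestronglyMeasurable (4 * x i)
      (hnorm.mono fun ω hω => norm_eulerFactorLog_le (hx0 i) (hx1 i) (hω _))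
  have hre := ae_exists_tendsto_sum_of_iIndepFun (P := P) (c := fun i => 4 * x i)
    (ξ := fun i ω => (eulerFactorLog (x i) (X (nthPrime i) ω)).re)
    (fun i => Complex.measurable_re.comp ((measurable_eulerFactorLog _).comp (hX _)))
    (hind'.comp (fun i w => (eulerFactorLog (x i) w).re)
      fun i => Complex.measurable_re.comp (measurable_eulerFactorLog _))
    (fun i => hnorm.mono fun ω hω => (abs_re_le_norm _).trans
      (norm_eulerFactorLog_le (hx0 i) (hx1 i) (hω _)))
    (fun i => by
      have := integral_re (hint i)
      rw [hzero] at this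
      simpa using this) summable_sq_inv_nthPrime
  have him := ae_exists_tendsto_sum_of_iIndepFun (P := P) (c := fun i => 4 * x i)
    (ξ := fun i ω => (eulerFactorLog (x i) (X (nthPrime i) ω)).im)
    (fun i => Complex.measurable_im.comp ((measurable_eulerFactorLog _).comp (hX _)))
    (hind'.comp (fun i w => (eulerFactorLog (x i) w).im)
      fun i => Complex.measurable_im.comp (measurable_eulerFactorLog _))
    (fun i => hnorm.mono fun ω hω => (abs_im_le_norm _).trans
      (norm_eulerFactorLog_le (hx0 i) (hx1 i) (hω _)))
    (fun i => by
      have := integral_im (hint i)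
      rw [hzero] at this
      simpa using this) summable_sq_inv_nthPrime
  filter_upwards [hre, him] with ω ⟨a, ha⟩ ⟨b, hb⟩
  refine ⟨a + b * I, ?_⟩
  have h1 : Tendsto (fun n => ∑ i ∈ Finset.range n, eulerFactorLog (x i) (X (nthPrime i) ω)) atTop
      (𝓝 (a + b * I)) := by
    have h2 := ((Complex.continuous_ofReal.tendsto _).comp ha).add
      (((Complex.continuous_ofReal.tendsto _).comp hb).mul_const I)
    refine h2.congr fun n => ?_
    simp only [Function.comp_apply]
    push_cast
    rw [Finset.sum_mul, ← Finset.sum_add_distrib]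
    exact Finset.sum_congr rfl fun i _ => Complex.re_add_im _
  refine (h1.comp tendsto_count_prime).congr fun y => ?_
  rw [logEulerProductUpTo_eq, sum_primesUpTo, Function.comp_apply]

lemma exp_logEulerProductUpTo {x : Nat.Primes → ℂ} (hx : ∀ p, ‖x p‖ = 1) (y : ℕ) :
    exp (logEulerProductUpTo x y) = eulerProductUpTo x y := by
  rw [logEulerProductUpTo, Complex.exp_sum, eulerProductUpTo]
  refine Finset.prod_congr rfl fun p _ => ?_
  rw [Complex.exp_neg, Complex.exp_log]
  intro h
  have h1 : x p / ((p : ℕ) : ℂ) = 1 := (sub_eq_zero.1 h).symm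
  have h2 : ‖x p / ((p : ℕ) : ℂ)‖ ≤ 3 / 4 := by
    rw [norm_div, hx, Complex.norm_natCast, one_div]
    exact inv_prime_le p
  rw [h1] at h2
  norm_num at h2

lemma ae_tendsto_eulerProductUpTo (hX : ∀ p, Measurable (X p))
    (hlaw : ∀ p, P.map (X p) = uniformCircle) (hind : iIndepFun X P) :
    ∀ᵐ ω ∂P,
      Tendsto (eulerProductUpTo fun p => X p ω) atTop (𝓝 (eulerL fun p => X p ω)) ∧
      Tendsto (logEulerProductUpTo fun p => X p ω) atTop (𝓝 (logEulerL fun p => X p ω)) ∧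
      Complex.exp (logEulerL fun p => X p ω) = eulerL fun p => X p ω := by
  filter_upwards [ae_exists_tendsto_logEulerProductUpTo hX hlaw hind, ae_norm_eq_one hX hlaw]
    with ω hω hn
  have h1 : Tendsto (logEulerProductUpTo fun p => X p ω) atTop (𝓝 (logEulerL fun p => X p ω)) :=
    tendsto_nhds_limUnder hω
  have h2 : Tendsto (eulerProductUpTo fun p => X p ω) atTop
      (𝓝 (exp (logEulerL fun p => X p ω))) :=
    ((Complex.continuous_exp.tendsto _).comp h1).congr fun y => exp_logEulerProductUpTo hn y
  have h3 : (eulerL fun p => X p ω) = exp (logEulerL fun p => X p ω) := h2.limUnder_eq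
  exact ⟨h3 ▸ h2, h1, h3.symm⟩

/-- By independence the expectation splits over the primes p ≤ y, and Parseval evaluates each
factor. -/
lemma integral_exp_logEulerProductUpTo (hX : ∀ p, Measurable (X p))
    (hlaw : ∀ p, P.map (X p) = uniformCircle) (hind : iIndepFun X P) (z₁ z₂ : ℂ) (y : ℕ) :
    ∫ ω, exp (z₁ * logEulerProductUpTo (fun p => X p ω) y) *
        exp (z₂ * conj (logEulerProductUpTo (fun p => X p ω) y)) ∂P =
      ∏ p ∈ (y + 1).primesBelow,
        ∑' a : ℕ, negBinomCoeff z₁ a * negBinomCoeff z₂ a * (((p : ℂ) ^ 2)⁻¹) ^ a := by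
  set g : Nat.Primes → ℂ → ℂ := fun p w => exp (z₁ * eulerFactorLog (((p : ℕ) : ℝ)⁻¹) w) *
    exp (z₂ * conj (eulerFactorLog (((p : ℕ) : ℝ)⁻¹) w)) with hg
  have hgm : ∀ p, Measurable (g p) := fun p => by simp only [hg]; fun_prop
  have h1 : ∀ ω, exp (z₁ * logEulerProductUpTo (fun p => X p ω) y) *
      exp (z₂ * conj (logEulerProductUpTo (fun p => X p ω) y)) =
      ∏ p : primesUpTo y, g p (X p ω) := fun ω => by
    rw [Finset.prod_coe_sort (primesUpTo y) (fun p => g p (X p ω)), logEulerProductUpTo_eq, map_sum,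
      Finset.mul_sum, Finset.mul_sum, Complex.exp_sum, Complex.exp_sum, ← Finset.prod_mul_distrib]
  have hind2 : iIndepFun (fun (p : primesUpTo y) ω => g p (X p ω)) P :=
    (hind.precomp (g := fun p : primesUpTo y => (p : Nat.Primes)) Subtype.val_injective).comp
      (fun p => g p) fun p => hgm p
  simp only [h1]
  rw [hind2.integral_fun_prod_eq_prod_integral fun p => ((hgm p).comp (hX p)).aestronglyMeasurable,
    Finset.prod_coe_sort (primesUpTo y) (fun p => ∫ ω, g p (X p ω) ∂P), ← prod_primesUpTo]
  refine Finset.prod_congr rfl fun p _ => ?_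
  rw [← integral_map (φ := X p) (f := g p) (hX p).aemeasurable (hgm p).aestronglyMeasurable, hlaw,
    integral_exp_eulerFactorLog z₁ z₂ (by positivity) (by linarith [inv_prime_le p])]
  refine tsum_congr fun a => ?_
  push_cast
  rw [inv_pow]

/-- With S the truncated logarithm and w = z₁ + conj z₂, the squared modulus of exp(z₁ S) exp(z₂
conj S) is exp(w S) exp(conj w · conj S). Its expectation is therefore a truncated moment as well
and converges with y; this is the L² bound that justifies the limit. -/
lemma integrable_and_hasSum_moment (hX : ∀ p, Measurable (X p))
    (hlaw : ∀ p, P.map (X p) = uniformCircle) (hind : iIndepFun X P) (z₁ z₂ : ℂ) :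
    Integrable (fun ω => eulerLPow (fun p => X p ω) z₁ * eulerLConjPow (fun p => X p ω) z₂) P ∧
    HasSum (fun n : ℕ => divisorFun z₁ n * divisorFun z₂ n / (n : ℂ) ^ 2)
      (∫ ω, eulerLPow (fun p => X p ω) z₁ * eulerLConjPow (fun p => X p ω) z₂ ∂P) := by
  set S : ℕ → Ω → ℂ := fun y ω => logEulerProductUpTo (fun p => X p ω) y with hS
  have hSm : ∀ y, Measurable (S y) := fun y => by
    simp only [hS, logEulerProductUpTo_eq]
    exact Finset.measurable_sum _ fun p _ => (measurable_eulerFactorLog _).comp (hX p)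
  have hnorm := ae_norm_eq_one hX hlaw
  have hSb : ∀ y, ∃ B, ∀ᵐ ω ∂P, ‖S y ω‖ ≤ B := fun y =>
    ⟨∑ p ∈ primesUpTo y, 4 * (((p : ℕ) : ℝ)⁻¹), by
      filter_upwards [hnorm] with ω hω
      simp only [hS, logEulerProductUpTo_eq]
      exact norm_sum_le_of_le _ fun p _ => norm_eulerFactorLog_le (by positivity) (inv_prime_le p) (hω p)⟩
  set F : ℕ → Ω → ℂ := fun y ω => exp (z₁ * S y ω) * exp (z₂ * conj (S y ω)) with hF
  have hFm : ∀ y, Measurable (F y) := fun y => by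
    have := hSm y
    simp only [hF]; fun_prop
  set w : ℂ := z₁ + conj z₂ with hw
  have hsq : ∀ y ω, ((‖F y ω‖ ^ 2 : ℝ) : ℂ) = exp (w * S y ω) * exp (conj w * conj (S y ω)) := by
    intro y ω
    push_cast
    rw [← Complex.mul_conj', hF]
    simp only [map_mul, ← Complex.exp_conj, ← Complex.exp_add]
    congr 1
    simp [hw]
    ring
  have hFi : ∀ y, Integrable (fun ω => ‖F y ω‖ ^ 2) P := fun y => by
    obtain ⟨B, hB⟩ := hSb y
    refine Integrable.of_bound ((hFm y).norm.pow_const 2).aestronglyMeasurable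
      ((Real.exp (‖z₁‖ * B) * Real.exp (‖z₂‖ * B)) ^ 2) (hB.mono fun ω hω => ?_)
    rw [Real.norm_of_nonneg (by positivity), hF]
    simp only [norm_mul]
    gcongr
    · refine (Complex.norm_exp_le_exp_norm _).trans (Real.exp_le_exp.2 ?_)
      rw [norm_mul]; gcongr
    · refine (Complex.norm_exp_le_exp_norm _).trans (Real.exp_le_exp.2 ?_)
      rw [norm_mul, Complex.norm_conj]; gcongr
  have hlimsq := ((tendsto_prod_tsum_negBinomCoeff w (conj w)).comp (tendsto_add_atTop_nat 1)).norm
  obtain ⟨R, hR⟩ := hlimsq.bddAbove_range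
  have hRb : ∀ y, ∫ ω, ‖F y ω‖ ^ 2 ∂P ≤ R := fun y => by
    have h1 : ((∫ ω, ‖F y ω‖ ^ 2 ∂P : ℝ) : ℂ) = ∏ p ∈ (y + 1).primesBelow,
        ∑' a : ℕ, negBinomCoeff w a * negBinomCoeff (conj w) a * (((p : ℂ) ^ 2)⁻¹) ^ a := by
      rw [← integral_exp_logEulerProductUpTo hX hlaw hind, ← integral_complex_ofReal]
      exact integral_congr_ae (Eventually.of_forall fun ω => hsq y ω)
    have h2 : ‖((∫ ω, ‖F y ω‖ ^ 2 ∂P : ℝ) : ℂ)‖ ≤ R := by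
      rw [h1]; exact hR ⟨y, rfl⟩
    rw [Complex.norm_real] at h2
    exact (le_abs_self _).trans h2
  have hlim : ∀ᵐ ω ∂P, Tendsto (fun y => F y ω) atTop
      (𝓝 (eulerLPow (fun p => X p ω) z₁ * eulerLConjPow (fun p => X p ω) z₂)) := by
    filter_upwards [ae_tendsto_eulerProductUpTo hX hlaw hind] with ω hω
    have h := hω.2.1
    have hc : Continuous fun s : ℂ => exp (z₁ * s) * exp (z₂ * conj s) := by fun_prop
    exact (hc.tendsto _).comp h
  obtain ⟨h1, h2⟩ := integrable_and_tendsto_integral_of_sq_bounded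
    (fun y => (hFm y).aestronglyMeasurable) hFi hRb hlim
  refine ⟨h1, ?_⟩
  have h3 := (tendsto_prod_tsum_negBinomCoeff z₁ z₂).comp (tendsto_add_atTop_nat 1)
  have h4 : Tendsto (fun y => ∫ ω, F y ω ∂P) atTop
      (𝓝 (∑' n : ℕ, divisorFun z₁ n * divisorFun z₂ n / (n : ℂ) ^ 2)) :=
    h3.congr fun y => (integral_exp_logEulerProductUpTo hX hlaw hind z₁ z₂ y).symm
  rw [tendsto_nhds_unique h2 h4]
  exact (summable_norm_divisorFun_mul_divisorFun z₁ z₂).of_norm.hasSum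

end EulerProduct

/-! ### Approximation of `ζ` by partial sums in Re s > 0 -/

section Approximation

/-- `(s - 1)` times the difference of `(n + 1) ^ (-s)` and `∫ x in n..n + 1, x ^ (-s)`. -/
noncomputable def zetaRemainderTerm (n : ℕ) (s : ℂ) : ℂ :=
  (s - 1) * ((n + 1 : ℕ) : ℂ) ^ (-s) - ((n : ℂ) ^ (1 - s) - ((n + 1 : ℕ) : ℂ) ^ (1 - s))

lemma differentiable_zetaRemainderTerm {n : ℕ} (hn : 1 ≤ n) :
    Differentiable ℂ (zetaRemainderTerm n) := by
  have h1 : (n : ℂ) ≠ 0 := by exact_mod_cast (Nat.pos_of_ne_zero (by omega)).ne'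
  have h2 : ((n + 1 : ℕ) : ℂ) ≠ 0 := by exact_mod_cast Nat.succ_ne_zero n
  intro s
  unfold zetaRemainderTerm
  refine ((differentiableAt_id.sub_const 1).mul (differentiableAt_id.neg.const_cpow (Or.inl h2))).sub
    (((differentiableAt_id.const_sub 1).const_cpow (Or.inl h1)).sub
      ((differentiableAt_id.const_sub 1).const_cpow (Or.inl h2)))

/-- Replaces n^(-σ-1) by a telescoping difference. The 8 is 2³: n + 1 ≤ 2n, and the exponent -σ - 1
is at least -3. -/
lemma rpow_neg_sub_one_le_sub {n : ℕ} (hn : 1 ≤ n) {σ : ℝ} (h0 : 0 < σ) (h2 : σ ≤ 2) :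
    (n : ℝ) ^ (-σ - 1) ≤ 8 / σ * ((n : ℝ) ^ (-σ) - ((n + 1 : ℕ) : ℝ) ^ (-σ)) := by
  have hn' : (1 : ℝ) ≤ n := by exact_mod_cast hn
  have hn0 : (0 : ℝ) < n := by linarith
  have hm0 : (0 : ℝ) < ((n + 1 : ℕ) : ℝ) := by push_cast; linarith
  set m : ℝ := ((n + 1 : ℕ) : ℝ) with hm
  have hmn : m = n + 1 := by rw [hm]; push_cast; rfl
  have key : m ^ (-σ) * (1 + σ / m) ≤ (n : ℝ) ^ (-σ) := by
    have e : (n : ℝ) = m * (n / m) := by field_simp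
    rw [e, Real.mul_rpow hm0.le (by positivity)]
    gcongr
    rw [Real.rpow_def_of_pos (by positivity)]
    have h := Real.log_le_sub_one_of_pos (x := n / m) (by positivity)
    have h' : (n : ℝ) / m - 1 = -(1 / m) := by rw [hmn]; field_simp; ring
    have := Real.add_one_le_exp (Real.log (n / m) * -σ)
    have h3 : σ / m = σ * (1 / m) := by ring
    nlinarith
  have h4 : (m : ℝ) ^ (-σ - 1) * σ ≤ (n : ℝ) ^ (-σ) - m ^ (-σ) := by
    rw [Real.rpow_sub_one hm0.ne']
    have : m ^ (-σ) / m * σ = m ^ (-σ) * (σ / m) := by ring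
    linarith
  have h5 : (n : ℝ) ^ (-σ - 1) ≤ 8 * m ^ (-σ - 1) := by
    have : (2 * n : ℝ) ^ (-σ - 1) ≤ m ^ (-σ - 1) :=
      Real.rpow_le_rpow_of_nonpos hm0 (by rw [hmn]; linarith) (by linarith)
    rw [Real.mul_rpow (by norm_num) hn0.le] at this
    have h6 : (2 : ℝ) ^ (-(3 : ℝ)) ≤ 2 ^ (-σ - 1) :=
      Real.rpow_le_rpow_of_exponent_le (by norm_num) (by linarith)
    have h7 : (2 : ℝ) ^ (-(3 : ℝ)) = 1 / 8 := by
      rw [Real.rpow_neg (by norm_num)]; norm_num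
    have h8 : 0 < (n : ℝ) ^ (-σ - 1) := by positivity
    rw [h7] at h6
    have := mul_le_mul_of_nonneg_right h6 h8.le
    linarith
  rw [div_mul_eq_mul_div, le_div_iff₀ h0]
  nlinarith

lemma norm_zetaRemainderTerm_le {n : ℕ} (hn : 1 ≤ n) {s : ℂ} (hs : 0 < s.re) :
    ‖zetaRemainderTerm n s‖ ≤ ‖s - 1‖ * ‖s‖ * (n : ℝ) ^ (-s.re - 1) := by
  have hn' : (1 : ℝ) ≤ n := by exact_mod_cast hn
  rcases eq_or_ne s 1 with rfl | hs1
  · simp [zetaRemainderTerm]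
  have hs1' : 1 - s ≠ 0 := sub_ne_zero.2 hs1.symm
  have hint : ∫ x in (n : ℝ)..((n + 1 : ℕ) : ℝ), (x : ℂ) ^ (-s) =
      (((n + 1 : ℕ) : ℂ) ^ (1 - s) - (n : ℂ) ^ (1 - s)) / (1 - s) := by
    rw [integral_cpow]
    · push_cast
      rw [show -s + 1 = 1 - s by ring]
    · right
      refine ⟨fun h => hs1 (by rw [← neg_neg s, h, neg_neg]), ?_⟩
      rw [Set.uIcc_of_le (by push_cast; linarith)]
      intro h
      linarith [h.1]
  have hconst : ∫ _x in (n : ℝ)..((n + 1 : ℕ) : ℝ), ((n + 1 : ℕ) : ℂ) ^ (-s) = ((n + 1 : ℕ) : ℂ) ^ (-s) := by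
    rw [intervalIntegral.integral_const]; push_cast; simp
  have hcont : IntervalIntegrable (fun x : ℝ => (x : ℂ) ^ (-s)) volume n ((n + 1 : ℕ) : ℝ) := by
    apply intervalIntegral.intervalIntegrable_cpow
    right
    rw [Set.uIcc_of_le (by push_cast; linarith)]
    intro h
    linarith [h.1]
  have hrep : zetaRemainderTerm n s = (s - 1) *
      ∫ x in (n : ℝ)..((n + 1 : ℕ) : ℝ), (((n + 1 : ℕ) : ℂ) ^ (-s) - (x : ℂ) ^ (-s)) := by
    rw [intervalIntegral.integral_sub (intervalIntegrable_const) hcont, hconst, hint, mul_sub,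
      zetaRemainderTerm]
    field_simp
    ring
  have hbound : ∀ x ∈ Set.Icc (n : ℝ) ((n + 1 : ℕ) : ℝ),
      ‖((n + 1 : ℕ) : ℂ) ^ (-s) - (x : ℂ) ^ (-s)‖ ≤ ‖s‖ * (n : ℝ) ^ (-s.re - 1) := by
    intro x hx
    have h := (convex_Icc (n : ℝ) ((n + 1 : ℕ) : ℝ)).norm_image_sub_le_of_norm_hasDerivWithin_le
      (f := fun x : ℝ => (x : ℂ) ^ (-s)) (f' := fun x : ℝ => -s * (x : ℂ) ^ (-s - 1))
      (C := ‖s‖ * (n : ℝ) ^ (-s.re - 1))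
      (fun y hy => by
        have hy0 : y ≠ 0 := by linarith [hy.1]
        exact (hasDerivAt_ofReal_cpow_const hy0
          (by simpa using fun h : s = 0 => by simp [h] at hs)).hasDerivWithinAt)
      (fun y hy => by
        have hy0 : 0 < y := by linarith [hy.1]
        rw [norm_mul, norm_neg, Complex.norm_cpow_eq_rpow_re_of_pos hy0]
        gcongr
        simp only [sub_re, neg_re, one_re]
        exact Real.rpow_le_rpow_of_nonpos (by linarith) hy.1 (by linarith))
      hx (show ((n + 1 : ℕ) : ℝ) ∈ Set.Icc (n : ℝ) ((n + 1 : ℕ) : ℝ) from ⟨by push_cast; linarith, le_rfl⟩)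
    have h1 : ‖((n + 1 : ℕ) : ℝ) - x‖ ≤ 1 := by
      rw [Real.norm_eq_abs, abs_le]
      have := hx.1; have := hx.2
      push_cast at *
      constructor <;> linarith
    calc _ ≤ ‖s‖ * (n : ℝ) ^ (-s.re - 1) * ‖((n + 1 : ℕ) : ℝ) - x‖ := by simpa using h
      _ ≤ _ := mul_le_of_le_one_right (by positivity) h1
  rw [hrep, norm_mul, mul_assoc]
  gcongr
  have := intervalIntegral.norm_integral_le_of_norm_le_const (a := (n : ℝ)) (b := ((n + 1 : ℕ) : ℝ))
    (f := fun x : ℝ => ((n + 1 : ℕ) : ℂ) ^ (-s) - (x : ℂ) ^ (-s))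
    (C := ‖s‖ * (n : ℝ) ^ (-s.re - 1)) (fun x hx => by
      rw [Set.uIoc_of_le (by push_cast; linarith)] at hx
      exact hbound x ⟨hx.1.le, hx.2⟩)
  simpa using this

lemma tendsto_rpow_neg_natCast {σ : ℝ} (h0 : 0 < σ) :
    Tendsto (fun n : ℕ => (n : ℝ) ^ (-σ)) atTop (𝓝 0) :=
  (tendsto_rpow_neg_atTop h0).comp tendsto_natCast_atTop_atTop

lemma hasSum_rpow_sub {N : ℕ} (hN : 1 ≤ N) {σ : ℝ} (h0 : 0 < σ) :
    HasSum (fun n : ℕ => ((n + N : ℕ) : ℝ) ^ (-σ) - ((n + N + 1 : ℕ) : ℝ) ^ (-σ))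
      ((N : ℝ) ^ (-σ)) := by
  rw [hasSum_iff_tendsto_nat_of_nonneg (fun n => ?_)]
  · have h : ∀ m : ℕ, ∑ n ∈ Finset.range m,
        (((n + N : ℕ) : ℝ) ^ (-σ) - ((n + N + 1 : ℕ) : ℝ) ^ (-σ)) =
        (N : ℝ) ^ (-σ) - ((m + N : ℕ) : ℝ) ^ (-σ) := fun m => by
      have := Finset.sum_range_sub' (fun n : ℕ => ((n + N : ℕ) : ℝ) ^ (-σ)) m
      rw [zero_add] at this
      rw [← this]
      exact Finset.sum_congr rfl fun n _ => by rw [Nat.add_right_comm]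
    simp only [h]
    have := ((tendsto_rpow_neg_natCast h0).comp (tendsto_add_atTop_nat N)).const_sub ((N : ℝ) ^ (-σ))
    simpa using this
  · rw [sub_nonneg]
    exact Real.rpow_le_rpow_of_nonpos (by exact_mod_cast (by omega : 0 < n + N)) (by push_cast; linarith)
      (by linarith)

lemma summable_rpow_neg_sub_one {N : ℕ} {σ : ℝ} (h0 : 0 < σ) :
    Summable fun n : ℕ => ((n + N : ℕ) : ℝ) ^ (-σ - 1) :=
  (summable_nat_add_iff (f := fun n : ℕ => (n : ℝ) ^ (-σ - 1)) N).2
    (Real.summable_nat_rpow.2 (by linarith))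

lemma tsum_rpow_neg_sub_one_le {N : ℕ} (hN : 1 ≤ N) {σ : ℝ} (h0 : 0 < σ) (h2 : σ ≤ 2) :
    ∑' n : ℕ, ((n + N : ℕ) : ℝ) ^ (-σ - 1) ≤ 8 / σ * (N : ℝ) ^ (-σ) := by
  have h := (hasSum_rpow_sub hN h0).mul_left (8 / σ)
  rw [← h.tsum_eq]
  exact (summable_rpow_neg_sub_one h0).tsum_le_tsum
    (fun n => rpow_neg_sub_one_le_sub (by omega) h0 h2) h.summable

lemma differentiableOn_tsum_zetaRemainderTerm {N : ℕ} (hN : 1 ≤ N) :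
    DifferentiableOn ℂ (fun s => ∑' n : ℕ, zetaRemainderTerm (n + N) s) {s | 0 < s.re} := by
  intro s hs
  have hs : 0 < s.re := hs
  set U : Set ℂ := {w | s.re / 2 < w.re} ∩ Metric.ball 0 (‖s‖ + 1) with hU
  have hUo : IsOpen U := (Complex.isOpen_re_gt _).inter Metric.isOpen_ball
  have hsU : s ∈ U := ⟨show s.re / 2 < s.re by linarith, by simp⟩
  refine ((differentiableOn_tsum_of_summable_norm
    (u := fun n : ℕ => (‖s‖ + 2) * (‖s‖ + 1) * ((n + N : ℕ) : ℝ) ^ (-(s.re / 2) - 1))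
    ((summable_rpow_neg_sub_one (by linarith)).mul_left _)
    (fun n => (differentiable_zetaRemainderTerm (by omega)).differentiableOn) hUo ?_).differentiableAt
    (hUo.mem_nhds hsU)).differentiableWithinAt
  intro n w hw
  have hw1 : s.re / 2 < w.re := hw.1
  have hw2 : ‖w‖ < ‖s‖ + 1 := by simpa using hw.2
  refine (norm_zetaRemainderTerm_le (by omega) (by linarith)).trans ?_
  have h1 : ‖w - 1‖ ≤ ‖s‖ + 2 := (norm_sub_le _ _).trans (by rw [norm_one]; linarith)
  have h2 : (1 : ℝ) ≤ ((n + N : ℕ) : ℝ) := by exact_mod_cast (by omega : 1 ≤ n + N)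
  gcongr

/-- For Re s > 1 the differences n^(1-s) - (n+1)^(1-s) telescope; the identity theorem extends the
formula to Re s > 0. Using `riemannZeta₁`, which is (s - 1)ζ(s) with the pole removed, keeps both
sides holomorphic on a convex domain. -/
lemma riemannZeta₁_eq {N : ℕ} (hN : 1 ≤ N) {s : ℂ} (hs : 0 < s.re) :
    riemannZeta₁ s = (s - 1) * ∑ n ∈ Finset.Icc 1 N, (n : ℂ) ^ (-s) + (N : ℂ) ^ (1 - s) +
      ∑' n : ℕ, zetaRemainderTerm (n + N) s := by
  have hopen : IsOpen {w : ℂ | 0 < w.re} := Complex.isOpen_re_gt 0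
  have hd : DifferentiableOn ℂ (fun s => (s - 1) * ∑ n ∈ Finset.Icc 1 N, (n : ℂ) ^ (-s) +
      (N : ℂ) ^ (1 - s) + ∑' n : ℕ, zetaRemainderTerm (n + N) s) {w | 0 < w.re} := by
    have hN0 : (N : ℂ) ≠ 0 := by exact_mod_cast (by omega : N ≠ 0)
    refine DifferentiableOn.add (Differentiable.differentiableOn ?_)
      (differentiableOn_tsum_zetaRemainderTerm hN)
    refine ((differentiable_id.sub_const 1).mul (Differentiable.fun_sum fun n hn => ?_)).add
      ((differentiable_id.const_sub 1).const_cpow (Or.inl hN0))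
    have hn0 : (n : ℂ) ≠ 0 := by
      exact_mod_cast (by have := (Finset.mem_Icc.1 hn).1; omega : n ≠ 0)
    exact differentiable_id.neg.const_cpow (Or.inl hn0)
  have h2 : (2 : ℂ) ∈ {w : ℂ | 0 < w.re} := by simp
  have han : AnalyticOnNhd ℂ riemannZeta₁ {w : ℂ | 0 < w.re} :=
    differentiable_riemannZeta₁.differentiableOn.analyticOnNhd hopen
  refine han.eqOn_of_preconnected_of_eventuallyEq (hd.analyticOnNhd hopen)
    (convex_halfSpace_re_gt 0).isPreconnected h2 ?_ hs
  filter_upwards [(Complex.isOpen_re_gt 1).mem_nhds (show (1 : ℝ) < (2 : ℂ).re by simp)] with w hw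
  have hw : 1 < w.re := hw
  have hw1 : w ≠ 1 := fun h => by simp [h] at hw
  have hw1' : w - 1 ≠ 0 := sub_ne_zero.2 hw1
  have hz : riemannZeta₁ w = (w - 1) * riemannZeta w := by
    rw [riemannZeta_eq_inv_sub_mul hw1]; field_simp
  have hs0 : Summable fun n : ℕ => (n : ℂ) ^ (-w) := by
    simpa only [Complex.cpow_neg, one_div] using Complex.summable_one_div_nat_cpow.2 hw
  have hζ : riemannZeta w = ∑' n : ℕ, (n : ℂ) ^ (-w) := by
    rw [zeta_eq_tsum_one_div_nat_cpow hw]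
    simp only [Complex.cpow_neg, one_div]
  have hsplit : ∑' n : ℕ, (n : ℂ) ^ (-w) = ∑ n ∈ Finset.Icc 1 N, (n : ℂ) ^ (-w) +
      ∑' n : ℕ, ((n + N + 1 : ℕ) : ℂ) ^ (-w) := by
    rw [← hs0.sum_add_tsum_nat_add (N + 1)]
    congr 1
    have hw0 : (-w) ≠ 0 := fun h => by rw [neg_eq_zero] at h; simp [h] at hw; linarith
    rw [Finset.range_eq_Ico, Finset.sum_eq_sum_Ico_succ_bot (Nat.succ_pos N), Nat.cast_zero,
      Complex.zero_cpow hw0, zero_add]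
    rfl
  have hs1 : Summable fun n : ℕ => ((n + N + 1 : ℕ) : ℂ) ^ (-w) :=
    (summable_nat_add_iff (f := fun n : ℕ => (n : ℂ) ^ (-w)) (N + 1)).2 hs0
  have hsr : Summable fun n : ℕ => zetaRemainderTerm (n + N) w :=
    Summable.of_norm_bounded ((summable_rpow_neg_sub_one (N := N) (by linarith : 0 < w.re)).mul_left
      (‖w - 1‖ * ‖w‖)) fun n => norm_zetaRemainderTerm_le (by omega) (by linarith)
  have htel : HasSum (fun n : ℕ => ((n + N : ℕ) : ℂ) ^ (1 - w) - ((n + N + 1 : ℕ) : ℂ) ^ (1 - w))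
      ((N : ℂ) ^ (1 - w)) := by
    have hsum : Summable fun n : ℕ => ((n + N : ℕ) : ℂ) ^ (1 - w) - ((n + N + 1 : ℕ) : ℂ) ^ (1 - w) := by
      refine ((hs1.mul_left (w - 1)).sub hsr).congr fun n => ?_
      rw [zetaRemainderTerm]; ring
    rw [hsum.hasSum_iff_tendsto_nat]
    have h : ∀ m : ℕ, ∑ n ∈ Finset.range m,
        (((n + N : ℕ) : ℂ) ^ (1 - w) - ((n + N + 1 : ℕ) : ℂ) ^ (1 - w)) =
        (N : ℂ) ^ (1 - w) - ((m + N : ℕ) : ℂ) ^ (1 - w) := fun m => by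
      have := Finset.sum_range_sub' (fun n : ℕ => ((n + N : ℕ) : ℂ) ^ (1 - w)) m
      rw [zero_add] at this
      rw [← this]
      exact Finset.sum_congr rfl fun n _ => by rw [Nat.add_right_comm]
    simp only [h]
    have h0 : Tendsto (fun n : ℕ => (n : ℂ) ^ (1 - w)) atTop (𝓝 0) := by
      rw [tendsto_zero_iff_norm_tendsto_zero]
      refine (tendsto_rpow_neg_natCast (σ := w.re - 1) (by linarith)).congr' ?_
      filter_upwards [eventually_ge_atTop 1] with n hn
      rw [Complex.norm_natCast_cpow_of_pos hn]; simp
    have := (h0.comp (tendsto_add_atTop_nat N)).const_sub ((N : ℂ) ^ (1 - w))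
    simpa using this
  have hr : ∑' n : ℕ, zetaRemainderTerm (n + N) w =
      (w - 1) * ∑' n : ℕ, ((n + N + 1 : ℕ) : ℂ) ^ (-w) - (N : ℂ) ^ (1 - w) := by
    rw [← tsum_mul_left, ← htel.tsum_eq, ← (hs1.mul_left (w - 1)).tsum_sub htel.summable]
    rfl
  rw [hz, hζ, hsplit, hr]
  ring

/-- Approximation of `ζ` by a partial sum of its Dirichlet series in the half plane `Re s > 0`. -/
lemma norm_riemannZeta_sub_le {N : ℕ} (hN : 1 ≤ N) {s : ℂ} (hs : 0 < s.re) (hs2 : s.re ≤ 2)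
    (hs1 : s ≠ 1) :
    ‖riemannZeta s - ∑ n ∈ Finset.Icc 1 N, (n : ℂ) ^ (-s)‖ ≤
      (N : ℝ) ^ (1 - s.re) / ‖s - 1‖ + 8 / s.re * ‖s‖ * (N : ℝ) ^ (-s.re) := by
  have hne : s - 1 ≠ 0 := sub_ne_zero.2 hs1
  have hpos : 0 < ‖s - 1‖ := norm_pos_iff.2 hne
  have hb : ‖∑' n : ℕ, zetaRemainderTerm (n + N) s‖ ≤
      ‖s - 1‖ * ‖s‖ * (8 / s.re * (N : ℝ) ^ (-s.re)) := by
    refine (tsum_of_norm_bounded ((summable_rpow_neg_sub_one hs).hasSum.mul_left (‖s - 1‖ * ‖s‖))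
      fun n => norm_zetaRemainderTerm_le (by omega) hs).trans ?_
    gcongr
    exact tsum_rpow_neg_sub_one_le hN hs hs2
  have e : riemannZeta s - ∑ n ∈ Finset.Icc 1 N, (n : ℂ) ^ (-s) =
      (N : ℂ) ^ (1 - s) / (s - 1) + (∑' n : ℕ, zetaRemainderTerm (n + N) s) / (s - 1) := by
    rw [riemannZeta_eq_inv_sub_mul hs1, riemannZeta₁_eq hN hs]
    field_simp
    ring
  rw [e]
  refine (norm_add_le _ _).trans (add_le_add ?_ ?_)
  · rw [norm_div, Complex.norm_natCast_cpow_of_pos (by omega)]; simp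
  · rw [norm_div, div_le_iff₀ hpos]
    refine hb.trans (le_of_eq (by ring))

end Approximation

/-! ### Classical bounds for `ζ` and `log ζ` at the line Re s = 1 -/

section NearOneLine

lemma natCast_rpow_one_sub_le {L σ : ℝ} (hL : 0 < L) (hσ : 1 - 1 / L ≤ σ) {n : ℕ} (hn : 1 ≤ n)
    (hnL : (n : ℝ) ≤ Real.exp L) : (n : ℝ) ^ (1 - σ) ≤ 3 := by
  have hn' : (1 : ℝ) ≤ n := by exact_mod_cast hn
  calc (n : ℝ) ^ (1 - σ) ≤ (n : ℝ) ^ (1 / L) :=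
        Real.rpow_le_rpow_of_exponent_le hn' (by linarith)
    _ ≤ (Real.exp L) ^ (1 / L) := Real.rpow_le_rpow (by positivity) hnL (by positivity)
    _ = Real.exp 1 := by rw [← Real.exp_mul]; congr 1; field_simp
    _ ≤ 3 := Real.exp_one_lt_three.le

/-- The partial sum has length about e^L, at least of the order of |s|, so the error of the
approximation is bounded. For 1 - σ ≤ 1/L and n ≤ e^L the factor n^(1-σ) is below 3, so the sum is
at most three times a harmonic sum. -/
lemma norm_riemannZeta_le {L : ℝ} (hL : 2 ≤ L) {s : ℂ} (h1 : 1 - 1 / L ≤ s.re) (h2 : s.re ≤ 2)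
    (hi1 : 1 ≤ |s.im|) (hi2 : |s.im| ≤ Real.exp L) : ‖riemannZeta s‖ ≤ 200 * L := by
  have hL0 : 0 < L := by linarith
  have hinv : 1 / L ≤ 1 / 2 := one_div_le_one_div_of_le (by norm_num) hL
  have hre : 1 / 2 ≤ s.re := by linarith
  have hE : 4 ≤ Real.exp L := by
    have h := Real.add_one_le_exp (1 : ℝ)
    have : Real.exp 2 ≤ Real.exp L := Real.exp_le_exp.2 hL
    have h3 : Real.exp 2 = Real.exp 1 * Real.exp 1 := by rw [← Real.exp_add]; norm_num
    nlinarith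
  set N : ℕ := ⌊Real.exp L⌋₊ with hN
  have hN1 : 1 ≤ N := Nat.le_floor (by push_cast; linarith)
  have hNle : (N : ℝ) ≤ Real.exp L := Nat.floor_le (by positivity)
  have hNge : Real.exp L / 2 ≤ N := by
    have := Nat.lt_floor_add_one (Real.exp L)
    rw [← hN] at this
    linarith
  have hN0 : (0 : ℝ) < N := by linarith
  have hs1 : s ≠ 1 := fun h => by rw [h] at hi1; norm_num at hi1
  have hs1' : 1 ≤ ‖s - 1‖ := hi1.trans (by simpa using abs_im_le_norm (s - 1))
  have hsn : ‖s‖ ≤ 2 * Real.exp L := by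
    refine (Complex.norm_le_abs_re_add_abs_im s).trans ?_
    rw [abs_of_pos (by linarith)]
    linarith
  have hsum : ‖∑ n ∈ Finset.Icc 1 N, (n : ℂ) ^ (-s)‖ ≤ 3 * (1 + L) := by
    have hH := harmonic_le_one_add_log N
    rw [harmonic_eq_sum_Icc] at hH
    push_cast at hH
    have hlog : Real.log N ≤ L := (Real.log_le_iff_le_exp hN0).2 hNle
    calc ‖∑ n ∈ Finset.Icc 1 N, (n : ℂ) ^ (-s)‖ ≤ ∑ n ∈ Finset.Icc 1 N, 3 * ((n : ℝ))⁻¹ := by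
          refine norm_sum_le_of_le _ fun n hn => ?_
          obtain ⟨hn1, hn2⟩ := Finset.mem_Icc.1 hn
          have hn0 : (0 : ℝ) < n := by exact_mod_cast hn1
          rw [Complex.norm_natCast_cpow_of_pos hn1, neg_re,
            show -s.re = (1 - s.re) - 1 by ring, Real.rpow_sub_one hn0.ne', div_eq_mul_inv]
          gcongr
          exact natCast_rpow_one_sub_le hL0 h1 hn1 (le_trans (by exact_mod_cast hn2) hNle)
      _ = 3 * ∑ n ∈ Finset.Icc 1 N, ((n : ℝ))⁻¹ := by rw [Finset.mul_sum]
      _ ≤ 3 * (1 + L) := by linarith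
  have hap := norm_riemannZeta_sub_le hN1 (by linarith : 0 < s.re) h2 hs1
  have hrp := natCast_rpow_one_sub_le hL0 h1 hN1 hNle
  have hA : (N : ℝ) ^ (1 - s.re) / ‖s - 1‖ ≤ 3 :=
    (div_le_self (by positivity) hs1').trans hrp
  have hB : 8 / s.re * ‖s‖ * (N : ℝ) ^ (-s.re) ≤ 192 := by
    have e1 : (N : ℝ) ^ (-s.re) ≤ 3 * (2 / Real.exp L) := by
      rw [show -s.re = (1 - s.re) - 1 by ring, Real.rpow_sub_one hN0.ne', div_eq_mul_inv]
      have : (N : ℝ)⁻¹ ≤ 2 / Real.exp L := by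
        rw [inv_le_comm₀ hN0 (by positivity), inv_div]; exact hNge
      gcongr
    have e2 : 8 / s.re ≤ 16 := by rw [div_le_iff₀ (by linarith)]; linarith
    calc _ ≤ 16 * (2 * Real.exp L) * (3 * (2 / Real.exp L)) := by gcongr
      _ = 192 := by field_simp; norm_num
  have := norm_le_norm_add_norm_sub' (riemannZeta s) (∑ n ∈ Finset.Icc 1 N, (n : ℂ) ^ (-s))
  linarith

/-- Cauchy's estimate on the circle of radius 1/L, which stays in the region where |ζ| ≤ 200 L. -/
lemma norm_deriv_riemannZeta_le {L : ℝ} (hL : 2 ≤ L) {s : ℂ} (h1 : 1 ≤ s.re) (h2 : s.re ≤ 3 / 2)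
    (hi1 : 2 ≤ |s.im|) (hi2 : |s.im| + 1 ≤ Real.exp L) :
    ‖deriv riemannZeta s‖ ≤ 200 * L ^ 2 := by
  have hL0 : 0 < L := by linarith
  have hinv : 1 / L ≤ 1 / 2 := one_div_le_one_div_of_le (by norm_num) hL
  have hmem : ∀ z ∈ Metric.closedBall s (1 / L), |z.re - s.re| ≤ 1 / L ∧ |z.im - s.im| ≤ 1 / L := by
    intro z hz
    rw [mem_closedBall_iff_norm] at hz
    have h1 := abs_re_le_norm (z - s)
    have h2 := abs_im_le_norm (z - s)
    rw [sub_re] at h1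
    rw [sub_im] at h2
    exact ⟨h1.trans hz, h2.trans hz⟩
  have him : ∀ z ∈ Metric.closedBall s (1 / L), 1 ≤ |z.im| ∧ |z.im| ≤ |s.im| + 1 := by
    intro z hz
    have h := (hmem z hz).2
    have h3 := abs_sub_abs_le_abs_sub s.im z.im
    have h4 := abs_sub_abs_le_abs_sub z.im s.im
    rw [abs_sub_comm] at h3
    constructor <;> linarith
  have h := Complex.norm_deriv_le_of_forall_mem_sphere_norm_le (f := riemannZeta) (c := s)
    (C := 200 * L) (show 0 < 1 / L by positivity)
    (DifferentiableOn.diffContOnCl (fun z hz => (differentiableAt_riemannZeta fun h => by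
      rw [closure_ball _ (by positivity)] at hz
      have := (him z hz).1
      rw [h] at this
      norm_num at this).differentiableWithinAt))
    (fun z hz => by
      have hz' := Metric.sphere_subset_closedBall hz
      have h3 := abs_le.1 (hmem z hz').1
      exact norm_riemannZeta_le hL (by linarith) (by linarith) (him z hz').1
        ((him z hz').2.trans hi2))
  refine h.trans (le_of_eq ?_)
  field_simp

/-- The inequality |ζ(σ)³ ζ(σ + it)⁴ ζ(σ + 2it)| ≥ 1, with ζ(σ) ≤ 2/(σ - 1) and |ζ(σ + 2it)| ≤ 200
L; thus 1600 = 2³ · 200. -/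
lemma pow_three_le_norm_riemannZeta_pow_four {L σ t : ℝ} (hL : 2 ≤ L) (h1 : 1 < σ) (h2 : σ ≤ 2)
    (ht : 1 ≤ |t|) (ht2 : 2 * |t| ≤ Real.exp L) :
    (σ - 1) ^ 3 ≤ 1600 * L * ‖riemannZeta (σ + t * I)‖ ^ 4 := by
  have hσ : 0 < σ - 1 := by linarith
  have h := DirichletCharacter.norm_LFunction_product_ge_one (N := 1) 1 hσ t
  rw [DirichletCharacter.LFunctionTrivChar, DirichletCharacter.LFunction_modOne_eq,
    DirichletCharacter.LFunction_modOne_eq, norm_mul, norm_mul, norm_pow, norm_pow] at h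
  have e0 : (1 : ℂ) + ((σ - 1 : ℝ) : ℂ) = σ := by push_cast; ring
  have e1 : (σ : ℂ) + I * t = σ + t * I := by ring
  rw [e0, e1] at h
  have b0 : ‖riemannZeta σ‖ ≤ 2 / (σ - 1) := by
    rw [← exp_logZetaEuler (by simpa using h1), logZetaEuler_ofReal h1, ← Complex.ofReal_exp,
      Complex.norm_real, Real.norm_of_nonneg (Real.exp_pos _).le]
    refine (exp_logZetaReal_le h1).trans ?_
    rw [add_div' _ _ _ hσ.ne']
    gcongr
    linarith
  have b2 : ‖riemannZeta (σ + 2 * I * t)‖ ≤ 200 * L := by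
    have him : ((σ : ℂ) + 2 * I * t).im = 2 * t := by simp
    have hre : ((σ : ℂ) + 2 * I * t).re = σ := by simp
    refine norm_riemannZeta_le hL ?_ (by rw [hre]; exact h2) ?_ ?_
    · rw [hre]
      have : 0 < 1 / L := by positivity
      linarith
    · rw [him, abs_mul, abs_two]; linarith
    · rw [him, abs_mul, abs_two]; exact ht2
  have hpow : ‖riemannZeta σ‖ ^ 3 ≤ (2 / (σ - 1)) ^ 3 := by gcongr
  have hprod : (1 : ℝ) ≤ (2 / (σ - 1)) ^ 3 * ‖riemannZeta (σ + t * I)‖ ^ 4 * (200 * L) :=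
    h.le.trans (by gcongr)
  have e3 : (2 / (σ - 1)) ^ 3 * ‖riemannZeta (σ + t * I)‖ ^ 4 * (200 * L) =
      (1600 * L * ‖riemannZeta (σ + t * I)‖ ^ 4) / (σ - 1) ^ 3 := by
    rw [div_pow]; ring
  rw [e3, le_div_iff₀ (by positivity)] at hprod
  linarith

lemma logDeriv_riemannZeta_continuousAt {s : ℂ} (h1 : s ≠ 1) (h0 : riemannZeta s ≠ 0) :
    ContinuousAt (logDeriv riemannZeta) s := by
  have han : AnalyticAt ℂ riemannZeta s :=
    (DifferentiableOn.analyticOnNhd (s := {w : ℂ | w ≠ 1})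
      (fun x hx => (differentiableAt_riemannZeta hx).differentiableWithinAt) isOpen_ne) s h1
  exact han.deriv.continuousAt.div han.continuousAt h0

lemma continuous_logDeriv_riemannZeta_vertical {σ : ℝ} (hσ : 1 < σ) :
    Continuous fun u : ℝ => logDeriv riemannZeta (σ + u * I) := by
  rw [continuous_iff_continuousAt]
  intro u
  have hre : ((σ : ℂ) + u * I).re = σ := by simp
  have hc : ContinuousAt (logDeriv riemannZeta) ((σ : ℂ) + u * I) :=
    logDeriv_riemannZeta_continuousAt (fun h => by rw [h] at hre; simp at hre; linarith)
      (riemannZeta_ne_zero_of_one_le_re (by rw [hre]; exact hσ.le))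
  exact ContinuousAt.comp (f := fun u : ℝ => (σ : ℂ) + u * I) hc (by fun_prop)

lemma continuousOn_logDeriv_riemannZeta_horizontal {t : ℝ} (ht : t ≠ 0) :
    ContinuousOn (fun σ : ℝ => logDeriv riemannZeta (σ + t * I)) (Set.Ici 1) := by
  intro σ hσ
  have hσ : 1 ≤ σ := hσ
  have hre : ((σ : ℂ) + t * I).re = σ := by simp
  have him : ((σ : ℂ) + t * I).im = t := by simp
  have hc : ContinuousAt (logDeriv riemannZeta) ((σ : ℂ) + t * I) :=
    logDeriv_riemannZeta_continuousAt (fun h => ht (by rw [h] at him; simpa using him.symm))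
      (riemannZeta_ne_zero_of_one_le_re (by rw [hre]; exact hσ))
  exact (ContinuousAt.comp (f := fun σ : ℝ => (σ : ℂ) + t * I) hc (by fun_prop)).continuousWithinAt

lemma log_riemannZeta_two : Complex.log (riemannZeta 2) = logZetaEuler 2 := by
  have h : logZetaEuler 2 = (logZetaReal 2 : ℝ) := by
    have := logZetaEuler_ofReal (σ := 2) (by norm_num)
    simpa using this
  rw [← exp_logZetaEuler (by norm_num), h, ← Complex.ofReal_exp, ← Complex.ofReal_log (Real.exp_pos _).le,
    Real.log_exp]

lemma logZetaEuler_vertical (t : ℝ) :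
    Complex.log (riemannZeta 2) + (∫ u in (0 : ℝ)..t, logDeriv riemannZeta (2 + u * I) * I) =
      logZetaEuler (2 + t * I) := by
  have h := intervalIntegral.integral_eq_sub_of_hasDerivAt (a := 0) (b := t)
    (f := fun u : ℝ => logZetaEuler (2 + u * I))
    (f' := fun u : ℝ => logDeriv riemannZeta (2 + u * I) * I)
    (fun u _ => by
      have h1 : HasDerivAt (fun u : ℝ => (2 : ℂ) + u * I) I u := by
        simpa using ((Complex.ofRealCLM.hasDerivAt (x := u)).mul_const I).const_add (2 : ℂ)
      exact (hasDerivAt_logZetaEuler (s := 2 + u * I) (by simp)).comp u h1)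
    (by
      have := continuous_logDeriv_riemannZeta_vertical (σ := 2) (by norm_num)
      push_cast at this
      exact (this.mul continuous_const).intervalIntegrable _ _)
  rw [h, log_riemannZeta_two]
  simp

/-- For Re s > 1 continuous variation agrees with the sum over primes, so the path through 2 and 2 +
it may be replaced by the short segment from σ + it. -/
lemma logZetaOneLine_eq {t : ℝ} (ht : t ≠ 0) {σ : ℝ} (h1 : 1 < σ) :
    logZetaOneLine t = logZetaEuler (σ + t * I) -
      ∫ x in (1 : ℝ)..σ, logDeriv riemannZeta (x + t * I) := by
  have hcont := continuousOn_logDeriv_riemannZeta_horizontal ht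
  have h := intervalIntegral.integral_eq_sub_of_hasDerivAt (a := σ) (b := 2)
    (f := fun x : ℝ => logZetaEuler (x + t * I))
    (f' := fun x : ℝ => logDeriv riemannZeta (x + t * I))
    (fun x hx => by
      have hx1 : 1 < x := lt_of_lt_of_le (lt_min h1 one_lt_two) hx.1
      have h2 : HasDerivAt (fun x : ℝ => (x : ℂ) + t * I) 1 x := by
        simpa using (Complex.ofRealCLM.hasDerivAt (x := x)).add_const (t * I)
      have := (hasDerivAt_logZetaEuler (s := x + t * I) (by simpa using hx1)).comp x h2
      rwa [mul_one] at this)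
    ((hcont.mono fun x hx => (lt_of_lt_of_le (lt_min h1 one_lt_two) hx.1).le).intervalIntegrable)
  have hi1 : IntervalIntegrable (fun x : ℝ => logDeriv riemannZeta (x + t * I)) volume 1 σ :=
    (hcont.mono fun x hx => by rw [Set.uIcc_of_le h1.le] at hx; exact hx.1).intervalIntegrable
  have hi2 : IntervalIntegrable (fun x : ℝ => logDeriv riemannZeta (x + t * I)) volume σ 2 :=
    (hcont.mono fun x hx => (lt_of_lt_of_le (lt_min h1 one_lt_two) hx.1).le).intervalIntegrable
  rw [logZetaOneLine, logZetaEuler_vertical, ← intervalIntegral.integral_add_adjacent_intervals hi1 hi2, h]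
  push_cast
  ring

/-- The classical bound `log ζ(1 + it) = O(log log t)`. -/
lemma norm_logZetaOneLine_le {L t : ℝ} (hL : 2 ≤ L) (ht : 2 ≤ |t|) (ht2 : 2 * |t| ≤ Real.exp L) :
    ‖logZetaOneLine t‖ ≤ 9 * Real.log L + 34 := by
  have ht0 : t ≠ 0 := fun h => by rw [h] at ht; norm_num at ht
  have hL0 : 0 < L := by linarith
  -- With η of order L^(-9), the 3-4-1 inequality gives |ζ(1 + η + it)| ≫ (η³/L)^(1/4), of order
  -- L^(-7), and the derivative bound moves `ζ` by at most 200 L² η, of the same order. The value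
  -- 1/2800 makes this variation exactly half of the lower bound, so `ζ` stays away from 0 on the
  -- whole segment.
  obtain ⟨a, ha⟩ : ∃ a : ℝ, a = 1 / 2800 := ⟨_, rfl⟩
  have ha0 : 0 < a := by rw [ha]; norm_num
  have ha1 : a ≤ 1 / 2800 := ha.le
  set η : ℝ := a ^ 4 / L ^ 9 with hη
  have hη0 : 0 < η := by positivity
  have hη1 : η ≤ 1 / 2 := by
    rw [hη, div_le_iff₀ (by positivity)]
    have h1 : a ^ 4 ≤ 1 / 2 := by rw [ha]; norm_num
    have h2 : 1 ≤ L ^ 9 := one_le_pow₀ (by linarith)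
    linarith
  have hlow : a ^ 3 / (7 * L ^ 7) ≤ ‖riemannZeta ((1 + η : ℝ) + t * I)‖ := by
    have h := pow_three_le_norm_riemannZeta_pow_four hL (σ := 1 + η) (t := t) (by linarith) (by linarith)
      (by linarith) ht2
    refine le_of_pow_le_pow_left₀ (n := 4) (by norm_num) (norm_nonneg _) ?_
    have e : (a ^ 3 / (7 * L ^ 7)) ^ 4 * (1600 * L) ≤ (1 + η - 1) ^ 3 := by
      have : (1 + η - 1) ^ 3 = a ^ 12 / L ^ 27 := by rw [hη]; ring
      rw [this, div_pow, mul_pow, div_mul_eq_mul_div, div_le_div_iff₀ (by positivity) (by positivity)]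
      have e1 : (a ^ 3) ^ 4 * (1600 * L) * L ^ 27 = 1600 * (a ^ 12 * L ^ 28) := by ring
      have e2 : a ^ 12 * (7 ^ 4 * (L ^ 7) ^ 4) = 2401 * (a ^ 12 * L ^ 28) := by ring
      rw [e1, e2]
      have : 0 ≤ a ^ 12 * L ^ 28 := by positivity
      linarith
    have h3 := e.trans h
    have h4 : 0 < 1600 * L := by positivity
    nlinarith
  have hre : ∀ x : ℝ, ((x : ℂ) + t * I).re = x := fun x => by simp
  have him : ∀ x : ℝ, ((x : ℂ) + t * I).im = t := fun x => by simp
  have hd : ∀ x ∈ Set.Icc 1 (1 + η), ‖deriv riemannZeta (x + t * I)‖ ≤ 200 * L ^ 2 := fun x hx =>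
    norm_deriv_riemannZeta_le hL (by rw [hre]; exact hx.1) (by rw [hre]; linarith [hx.2])
      (by rw [him]; exact ht) (by rw [him]; linarith)
  have hlow' : ∀ x ∈ Set.Icc 1 (1 + η), a ^ 3 / (14 * L ^ 7) ≤ ‖riemannZeta (x + t * I)‖ := by
    intro x hx
    have h := (convex_Icc (1 : ℝ) (1 + η)).norm_image_sub_le_of_norm_hasDerivWithin_le
      (f := fun x : ℝ => riemannZeta (x + t * I)) (f' := fun x : ℝ => deriv riemannZeta (x + t * I))
      (C := 200 * L ^ 2)
      (fun y hy => by
        have h2 : HasDerivAt (fun x : ℝ => (x : ℂ) + t * I) 1 y := by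
          simpa using (Complex.ofRealCLM.hasDerivAt (x := y)).add_const (t * I)
        have h3 : HasDerivAt riemannZeta (deriv riemannZeta (y + t * I)) (y + t * I) :=
          (differentiableAt_riemannZeta fun h => by
            have := him y; rw [h] at this; exact ht0 (by simpa using this.symm)).hasDerivAt
        have h4 := h3.comp y h2
        rw [mul_one] at h4
        exact h4.hasDerivWithinAt)
      hd hx (show 1 + η ∈ Set.Icc 1 (1 + η) from ⟨by linarith, le_rfl⟩)
    have h1 : ‖(1 + η) - x‖ ≤ η := by
      rw [Real.norm_eq_abs, abs_le]
      exact ⟨by linarith [hx.2], by linarith [hx.1]⟩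
    have h2 : 200 * L ^ 2 * ‖(1 + η) - x‖ ≤ a ^ 3 / (14 * L ^ 7) := by
      calc 200 * L ^ 2 * ‖(1 + η) - x‖ ≤ 200 * L ^ 2 * η := by gcongr
        _ = (2800 * a) * (a ^ 3 / (14 * L ^ 7)) := by rw [hη]; field_simp; norm_num
        _ = _ := by rw [ha]; norm_num
    have h3 := norm_sub_norm_le (riemannZeta ((1 + η : ℝ) + t * I)) (riemannZeta (x + t * I))
    have h4 : a ^ 3 / (7 * L ^ 7) = 2 * (a ^ 3 / (14 * L ^ 7)) := by field_simp; norm_num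
    have h5 := h3.trans (h.trans h2)
    linarith
  have hint : ‖∫ x in (1 : ℝ)..(1 + η), logDeriv riemannZeta (x + t * I)‖ ≤ 1 := by
    have h := intervalIntegral.norm_integral_le_of_norm_le_const (a := (1 : ℝ)) (b := 1 + η)
      (f := fun x : ℝ => logDeriv riemannZeta (x + t * I))
      (C := 200 * L ^ 2 / (a ^ 3 / (14 * L ^ 7))) (fun x hx => by
        rw [Set.uIoc_of_le (by linarith)] at hx
        rw [logDeriv_apply, norm_div]
        have hx' : x ∈ Set.Icc 1 (1 + η) := ⟨hx.1.le, hx.2⟩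
        have := hlow' x hx'
        have := hd x hx'
        gcongr)
    refine h.trans (le_of_eq ?_)
    rw [add_sub_cancel_left, abs_of_pos hη0, hη, ha]
    field_simp
    norm_num
  rw [logZetaOneLine_eq ht0 (σ := 1 + η) (by linarith)]
  have hE := norm_logZetaEuler_le (s := ((1 + η : ℝ) : ℂ) + t * I) (by rw [hre]; linarith)
  rw [hre] at hE
  have hZ := logZetaReal_le_log (σ := 1 + η) (by linarith)
  have hlog : Real.log (1 + 1 / (1 + η - 1)) ≤ 9 * Real.log L + 33 := by
    have h1 : 1 + 1 / (1 + η - 1) ≤ 2 / η := by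
      rw [add_sub_cancel_left, ← sub_nonneg]
      have : 2 / η - (1 + 1 / η) = (1 - η) / η := by field_simp; ring
      rw [this]
      exact div_nonneg (by linarith) hη0.le
    have h2 : 2 / η = (2 * 2800 ^ 4) * L ^ 9 := by rw [hη, ha]; field_simp
    refine (Real.log_le_log (by have : 0 < 1 / (1 + η - 1) := by rw [add_sub_cancel_left]; positivity
                                linarith) (h1.trans_eq h2)).trans ?_
    rw [Real.log_mul (by norm_num) (by positivity), Real.log_pow]
    have : Real.log (2 * 2800 ^ 4) ≤ 33 := by
      rw [Real.log_le_iff_le_exp (by norm_num)]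
      have h := Real.exp_one_gt_d9
      calc (2 * 2800 ^ 4 : ℝ) ≤ (2.718 : ℝ) ^ 33 := by norm_num
        _ ≤ (Real.exp 1) ^ 33 := by gcongr; linarith
        _ = Real.exp 33 := by rw [← Real.exp_nat_mul]; norm_num
    push_cast
    linarith
  refine (norm_sub_le _ _).trans ?_
  linarith

end NearOneLine

/-! ### Mean squares of Dirichlet polynomials -/

section MeanValue

/-- |log n - log m| ≥ |n - m|/max(m, n), followed by partial fractions when m < n. The weight n/m is
chosen so that summing over m gives O(n log N). -/
lemma div_abs_log_sub_log_le {m n : ℕ} (hm : 1 ≤ m) (hn : 1 ≤ n) (hmn : m ≠ n) :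
    (n : ℝ) / m / |Real.log n - Real.log m| ≤ n * ((m : ℝ)⁻¹ + |(n : ℝ) - m|⁻¹) := by
  have hm0 : (0 : ℝ) < m := by exact_mod_cast hm
  have hn0 : (0 : ℝ) < n := by exact_mod_cast hn
  rcases lt_or_gt_of_ne hmn with h | h
  · have h' : (m : ℝ) < n := by exact_mod_cast h
    have hd : 0 < (n : ℝ) - m := by linarith
    have hlog : ((n : ℝ) - m) / n ≤ Real.log n - Real.log m := by
      have := Real.log_le_sub_one_of_pos (x := (m : ℝ) / n) (by positivity)
      rw [Real.log_div hm0.ne' hn0.ne'] at this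
      have e : ((n : ℝ) - m) / n = 1 - m / n := by field_simp
      linarith
    have hpos : 0 < ((n : ℝ) - m) / n := by positivity
    rw [abs_of_pos (by linarith), abs_of_pos hd]
    calc (n : ℝ) / m / (Real.log n - Real.log m) ≤ (n : ℝ) / m / (((n : ℝ) - m) / n) := by gcongr
      _ = n * ((m : ℝ)⁻¹ + ((n : ℝ) - m)⁻¹) := by field_simp; ring
  · have h' : (n : ℝ) < m := by exact_mod_cast h
    have hd : 0 < (m : ℝ) - n := by linarith
    have hlog : ((m : ℝ) - n) / m ≤ Real.log m - Real.log n := by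
      have := Real.log_le_sub_one_of_pos (x := (n : ℝ) / m) (by positivity)
      rw [Real.log_div hn0.ne' hm0.ne'] at this
      have e : ((m : ℝ) - n) / m = 1 - n / m := by field_simp
      linarith
    have hpos : 0 < ((m : ℝ) - n) / m := by positivity
    rw [abs_sub_comm, abs_of_pos (by linarith), abs_sub_comm (n : ℝ), abs_of_pos hd]
    calc (n : ℝ) / m / (Real.log m - Real.log n) ≤ (n : ℝ) / m / (((m : ℝ) - n) / m) := by gcongr
      _ = n * ((m : ℝ) - n)⁻¹ := by field_simp
      _ ≤ n * ((m : ℝ)⁻¹ + ((m : ℝ) - n)⁻¹) := by gcongr; simp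

lemma sum_inv_Icc_le {k N : ℕ} (h : k ≤ N) :
    ∑ m ∈ Finset.Icc 1 k, (m : ℝ)⁻¹ ≤ 1 + Real.log N := by
  have hH := harmonic_le_one_add_log N
  rw [harmonic_eq_sum_Icc] at hH
  push_cast at hH
  exact (Finset.sum_le_sum_of_subset_of_nonneg (Finset.Icc_subset_Icc_right h)
    fun _ _ _ => by positivity).trans hH

lemma sum_inv_abs_sub_le {n N : ℕ} (hn : n ∈ Finset.Icc 1 N) :
    ∑ m ∈ (Finset.Icc 1 N).erase n, |(n : ℝ) - m|⁻¹ ≤ 2 * (1 + Real.log N) := by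
  obtain ⟨h1, h2⟩ := Finset.mem_Icc.1 hn
  have hs : (Finset.Icc 1 N).erase n ⊆
      (Finset.Icc 1 (n - 1)).image (fun j => n - j) ∪ (Finset.Icc 1 (N - n)).image (fun j => n + j) := by
    intro m hm
    rw [Finset.mem_erase, Finset.mem_Icc] at hm
    rw [Finset.mem_union, Finset.mem_image, Finset.mem_image]
    rcases lt_or_gt_of_ne hm.1 with h | h
    · exact Or.inl ⟨n - m, Finset.mem_Icc.2 (by omega), by omega⟩
    · exact Or.inr ⟨m - n, Finset.mem_Icc.2 (by omega), by omega⟩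
  refine (Finset.sum_le_sum_of_subset_of_nonneg hs fun _ _ _ => by positivity).trans ?_
  have hle : ∀ (s t : Finset ℕ) (f : ℕ → ℝ), (∀ i, 0 ≤ f i) →
      ∑ i ∈ s ∪ t, f i ≤ ∑ i ∈ s, f i + ∑ i ∈ t, f i := fun s t f hf => by
    rw [← Finset.sum_union_inter]
    exact le_add_of_nonneg_right (Finset.sum_nonneg fun i _ => hf i)
  refine (hle _ _ _ fun _ => by positivity).trans ?_
  rw [Finset.sum_image (fun i hi j hj h => by
      have := (Finset.mem_Icc.1 hi); have := (Finset.mem_Icc.1 hj); have h : n - i = n - j := h; omega),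
    Finset.sum_image (fun i hi j hj h => by simpa using h), two_mul]
  refine add_le_add ?_ ?_
  · refine (le_of_eq (Finset.sum_congr rfl fun j hj => ?_)).trans
      (sum_inv_Icc_le (k := n - 1) (by omega))
    rw [Nat.cast_sub (by have := Finset.mem_Icc.1 hj; omega)]
    simp
  · refine (le_of_eq (Finset.sum_congr rfl fun j hj => ?_)).trans
      (sum_inv_Icc_le (k := N - n) (by omega))
    push_cast
    simp

lemma norm_integral_exp_le {a b ν : ℝ} (hν : ν ≠ 0) :
    ‖∫ t in a..b, Complex.exp (ν * I * t)‖ ≤ 2 / |ν| := by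
  rw [integral_exp_mul_complex (by simpa using hν), norm_div]
  have h1 : ∀ x : ℝ, ‖Complex.exp (ν * I * x)‖ = 1 := fun x => by
    rw [show (ν : ℂ) * I * x = ((ν * x : ℝ) : ℂ) * I by push_cast; ring, Complex.norm_exp_ofReal_mul_I]
  have h2 : ‖(ν : ℂ) * I‖ = |ν| := by simp
  rw [h2]
  gcongr
  refine (norm_sub_le _ _).trans ?_
  rw [h1, h1]; norm_num

/-- A mean value theorem for Dirichlet polynomials, with a logarithmic loss. -/
lemma integral_norm_sq_dirichletPolynomial_le (c : ℕ → ℂ) (N : ℕ) {a b : ℝ} (hab : a ≤ b) :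
    ∫ t in a..b, ‖∑ n ∈ Finset.Icc 1 N, c n * Complex.exp (-(Real.log n * I * t))‖ ^ 2 ≤
      ∑ n ∈ Finset.Icc 1 N, ‖c n‖ ^ 2 * ((b - a) + 6 * n * (1 + Real.log N)) := by
  set S := Finset.Icc 1 N with hS
  set e : ℕ → ℕ → ℂ := fun m n => ∫ t in a..b, Complex.exp ((Real.log n - Real.log m : ℝ) * I * t) with he
  have hexp : ∀ t : ℝ, ((‖∑ n ∈ S, c n * Complex.exp (-(Real.log n * I * t))‖ ^ 2 : ℝ) : ℂ) =
      ∑ m ∈ S, ∑ n ∈ S, (c m * conj (c n)) * Complex.exp ((Real.log n - Real.log m : ℝ) * I * t) := by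
    intro t
    rw [Complex.ofReal_pow, ← Complex.mul_conj', map_sum, Finset.sum_mul_sum]
    refine Finset.sum_congr rfl fun m _ => Finset.sum_congr rfl fun n _ => ?_
    have h3 : conj (Complex.exp (-(Real.log n * I * t))) = Complex.exp (Real.log n * I * t) := by
      rw [← Complex.exp_conj, map_neg, map_mul, map_mul, Complex.conj_ofReal, Complex.conj_I,
        Complex.conj_ofReal]
      congr 1
      ring
    rw [map_mul, h3, mul_mul_mul_comm, ← Complex.exp_add]
    rw [Complex.ofReal_sub]
    congr 2
    ring
  have hint : ((∫ t in a..b, ‖∑ n ∈ S, c n * Complex.exp (-(Real.log n * I * t))‖ ^ 2 : ℝ) : ℂ) =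
      ∑ m ∈ S, ∑ n ∈ S, (c m * conj (c n)) * e m n := by
    rw [← intervalIntegral.integral_ofReal]
    simp only [hexp]
    rw [intervalIntegral.integral_finsetSum fun m _ => Continuous.intervalIntegrable (by fun_prop) _ _]
    refine Finset.sum_congr rfl fun m _ => ?_
    rw [intervalIntegral.integral_finsetSum fun n _ => Continuous.intervalIntegrable (by fun_prop) _ _]
    exact Finset.sum_congr rfl fun n _ => intervalIntegral.integral_const_mul _ _
  have hsymm : ∀ m n, ‖e m n‖ = ‖e n m‖ := fun m n => by
    have : e n m = conj (e m n) := by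
      simp only [he]
      rw [intervalIntegral.integral_of_le hab, intervalIntegral.integral_of_le hab, ← integral_conj]
      refine integral_congr_ae (Eventually.of_forall fun t => ?_)
      simp only
      rw [← Complex.exp_conj, map_mul, map_mul, Complex.conj_ofReal, Complex.conj_I,
        Complex.conj_ofReal, Complex.ofReal_sub, Complex.ofReal_sub]
      congr 1
      ring
    rw [this, Complex.norm_conj]
  have hdiag : ∀ n, ‖e n n‖ = b - a := fun n => by
    simp [he, Complex.norm_real, abs_of_nonneg (sub_nonneg.2 hab), -Complex.ofReal_sub]
  -- Schur's test: the row sums of the kernel `e` with the weight n/m.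
  have hrow : ∀ n ∈ S, ∑ m ∈ S, (n : ℝ) / m * ‖e m n‖ ≤ (b - a) + 6 * n * (1 + Real.log N) := by
    intro n hn
    have hn1 := (Finset.mem_Icc.1 hn).1
    have hn0 : (0 : ℝ) < n := by exact_mod_cast hn1
    rw [← Finset.add_sum_erase _ _ hn, hdiag, div_self hn0.ne', one_mul]
    refine add_le_add le_rfl ?_
    calc ∑ m ∈ S.erase n, (n : ℝ) / m * ‖e m n‖
        ≤ ∑ m ∈ S.erase n, 2 * (n * ((m : ℝ)⁻¹ + |(n : ℝ) - m|⁻¹)) := by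
          refine Finset.sum_le_sum fun m hm => ?_
          have hm1 := (Finset.mem_Icc.1 (Finset.mem_of_mem_erase hm)).1
          have hmn := Finset.ne_of_mem_erase hm
          have hne : Real.log n - Real.log m ≠ 0 := fun h => hmn (by
            have := Real.log_injOn_pos (show (0 : ℝ) < n by exact_mod_cast hn1)
              (show (0 : ℝ) < m by exact_mod_cast hm1) (sub_eq_zero.1 h)
            exact_mod_cast this.symm)
          have h := div_abs_log_sub_log_le hm1 hn1 hmn
          calc (n : ℝ) / m * ‖e m n‖ ≤ (n : ℝ) / m * (2 / |Real.log n - Real.log m|) := by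
                gcongr
                exact norm_integral_exp_le hne
            _ = 2 * ((n : ℝ) / m / |Real.log n - Real.log m|) := by ring
            _ ≤ _ := by gcongr
      _ = 2 * n * (∑ m ∈ S.erase n, (m : ℝ)⁻¹ + ∑ m ∈ S.erase n, |(n : ℝ) - m|⁻¹) := by
          rw [← Finset.sum_add_distrib, Finset.mul_sum]
          exact Finset.sum_congr rfl fun m _ => by ring
      _ ≤ 2 * n * ((1 + Real.log N) + 2 * (1 + Real.log N)) := by
          gcongr
          · exact (Finset.sum_le_sum_of_subset_of_nonneg (Finset.erase_subset _ _)
              fun _ _ _ => by positivity).trans (sum_inv_Icc_le le_rfl)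
          · exact sum_inv_abs_sub_le hn
      _ = 6 * n * (1 + Real.log N) := by ring
  have hnn : 0 ≤ ∫ t in a..b, ‖∑ n ∈ S, c n * Complex.exp (-(Real.log n * I * t))‖ ^ 2 :=
    intervalIntegral.integral_nonneg hab fun _ _ => sq_nonneg _
  have hpos : ∀ n ∈ S, (0 : ℝ) < n := fun n hn => by exact_mod_cast (Finset.mem_Icc.1 hn).1
  calc ∫ t in a..b, ‖∑ n ∈ S, c n * Complex.exp (-(Real.log n * I * t))‖ ^ 2
      = ‖∑ m ∈ S, ∑ n ∈ S, (c m * conj (c n)) * e m n‖ := by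
        rw [← hint, Complex.norm_real, Real.norm_of_nonneg hnn]
    _ ≤ ∑ m ∈ S, ∑ n ∈ S, (‖c n‖ ^ 2 * ((n : ℝ) / m * ‖e m n‖) / 2 +
          ‖c m‖ ^ 2 * ((m : ℝ) / n * ‖e n m‖) / 2) := by
        refine norm_sum_le_of_le _ fun m hm => norm_sum_le_of_le _ fun n hn => ?_
        rw [norm_mul, norm_mul, Complex.norm_conj, hsymm n m]
        have hm0 := hpos m hm
        have hn0 := hpos n hn
        -- Arithmetic–geometric mean with weights n/m and m/n. Since |e m n| is symmetric, the two
        -- halves have the same double sum.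
        have h : ‖c m‖ * ‖c n‖ ≤ ‖c n‖ ^ 2 * ((n : ℝ) / m) / 2 + ‖c m‖ ^ 2 * ((m : ℝ) / n) / 2 := by
          have : ‖c n‖ ^ 2 * ((n : ℝ) / m) / 2 + ‖c m‖ ^ 2 * ((m : ℝ) / n) / 2 - ‖c m‖ * ‖c n‖ =
              (‖c n‖ * n - ‖c m‖ * m) ^ 2 / (2 * m * n) := by
            field_simp
            ring
          have h2 : 0 ≤ (‖c n‖ * n - ‖c m‖ * m) ^ 2 / (2 * m * n) := by positivity
          linarith
        have := mul_le_mul_of_nonneg_right h (norm_nonneg (e m n))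
        linarith
    _ = ∑ n ∈ S, ‖c n‖ ^ 2 * ∑ m ∈ S, (n : ℝ) / m * ‖e m n‖ := by
        simp only [Finset.sum_add_distrib]
        rw [Finset.sum_comm, ← Finset.sum_add_distrib]
        refine Finset.sum_congr rfl fun n _ => ?_
        rw [Finset.mul_sum, ← Finset.sum_add_distrib]
        exact Finset.sum_congr rfl fun m _ => by ring
    _ ≤ _ := Finset.sum_le_sum fun n hn => by gcongr; exact hrow n hn

end MeanValue

/-! ### Dirichlet coefficients of the mollified zeta function -/

section Mollifier

lemma negBinomCoeffReal_two (a : ℕ) : negBinomCoeffReal 2 a = a + 1 := by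
  induction a with
  | zero => simp
  | succ a ih =>
    rw [negBinomCoeffReal_succ, ih]
    have : (a : ℝ) + 1 ≠ 0 := by positivity
    push_cast
    field_simp
    ring

lemma card_divisors_eq_divisorFunReal {n : ℕ} (hn : n ≠ 0) :
    (n.divisors.card : ℝ) = divisorFunReal 2 n := by
  rw [Nat.card_divisors hn, divisorFunReal, primePowFun, if_neg hn]
  push_cast
  simp only [negBinomCoeffReal_two]

/-- The coefficients of the product of `∑_{m ≤ X} μ(m) m⁻ˢ` and `∑_{n ≤ N} n⁻ˢ`. -/
noncomputable def mollifiedCoeff (X N k : ℕ) : ℂ :=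
  ∑ p ∈ (Finset.Icc 1 X ×ˢ Finset.Icc 1 N) with p.1 * p.2 = k, (ArithmeticFunction.moebius p.1 : ℂ)

lemma norm_moebius_le (m : ℕ) : ‖(ArithmeticFunction.moebius m : ℂ)‖ ≤ 1 := by
  rw [Complex.norm_intCast]
  exact_mod_cast ArithmeticFunction.abs_moebius_le_one

/-- The sum runs over some of the factorisations of k, each with |μ| ≤ 1. The number of divisors is
expressed as d₂ so that the mean-square estimate for d_k applies to it. -/
lemma norm_mollifiedCoeff_le {X N k : ℕ} (hk : k ≠ 0) :
    ‖mollifiedCoeff X N k‖ ≤ divisorFunReal 2 k := by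
  rw [← card_divisors_eq_divisorFunReal hk]
  refine (norm_sum_le_of_le _ (n := fun _ => (1 : ℝ)) fun p _ => norm_moebius_le p.1).trans ?_
  rw [Finset.sum_const, nsmul_eq_mul, mul_one]
  have : ((Finset.Icc 1 X ×ˢ Finset.Icc 1 N).filter fun p => p.1 * p.2 = k) ⊆
      k.divisorsAntidiagonal := fun p hp =>
    Nat.mem_divisorsAntidiagonal.2 ⟨(Finset.mem_filter.1 hp).2, hk⟩
  exact_mod_cast (Finset.card_le_card this).trans_eq (by
    rw [← Nat.map_div_right_divisors, Finset.card_map])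

/-- Below both cutoffs all factorisations of k are present, and the Dirichlet convolution of μ with
1 is the unit. -/
lemma mollifiedCoeff_eq_sum {X N k : ℕ} (hk : k ≠ 0) (hX : k ≤ X) (hN : k ≤ N) :
    mollifiedCoeff X N k = if k = 1 then 1 else 0 := by
  have h := congrArg (fun f => f k) (ArithmeticFunction.moebius_mul_coe_zeta)
  simp only [ArithmeticFunction.mul_apply, ArithmeticFunction.one_apply] at h
  have h2 : mollifiedCoeff X N k = ((∑ x ∈ k.divisorsAntidiagonal,
      ArithmeticFunction.moebius x.1 * (ArithmeticFunction.zeta : ArithmeticFunction ℤ) x.2 : ℤ) : ℂ) := by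
    push_cast
    rw [mollifiedCoeff]
    refine Finset.sum_congr ?_ ?_
    · ext p
      simp only [Finset.mem_filter, Finset.mem_product, Finset.mem_Icc, Nat.mem_divisorsAntidiagonal]
      constructor
      · rintro ⟨_, h⟩; exact ⟨h, hk⟩
      · rintro ⟨h, _⟩
        have h0 : p.1 ≠ 0 := by rintro h'; simp [h'] at h; omega
        have h1 : p.2 ≠ 0 := by rintro h'; simp [h'] at h; omega
        have := Nat.le_of_dvd (by omega) (Dvd.intro _ h)
        have := Nat.le_of_dvd (by omega) (Dvd.intro_left _ h)
        omega
    · intro p hp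
      have : p.2 ≠ 0 := by
        have := Nat.mem_divisorsAntidiagonal.1 hp
        rintro h'; simp [h'] at this; omega
      simp [ArithmeticFunction.natCoe_apply, ArithmeticFunction.zeta_apply, this]
  rw [h2, h]
  push_cast
  rfl

lemma sum_mul_sum_eq_sum_mollifiedCoeff (X N : ℕ) (s : ℂ) :
    (∑ n ∈ Finset.Icc 1 N, (n : ℂ) ^ (-s)) *
      (∑ m ∈ Finset.Icc 1 X, (ArithmeticFunction.moebius m : ℂ) * (m : ℂ) ^ (-s)) =
      ∑ k ∈ Finset.Icc 1 (X * N), mollifiedCoeff X N k * (k : ℂ) ^ (-s) := by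
  rw [mul_comm, Finset.sum_mul_sum, ← Finset.sum_product',
    ← Finset.sum_fiberwise_of_maps_to (t := Finset.Icc 1 (X * N)) (g := fun p => p.1 * p.2)]
  · refine Finset.sum_congr rfl fun k _ => ?_
    rw [mollifiedCoeff, Finset.sum_mul]
    refine Finset.sum_congr rfl fun p hp => ?_
    rw [← (Finset.mem_filter.1 hp).2, Nat.cast_mul, Complex.natCast_mul_natCast_cpow, mul_assoc]
  · intro p hp
    obtain ⟨h1, h2⟩ := Finset.mem_product.1 hp
    rw [Finset.mem_Icc] at h1 h2 ⊢
    exact ⟨Nat.mul_pos h1.1 h2.1, Nat.mul_le_mul h1.2 h2.2⟩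

end Mollifier

/-! ### Point values bounded by area means -/

section AreaMeanValue

/-- The value of a holomorphic function at the centre of a disc is at most its mean over the disc. -/
lemma enorm_mul_le_lintegral_ball {f : ℂ → ℂ} {c : ℂ} {R : ℝ} (hR : 0 < R)
    (hf : DifferentiableOn ℂ f (Metric.ball c R)) :
    ‖f c‖ₑ * ENNReal.ofReal (π * R ^ 2) ≤ ∫⁻ w in Metric.ball c R, ‖f w‖ₑ := by
  set g : ℂ → ENNReal := (Metric.ball (0 : ℂ) R).indicator fun w => ‖f (c + w)‖ₑ with hg
  have hfc : ContinuousOn (fun w => ‖f (c + w)‖ₑ) (Metric.ball (0 : ℂ) R) := by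
    refine continuous_enorm.comp_continuousOn (hf.continuousOn.comp (by fun_prop) fun w hw => ?_)
    simpa using hw
  have hgm : Measurable g := by
    classical
    rw [hg, ← Set.piecewise_eq_indicator]
    exact hfc.measurable_piecewise continuousOn_const Metric.isOpen_ball.measurableSet
  have h1 : ∫⁻ w in Metric.ball c R, ‖f w‖ₑ = ∫⁻ w, g w := by
    rw [← lintegral_indicator Metric.isOpen_ball.measurableSet,
      ← lintegral_add_left_eq_self _ c]
    refine lintegral_congr fun w => ?_
    simp [hg, Set.indicator]
  have htarget : (_root_.polarCoord).target = Set.Ioi (0 : ℝ) ×ˢ Set.Ioo (-π) π := rfl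
  rw [h1, ← Complex.lintegral_comp_polarCoord_symm, htarget,
    Measure.volume_eq_prod, ← Measure.prod_restrict, lintegral_prod]
  -- The mean value property on the circle of radius r; integrating over r against r dr yields the
  -- area mean.
  · have key : ∀ r ∈ Set.Ioo (0 : ℝ) R, ‖f c‖ₑ * ENNReal.ofReal (2 * π * r) ≤
        ∫⁻ θ in Set.Ioo (-π) π, ENNReal.ofReal r • g (Complex.polarCoord.symm (r, θ)) := by
      intro r hr
      have hcl : DiffContOnCl ℂ f (Metric.ball c |r|) := by
        rw [abs_of_pos hr.1]
        exact DifferentiableOn.diffContOnCl_ball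
          (hf.mono (Metric.closedBall_subset_ball hr.2)) subset_rfl
      have hav : (2 * π : ℂ) * f c = ∫ θ in (-π)..π, f (circleMap c r θ) := by
        have h2 : ∫ θ in (-π)..π, f (circleMap c r θ) = ∫ θ in (0)..(2 * π), f (circleMap c r θ) := by
          have hper : Function.Periodic (fun θ => f (circleMap c r θ)) (2 * π) := fun θ => by
            simp only [periodic_circleMap c r θ]
          have := hper.intervalIntegral_add_eq (-π) 0
          rwa [show -π + 2 * π = π by ring, zero_add] at this
        rw [h2, ← hcl.circleAverage, Real.circleAverage_def, Complex.real_smul]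
        push_cast
        field_simp
      have hle : ‖f c‖ₑ * ENNReal.ofReal (2 * π) ≤ ∫⁻ θ in Set.Ioo (-π) π, ‖f (circleMap c r θ)‖ₑ := by
        have h3 : ‖(2 * π : ℂ) * f c‖ₑ = ‖f c‖ₑ * ENNReal.ofReal (2 * π) := by
          rw [enorm_mul, mul_comm, show (2 * π : ℂ) = ((2 * π : ℝ) : ℂ) by push_cast; ring,
            ← ofReal_norm, ← ofReal_norm ((2 * π : ℝ) : ℂ), Complex.norm_real,
            Real.norm_of_nonneg (by positivity)]
        rw [← h3, hav, intervalIntegral.integral_of_le (by linarith [Real.pi_pos]),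
          integral_Ioc_eq_integral_Ioo]
        exact enorm_integral_le_lintegral_enorm _
      simp only [smul_eq_mul]
      rw [lintegral_const_mul' _ _ ENNReal.ofReal_ne_top, ENNReal.ofReal_mul (by positivity),
        ← mul_assoc, mul_comm]
      gcongr
      refine hle.trans_eq (lintegral_congr fun θ => ?_)
      have hmem : (Complex.polarCoord.symm (r, θ)) ∈ Metric.ball (0 : ℂ) R := by
        rw [mem_ball_zero_iff, Complex.norm_polarCoord_symm, abs_of_pos hr.1]
        exact hr.2
      rw [hg, Set.indicator_of_mem hmem, Complex.polarCoord_symm_apply, circleMap,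
        Complex.exp_mul_I]
      push_cast
      rfl
    calc ‖f c‖ₑ * ENNReal.ofReal (π * R ^ 2)
        = ∫⁻ r in Set.Ioo (0 : ℝ) R, ‖f c‖ₑ * ENNReal.ofReal (2 * π * r) := by
          rw [lintegral_const_mul' _ _ (by simp)]
          congr 1
          rw [← ofReal_integral_eq_lintegral_ofReal]
          · rw [← integral_Ioc_eq_integral_Ioo, ← intervalIntegral.integral_of_le hR.le,
              intervalIntegral.integral_const_mul, integral_id]
            congr 1
            ring
          · exact (Continuous.integrableOn_Icc (by fun_prop)).mono_set Set.Ioo_subset_Icc_self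
          · filter_upwards [ae_restrict_mem measurableSet_Ioo] with r hr
            have := hr.1
            positivity
      _ ≤ ∫⁻ r in Set.Ioo (0 : ℝ) R,
            ∫⁻ θ in Set.Ioo (-π) π, ENNReal.ofReal r • g (Complex.polarCoord.symm (r, θ)) :=
          setLIntegral_mono' measurableSet_Ioo key
      _ ≤ _ := lintegral_mono_set Set.Ioo_subset_Ioi_self
  · simp only [Complex.polarCoord_symm_apply, smul_eq_mul]
    refine Measurable.aemeasurable (Measurable.mul (by fun_prop) (hgm.comp ?_))
    fun_prop

end AreaMeanValue

/-! ### Mean square of the mollified zeta function minus one -/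

section MollifiedMeanSquare

/-- The Dirichlet polynomial `∑_{m ≤ X} μ(m) m⁻ˢ`. -/
noncomputable def zetaMollifier (X : ℕ) (s : ℂ) : ℂ :=
  ∑ m ∈ Finset.Icc 1 X, (ArithmeticFunction.moebius m : ℂ) * (m : ℂ) ^ (-s)

lemma norm_natCast_cpow_neg {n : ℕ} (hn : 1 ≤ n) (s : ℂ) : ‖(n : ℂ) ^ (-s)‖ = (n : ℝ) ^ (-s.re) := by
  rw [Complex.norm_natCast_cpow_of_pos hn]; simp

lemma norm_zetaMollifier_le (X : ℕ) {s : ℂ} (hs : 0 ≤ s.re) : ‖zetaMollifier X s‖ ≤ X := by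
  refine (norm_sum_le_of_le _ (n := fun _ => (1 : ℝ)) fun m hm => ?_).trans (by simp)
  have hm1 := (Finset.mem_Icc.1 hm).1
  rw [norm_mul, norm_natCast_cpow_neg hm1]
  exact mul_le_one₀ (norm_moebius_le m) (by positivity)
    (Real.rpow_le_one_of_one_le_of_nonpos (by exact_mod_cast hm1) (by linarith))

lemma differentiable_zetaMollifier (X : ℕ) : Differentiable ℂ (zetaMollifier X) := by
  refine Differentiable.fun_sum fun m hm => ?_
  have : (m : ℂ) ≠ 0 := by exact_mod_cast Nat.one_le_iff_ne_zero.1 (Finset.mem_Icc.1 hm).1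
  exact (differentiable_const _).mul
    (differentiable_neg.const_cpow (Or.inl this))

lemma natCast_cpow_neg_eq {n : ℕ} (hn : 1 ≤ n) (σ t : ℝ) :
    (n : ℂ) ^ (-(σ + t * I : ℂ)) = ((n : ℝ) ^ (-σ) : ℝ) * Complex.exp (-(Real.log n * I * t)) := by
  have h : (n : ℂ) ≠ 0 := by exact_mod_cast Nat.one_le_iff_ne_zero.1 hn
  rw [neg_add, Complex.cpow_add _ _ h, Complex.ofReal_cpow (by positivity)]
  push_cast
  congr 1
  rw [Complex.cpow_def_of_ne_zero h]
  congr 1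
  ring

/-- The error in the approximation of `ζ` times the mollifier by a Dirichlet polynomial. -/
lemma norm_riemannZeta_sub_mul_zetaMollifier_le {X : ℕ} (hX : 1 ≤ X) {σ t : ℝ}
    (h1 : 0.95 ≤ σ) (h2 : σ ≤ 1.05) (ht1 : (X : ℝ) ^ 4 / 2 ≤ t) (ht2 : t ≤ 48 * (X : ℝ) ^ 4) :
    ‖(riemannZeta (σ + t * I) - ∑ n ∈ Finset.Icc 1 (X ^ 8), (n : ℂ) ^ (-(σ + t * I : ℂ))) *
      zetaMollifier X (σ + t * I)‖ ≤ 500 / (X : ℝ) ^ 2 := by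
  have hX1 : (1 : ℝ) ≤ X := by exact_mod_cast hX
  have hX0 : (0 : ℝ) < X := by linarith
  have hN1 : (1 : ℝ) ≤ ((X ^ 8 : ℕ) : ℝ) := by exact_mod_cast Nat.one_le_pow _ _ hX
  have hre : (σ + t * I : ℂ).re = σ := by simp
  have hX4 : 1 ≤ (X : ℝ) ^ 4 := one_le_pow₀ hX1
  have ht0 : 0 < t := by linarith
  have hsub := norm_riemannZeta_sub_le (N := X ^ 8) (Nat.one_le_pow _ _ hX) (s := σ + t * I)
    (by rw [hre]; linarith) (by rw [hre]; linarith)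
    (fun h => ht0.ne' (by simpa using congrArg Complex.im h))
  rw [hre] at hsub
  have hs1 : (X : ℝ) ^ 4 / 2 ≤ ‖(σ + t * I : ℂ) - 1‖ := by
    refine ht1.trans ((le_abs_self t).trans ?_)
    simpa using Complex.abs_im_le_norm ((σ + t * I : ℂ) - 1)
  have hs : ‖(σ + t * I : ℂ)‖ ≤ 50 * (X : ℝ) ^ 4 := by
    refine (norm_add_le _ _).trans ?_
    rw [norm_mul, Complex.norm_real, Complex.norm_real, Complex.norm_I, mul_one,
      Real.norm_of_nonneg (by linarith), Real.norm_of_nonneg ht0.le]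
    linarith
  -- Here 1 - σ ≤ 1/20; rounding the exponent up to 1/8 gives an integral power of X, with room to
  -- spare.
  have e1 : ((X ^ 8 : ℕ) : ℝ) ^ (1 - σ) ≤ X := by
    calc ((X ^ 8 : ℕ) : ℝ) ^ (1 - σ) ≤ ((X ^ 8 : ℕ) : ℝ) ^ (1 / 8 : ℝ) :=
          Real.rpow_le_rpow_of_exponent_le hN1 (by linarith)
      _ = X := by
          rw [Nat.cast_pow, ← Real.rpow_natCast, ← Real.rpow_mul hX0.le]; norm_num
  have e2 : ((X ^ 8 : ℕ) : ℝ) ^ (-σ) ≤ ((X : ℝ) ^ 7)⁻¹ := by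
    calc ((X ^ 8 : ℕ) : ℝ) ^ (-σ) ≤ ((X ^ 8 : ℕ) : ℝ) ^ (-(7 / 8) : ℝ) :=
          Real.rpow_le_rpow_of_exponent_le hN1 (by linarith)
      _ = ((X : ℝ) ^ 7)⁻¹ := by
          rw [Nat.cast_pow, ← Real.rpow_natCast, ← Real.rpow_mul hX0.le,
            show ((8 : ℕ) : ℝ) * (-(7 / 8)) = -((7 : ℕ) : ℝ) by norm_num, Real.rpow_neg hX0.le,
            Real.rpow_natCast]
  have e3 : 8 / σ ≤ 9 := by rw [div_le_iff₀ (by linarith)]; linarith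
  rw [norm_mul]
  have hb : ‖riemannZeta (σ + t * I) - ∑ n ∈ Finset.Icc 1 (X ^ 8), (n : ℂ) ^ (-(σ + t * I : ℂ))‖ ≤
      500 / (X : ℝ) ^ 3 := by
    calc _ ≤ _ := hsub
      _ ≤ X / ((X : ℝ) ^ 4 / 2) + 9 * (50 * (X : ℝ) ^ 4) * ((X : ℝ) ^ 7)⁻¹ := by gcongr
      _ = 452 / (X : ℝ) ^ 3 := by field_simp; norm_num
      _ ≤ _ := by gcongr; norm_num
  calc _ ≤ 500 / (X : ℝ) ^ 3 * X := by
        gcongr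
        exact norm_zetaMollifier_le X (by rw [hre]; linarith)
    _ = _ := by field_simp

/-- Terms with k ≤ X vanish. For k > X, k^(-2σ) ≤ k^(-1.2) k^(-0.7): the first factor keeps the
divisor series convergent. The second, against a length O(X⁴) and a loss O(k log X) with k ≤ X⁹,
leaves at most X^3.3 and X^3.2 up to constants, a saving of a power over X⁴. -/
lemma norm_sq_mollifiedCoeff_mul_le {X k : ℕ} (hX : 1 ≤ X) (hk : k ∈ Finset.Icc 1 (X * X ^ 8))
    {σ : ℝ} (h1 : 0.95 ≤ σ) {l : ℝ} (hl0 : 0 ≤ l) (hl : l ≤ 48 * (X : ℝ) ^ 4) :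
    ‖(mollifiedCoeff X (X ^ 8) k - if k = 1 then 1 else 0) * ((k : ℝ) ^ (-σ) : ℝ)‖ ^ 2 *
      (l + 6 * k * (1 + Real.log (X * X ^ 8 : ℕ))) ≤
      200 * (X : ℝ) ^ (7 / 2 : ℝ) * (divisorFunReal 2 k ^ 2 * ((k : ℝ) ^ (-0.6 : ℝ)) ^ 2) := by
  obtain ⟨hk1, hk2⟩ := Finset.mem_Icc.1 hk
  have hX1 : (1 : ℝ) ≤ X := by exact_mod_cast hX
  have hX0 : (0 : ℝ) < X := by linarith
  have hk1' : (1 : ℝ) ≤ k := by exact_mod_cast hk1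
  have hk0 : (0 : ℝ) < k := by linarith
  rcases le_or_gt k X with hkX | hkX
  · rw [mollifiedCoeff_eq_sum (by omega) hkX (hkX.trans (Nat.le_self_pow (by norm_num) X)), sub_self]
    simp only [zero_mul, norm_zero, ne_eq, OfNat.ofNat_ne_zero, not_false_eq_true, zero_pow]
    positivity
  have hkX' : (X : ℝ) ≤ k := by exact_mod_cast hkX.le
  rw [if_neg (by omega), sub_zero, norm_mul, Complex.norm_real,
    Real.norm_of_nonneg (by positivity), mul_pow]
  have hd := norm_mollifiedCoeff_le (X := X) (N := X ^ 8) (k := k) (by omega)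
  have hlog : Real.log (X * X ^ 8 : ℕ) ≤ 18 * (X : ℝ) ^ (1 / 2 : ℝ) := by
    rw [show X * X ^ 8 = X ^ 9 by ring, Nat.cast_pow, Real.log_pow]
    have := Real.log_le_rpow_div hX0.le (ε := 1 / 2) (by norm_num)
    push_cast
    linarith
  have hkpow : ((k : ℝ) ^ (-σ)) ^ 2 ≤ ((k : ℝ) ^ (-0.6 : ℝ)) ^ 2 * (k : ℝ) ^ (-0.7 : ℝ) := by
    rw [← Real.rpow_natCast, ← Real.rpow_mul hk0.le, ← Real.rpow_natCast, ← Real.rpow_mul hk0.le,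
      ← Real.rpow_add hk0]
    apply Real.rpow_le_rpow_of_exponent_le hk1'
    push_cast
    linarith
  have hA : (k : ℝ) ^ (-0.7 : ℝ) ≤ (X : ℝ) ^ (-0.7 : ℝ) :=
    Real.rpow_le_rpow_of_nonpos hX0 hkX' (by norm_num)
  have hB : (k : ℝ) ^ (-0.7 : ℝ) * k ≤ (X : ℝ) ^ (2.7 : ℝ) := by
    calc (k : ℝ) ^ (-0.7 : ℝ) * k = (k : ℝ) ^ (0.3 : ℝ) := by
          rw [← Real.rpow_add_one hk0.ne']; norm_num
      _ ≤ ((X : ℝ) ^ (9 : ℕ)) ^ (0.3 : ℝ) := by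
          refine Real.rpow_le_rpow hk0.le ?_ (by norm_num)
          calc (k : ℝ) ≤ ((X * X ^ 8 : ℕ) : ℝ) := by exact_mod_cast hk2
            _ = _ := by push_cast; ring
      _ = _ := by rw [← Real.rpow_natCast, ← Real.rpow_mul hX0.le]; norm_num
  have hmono : ∀ a : ℝ, a ≤ 7 / 2 → (X : ℝ) ^ a ≤ (X : ℝ) ^ (7 / 2 : ℝ) := fun a ha =>
    Real.rpow_le_rpow_of_exponent_le hX1 ha
  have hlog0 : 0 ≤ Real.log (X * X ^ 8 : ℕ) := Real.log_natCast_nonneg _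
  have hfin : (k : ℝ) ^ (-0.7 : ℝ) * (l + 6 * k * (1 + Real.log (X * X ^ 8 : ℕ))) ≤
      200 * (X : ℝ) ^ (7 / 2 : ℝ) := by
    calc (k : ℝ) ^ (-0.7 : ℝ) * (l + 6 * k * (1 + Real.log (X * X ^ 8 : ℕ)))
        = (k : ℝ) ^ (-0.7 : ℝ) * l +
          6 * ((k : ℝ) ^ (-0.7 : ℝ) * k) * (1 + Real.log (X * X ^ 8 : ℕ)) := by ring
      _ ≤ (X : ℝ) ^ (-0.7 : ℝ) * (48 * (X : ℝ) ^ 4) +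
          6 * (X : ℝ) ^ (2.7 : ℝ) * (1 + 18 * (X : ℝ) ^ (1 / 2 : ℝ)) := by gcongr
      _ = 48 * (X : ℝ) ^ (3.3 : ℝ) + 6 * (X : ℝ) ^ (2.7 : ℝ) + 108 * (X : ℝ) ^ (3.2 : ℝ) := by
          have a1 : (X : ℝ) ^ (3.3 : ℝ) = (X : ℝ) ^ (-0.7 : ℝ) * (X : ℝ) ^ 4 := by
            rw [← Real.rpow_natCast, ← Real.rpow_add hX0]; norm_num
          have a2 : (X : ℝ) ^ (3.2 : ℝ) = (X : ℝ) ^ (2.7 : ℝ) * (X : ℝ) ^ (1 / 2 : ℝ) := by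
            rw [← Real.rpow_add hX0]; norm_num
          rw [a1, a2]; ring
      _ ≤ _ := by
          have := hmono 3.3 (by norm_num)
          have := hmono 2.7 (by norm_num)
          have := hmono 3.2 (by norm_num)
          have : 0 ≤ (X : ℝ) ^ (7 / 2 : ℝ) := by positivity
          linarith
  calc ‖mollifiedCoeff X (X ^ 8) k‖ ^ 2 * ((k : ℝ) ^ (-σ)) ^ 2 *
        (l + 6 * k * (1 + Real.log (X * X ^ 8 : ℕ)))
      ≤ divisorFunReal 2 k ^ 2 * (((k : ℝ) ^ (-0.6 : ℝ)) ^ 2 * (k : ℝ) ^ (-0.7 : ℝ)) *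
        (l + 6 * k * (1 + Real.log (X * X ^ 8 : ℕ))) := by gcongr
    _ = (divisorFunReal 2 k ^ 2 * ((k : ℝ) ^ (-0.6 : ℝ)) ^ 2) *
        ((k : ℝ) ^ (-0.7 : ℝ) * (l + 6 * k * (1 + Real.log (X * X ^ 8 : ℕ)))) := by ring
    _ ≤ (divisorFunReal 2 k ^ 2 * ((k : ℝ) ^ (-0.6 : ℝ)) ^ 2) * (200 * (X : ℝ) ^ (7 / 2 : ℝ)) := by
        gcongr
    _ = _ := by ring

lemma sum_mollifiedCoeff_sub_one {X : ℕ} (hX : 1 ≤ X) (s : ℂ) :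
    (∑ n ∈ Finset.Icc 1 (X ^ 8), (n : ℂ) ^ (-s)) * zetaMollifier X s - 1 =
      ∑ k ∈ Finset.Icc 1 (X * X ^ 8), (mollifiedCoeff X (X ^ 8) k - if k = 1 then 1 else 0) *
        (k : ℂ) ^ (-s) := by
  rw [zetaMollifier, sum_mul_sum_eq_sum_mollifiedCoeff]
  simp only [sub_mul, Finset.sum_sub_distrib]
  congr 1
  rw [Finset.sum_eq_single_of_mem 1]
  · simp
  · exact Finset.mem_Icc.2 ⟨le_rfl, Nat.mul_pos hX (Nat.one_le_pow _ _ hX)⟩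
  · intro b _ hb
    simp [hb]

lemma differentiableOn_riemannZeta_mul_zetaMollifier (X : ℕ) :
    DifferentiableOn ℂ (fun s => riemannZeta s * zetaMollifier X s - 1) {1}ᶜ := by
  intro s hs
  exact (((differentiableAt_riemannZeta hs).mul (differentiable_zetaMollifier X s)).sub_const
    1).differentiableWithinAt

/-- The mean square of `ζ` times the mollifier, minus one, near the line `Re s = 1`. -/
lemma exists_integral_norm_sq_riemannZeta_mul_zetaMollifier_le :
    ∃ C : ℝ, 0 ≤ C ∧ ∀ X : ℕ, 1 ≤ X → ∀ σ : ℝ, 0.95 ≤ σ → σ ≤ 1.05 →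
      ∫ t in ((X : ℝ) ^ 4 / 2)..(48 * (X : ℝ) ^ 4),
        ‖riemannZeta (σ + t * I) * zetaMollifier X (σ + t * I) - 1‖ ^ 2 ≤
          C * (X : ℝ) ^ (7 / 2 : ℝ) := by
  have hsq := summable_and_tsum_divisorFunReal_sq_le (k := 2) (σ := 0.6) (r := 2) (by norm_num)
    (by norm_num) (by norm_num) le_rfl (by norm_num)
  set A := ∑' n : ℕ, divisorFunReal 2 n ^ 2 * ((n : ℝ) ^ (-0.6 : ℝ)) ^ 2 with hA
  have hA0 : 0 ≤ A := tsum_nonneg fun n => by positivity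
  refine ⟨2 * (200 * A) + 2 * (500 ^ 2 * 48), by positivity, fun X hX σ h1 h2 => ?_⟩
  have hX1 : (1 : ℝ) ≤ X := by exact_mod_cast hX
  have hX0 : (0 : ℝ) < X := by linarith
  have hX4 : 1 ≤ (X : ℝ) ^ 4 := one_le_pow₀ hX1
  have hab : (X : ℝ) ^ 4 / 2 ≤ 48 * (X : ℝ) ^ 4 := by linarith
  set P : ℝ → ℂ := fun t => ∑ k ∈ Finset.Icc 1 (X * X ^ 8),
    ((mollifiedCoeff X (X ^ 8) k - if k = 1 then 1 else 0) * ((k : ℝ) ^ (-σ) : ℝ)) *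
      Complex.exp (-(Real.log k * I * t)) with hP
  have hPc : Continuous P := by rw [hP]; fun_prop
  have hmain : ∫ t in ((X : ℝ) ^ 4 / 2)..(48 * (X : ℝ) ^ 4), ‖P t‖ ^ 2 ≤
      200 * A * (X : ℝ) ^ (7 / 2 : ℝ) := by
    refine (integral_norm_sq_dirichletPolynomial_le _ _ hab).trans ?_
    calc _ ≤ ∑ k ∈ Finset.Icc 1 (X * X ^ 8), 200 * (X : ℝ) ^ (7 / 2 : ℝ) *
          (divisorFunReal 2 k ^ 2 * ((k : ℝ) ^ (-0.6 : ℝ)) ^ 2) :=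
          Finset.sum_le_sum fun k hk => norm_sq_mollifiedCoeff_mul_le hX hk h1
            (by linarith) (by linarith)
      _ ≤ 200 * (X : ℝ) ^ (7 / 2 : ℝ) * A := by
          rw [← Finset.mul_sum]
          gcongr
          exact hsq.1.sum_le_tsum _ fun n _ => by positivity
      _ = _ := by ring
  have hpt : ∀ t : ℝ, t ∈ Set.Icc ((X : ℝ) ^ 4 / 2) (48 * (X : ℝ) ^ 4) →
      ‖riemannZeta (σ + t * I) * zetaMollifier X (σ + t * I) - 1‖ ^ 2 ≤
        2 * ‖P t‖ ^ 2 + 2 * (500 / (X : ℝ) ^ 2) ^ 2 := by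
    intro t ht
    have hr := norm_riemannZeta_sub_mul_zetaMollifier_le hX h1 h2 ht.1 ht.2
    have hPt : P t = (∑ n ∈ Finset.Icc 1 (X ^ 8), (n : ℂ) ^ (-(σ + t * I : ℂ))) *
        zetaMollifier X (σ + t * I) - 1 := by
      rw [sum_mollifiedCoeff_sub_one hX]
      refine Finset.sum_congr rfl fun k hk => ?_
      rw [natCast_cpow_neg_eq (Finset.mem_Icc.1 hk).1, mul_assoc]
    have heq : riemannZeta (σ + t * I) * zetaMollifier X (σ + t * I) - 1 = P t +
        (riemannZeta (σ + t * I) - ∑ n ∈ Finset.Icc 1 (X ^ 8), (n : ℂ) ^ (-(σ + t * I : ℂ))) *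
        zetaMollifier X (σ + t * I) := by rw [hPt]; ring
    rw [heq]
    have h3 := norm_add_le (P t) ((riemannZeta (σ + t * I) -
      ∑ n ∈ Finset.Icc 1 (X ^ 8), (n : ℂ) ^ (-(σ + t * I : ℂ))) * zetaMollifier X (σ + t * I))
    calc _ ≤ (‖P t‖ + 500 / (X : ℝ) ^ 2) ^ 2 := by gcongr; linarith
      _ ≤ _ := by nlinarith [sq_nonneg (‖P t‖ - 500 / (X : ℝ) ^ 2)]
  have hcont : ContinuousOn (fun t : ℝ =>
      ‖riemannZeta (σ + t * I) * zetaMollifier X (σ + t * I) - 1‖ ^ 2)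
      (Set.uIcc ((X : ℝ) ^ 4 / 2) (48 * (X : ℝ) ^ 4)) := by
    rw [Set.uIcc_of_le hab]
    refine (ContinuousOn.norm ?_).pow 2
    refine (differentiableOn_riemannZeta_mul_zetaMollifier X).continuousOn.comp
      (f := fun t : ℝ => (σ + t * I : ℂ)) (by fun_prop) fun t ht h => ?_
    have := congrArg Complex.im h
    simp at this
    have := ht.1
    linarith
  have hi2 : IntervalIntegrable (fun t => 2 * ‖P t‖ ^ 2 + 2 * (500 / (X : ℝ) ^ 2) ^ 2) volume
      ((X : ℝ) ^ 4 / 2) (48 * (X : ℝ) ^ 4) := Continuous.intervalIntegrable (by fun_prop) _ _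
  calc _ ≤ ∫ t in ((X : ℝ) ^ 4 / 2)..(48 * (X : ℝ) ^ 4),
        (2 * ‖P t‖ ^ 2 + 2 * (500 / (X : ℝ) ^ 2) ^ 2) :=
        intervalIntegral.integral_mono_on hab hcont.intervalIntegrable hi2 hpt
    _ = 2 * (∫ t in ((X : ℝ) ^ 4 / 2)..(48 * (X : ℝ) ^ 4), ‖P t‖ ^ 2) +
        (48 * (X : ℝ) ^ 4 - (X : ℝ) ^ 4 / 2) * (2 * (500 / (X : ℝ) ^ 2) ^ 2) := by
        rw [intervalIntegral.integral_add (Continuous.intervalIntegrable (by fun_prop) _ _)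
          (by simp), intervalIntegral.integral_const_mul, intervalIntegral.integral_const,
          smul_eq_mul]
    _ ≤ 2 * (200 * A * (X : ℝ) ^ (7 / 2 : ℝ)) + 48 * (X : ℝ) ^ 4 * (2 * (500 / (X : ℝ) ^ 2) ^ 2) := by
        gcongr
        linarith
    _ = 2 * (200 * A) * (X : ℝ) ^ (7 / 2 : ℝ) + 2 * (500 ^ 2 * 48) * 1 := by
        field_simp
    _ ≤ _ := by
        rw [add_mul]
        gcongr
        exact Real.one_le_rpow hX1 (by norm_num)

end MollifiedMeanSquare

/-! ### Zero-free boxes outside an exceptional set -/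

section ExceptionalSet

/-- Tonelli on the rectangle, so that a mean square uniform in σ becomes an area integral. -/
lemma lintegral_reProdIm_le {f : ℂ → ENNReal} {a b c d : ℝ} {B : ENNReal}
    (hf : Measurable ((Set.Icc a b ×ℂ Set.Icc c d).indicator f))
    (h : ∀ σ ∈ Set.Icc a b, ∫⁻ t in Set.Icc c d, f (σ + t * I) ≤ B) :
    ∫⁻ w, (Set.Icc a b ×ℂ Set.Icc c d).indicator f w ≤ B * ENNReal.ofReal (b - a) := by
  rw [← (Complex.volume_preserving_equiv_real_prod.symm).lintegral_comp hf, Measure.volume_eq_prod,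
    lintegral_prod (fun z => (Set.Icc a b ×ℂ Set.Icc c d).indicator f
      (Complex.measurableEquivRealProd.symm z))
      (hf.comp Complex.measurableEquivRealProd.symm.measurable).aemeasurable]
  calc _ ≤ ∫⁻ σ, (Set.Icc a b).indicator (fun _ => B) σ := by
        refine lintegral_mono fun σ => ?_
        by_cases hσ : σ ∈ Set.Icc a b
        · rw [Set.indicator_of_mem hσ]
          refine le_trans (le_of_eq ?_) (h σ hσ)
          rw [← lintegral_indicator measurableSet_Icc]
          refine lintegral_congr fun t => ?_
          have e : Complex.measurableEquivRealProd.symm (σ, t) = (σ + t * I : ℂ) := by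
            apply Complex.ext <;> simp [Complex.measurableEquivRealProd]
          rw [e]
          by_cases ht : t ∈ Set.Icc c d
          · rw [Set.indicator_of_mem ht, Set.indicator_of_mem]
            rw [Complex.mem_reProdIm]
            simpa using ⟨hσ, ht⟩
          · rw [Set.indicator_of_notMem ht, Set.indicator_of_notMem]
            rw [Complex.mem_reProdIm]
            simp only [Complex.add_im, Complex.ofReal_im, Complex.mul_im, Complex.ofReal_re,
              Complex.I_im, Complex.I_re]
            simpa using fun _ _ => by simpa using ht
        · rw [Set.indicator_of_notMem hσ]
          refine le_of_eq (lintegral_eq_zero_of_ae_eq_zero (Eventually.of_forall fun t => ?_))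
          refine Set.indicator_of_notMem (fun hm => hσ ?_) _
          exact (Complex.mem_reProdIm.1 hm).1
    _ = B * ENNReal.ofReal (b - a) := by
        rw [lintegral_indicator measurableSet_Icc, setLIntegral_const, Real.volume_Icc]

/-- Outside a set of small measure, the parts of the critical strip near the line `Re s = 1` and
near height `t` contain no zeros of `ζ`. -/
lemma exists_measurableSet_riemannZeta_ne_zero :
    ∃ C : ℝ, 0 ≤ C ∧ ∀ T Y : ℝ, 16 ≤ T → 1 ≤ Y → Y ≤ T / 4 → ∃ E : Set ℝ, MeasurableSet E ∧
      volume E ≤ ENNReal.ofReal (C * Y * T ^ (7 / 8 : ℝ)) ∧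
      ∀ t ∈ Set.Icc T (2 * T), t ∉ E → ∀ s : ℂ, 0.97 ≤ s.re → |s.im - t| ≤ Y →
        riemannZeta s ≠ 0 := by
  obtain ⟨C, hC0, hC⟩ := exists_integral_norm_sq_riemannZeta_mul_zetaMollifier_le
  have hc0 : 0 < π * 0.02 ^ 2 := by positivity
  refine ⟨4 * C * (1.05 - 0.95) / (π * 0.02 ^ 2), div_nonneg (by positivity) hc0.le,
    fun T Y hT hY1 hY2 => ?_⟩
  have hT0 : 0 < T := by linarith
  have hroot : (T ^ (1 / 4 : ℝ)) ^ 4 = T := by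
    rw [← Real.rpow_natCast, ← Real.rpow_mul hT0.le]; norm_num
  have hroot1 : 1 ≤ T ^ (1 / 4 : ℝ) := Real.one_le_rpow (by linarith) (by norm_num)
  -- Then X⁴ ≤ T ≤ 16 X⁴, so the heights [X⁴/2, 48 X⁴] of the mean-square estimate contain [T/2,
  -- 3T], hence the discs used below.
  set X := ⌊T ^ (1 / 4 : ℝ)⌋₊ with hXdef
  have hX : 1 ≤ X := Nat.one_le_floor_iff _ |>.2 hroot1
  have hX1 : (1 : ℝ) ≤ X := by exact_mod_cast hX
  have hX0 : (0 : ℝ) < X := by linarith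
  have hXle : (X : ℝ) ≤ T ^ (1 / 4 : ℝ) := Nat.floor_le (by positivity)
  have hXT : (X : ℝ) ^ 4 ≤ T := by
    calc (X : ℝ) ^ 4 ≤ (T ^ (1 / 4 : ℝ)) ^ 4 := by gcongr
      _ = T := hroot
  have hTX : T ≤ 16 * (X : ℝ) ^ 4 := by
    calc T = (T ^ (1 / 4 : ℝ)) ^ 4 := hroot.symm
      _ ≤ (X + 1) ^ 4 := by
          gcongr
          exact (Nat.lt_floor_add_one _).le
      _ ≤ (2 * X) ^ 4 := by gcongr; linarith
      _ = _ := by ring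
  have hX4 : 1 ≤ (X : ℝ) ^ 4 := one_le_pow₀ hX1
  set Q : ℂ → ℂ := fun s => riemannZeta s * zetaMollifier X s - 1 with hQ
  have hQd : DifferentiableOn ℂ (fun s => Q s ^ 2) {1}ᶜ :=
    (differentiableOn_riemannZeta_mul_zetaMollifier X).pow 2
  set R : Set ℂ := Set.Icc (0.95 : ℝ) 1.05 ×ℂ Set.Icc ((X : ℝ) ^ 4 / 2) (48 * (X : ℝ) ^ 4) with hR
  have hRm : MeasurableSet R := (isClosed_Icc.reProdIm isClosed_Icc).measurableSet
  have hRne : R ⊆ {1}ᶜ := by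
    intro w hw h
    have := (Complex.mem_reProdIm.1 hw).2.1
    rw [Set.mem_singleton_iff.1 h, Complex.one_im] at this
    linarith
  set h : ℂ → ENNReal := R.indicator fun w => ‖Q w ^ 2‖ₑ with hh
  have hm : Measurable h := by
    classical
    rw [hh, ← Set.piecewise_eq_indicator]
    exact ((continuous_enorm.comp_continuousOn hQd.continuousOn).mono hRne).measurable_piecewise
      continuousOn_const hRm
  have hint : ∫⁻ w, h w ≤ ENNReal.ofReal (C * (X : ℝ) ^ (7 / 2 : ℝ)) * ENNReal.ofReal (1.05 - 0.95) := by
    refine lintegral_reProdIm_le hm fun σ hσ => ?_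
    refine le_trans (le_of_eq ?_) (ENNReal.ofReal_le_ofReal (hC X hX σ hσ.1 hσ.2))
    have hcont : ContinuousOn (fun t : ℝ => ‖Q (σ + t * I)‖ ^ 2)
        (Set.Icc ((X : ℝ) ^ 4 / 2) (48 * (X : ℝ) ^ 4)) := by
      refine (ContinuousOn.norm ?_).pow 2
      refine (differentiableOn_riemannZeta_mul_zetaMollifier X).continuousOn.comp
        (f := fun t : ℝ => (σ + t * I : ℂ)) (by fun_prop) fun t ht h => ?_
      have := congrArg Complex.im h
      simp at this
      have := ht.1
      linarith
    rw [intervalIntegral.integral_of_le (by linarith), ← integral_Icc_eq_integral_Ioc,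
      ofReal_integral_eq_lintegral_ofReal (hcont.integrableOn_Icc)
        (Eventually.of_forall fun t => by positivity)]
    refine lintegral_congr fun t => ?_
    rw [← ofReal_norm, norm_pow]
  set D : Set (ℝ × ℂ) := {p | |p.2.im - p.1| ≤ Y + 1} with hD
  have hDm : MeasurableSet D :=
    (isClosed_le (f := fun p : ℝ × ℂ => |p.2.im - p.1|) (by fun_prop) continuous_const).measurableSet
  set F : ℝ × ℂ → ENNReal := D.indicator fun p => h p.2 with hF
  have hFm : Measurable F := (hm.comp measurable_snd).indicator hDm
  -- `H t` is the area integral of |ζM - 1|² over the part of the rectangle within Y + 1 of height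
  -- t. Its integral over t costs a factor 2(Y + 1), and Markov's inequality bounds the set where it
  -- is large.
  set H : ℝ → ENNReal := fun t => ∫⁻ w, F (t, w) with hH
  have hHm : Measurable H := hFm.lintegral_prod_right'
  have hHint : ∫⁻ t, H t ≤ ENNReal.ofReal (2 * (Y + 1)) * ∫⁻ w, h w := by
    rw [hH, lintegral_lintegral_swap (f := fun t w => F (t, w)) hFm.aemeasurable, ← lintegral_const_mul _ hm]
    refine lintegral_mono fun w => ?_
    calc ∫⁻ t, F (t, w) = ∫⁻ t, (Metric.closedBall w.im (Y + 1)).indicator (fun _ => h w) t := by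
          refine lintegral_congr fun t => ?_
          simp only [hF, hD, Set.indicator, Set.mem_ofPred_eq, Metric.mem_closedBall, Real.dist_eq,
            abs_sub_comm t]
      _ = _ := by
          rw [lintegral_indicator Metric.isClosed_closedBall.measurableSet, setLIntegral_const,
            Real.volume_closedBall, mul_comm]
      _ ≤ _ := le_rfl
  refine ⟨{t | ENNReal.ofReal (π * 0.02 ^ 2) ≤ H t}, measurableSet_le measurable_const hHm, ?_, ?_⟩
  · refine (meas_ge_le_lintegral_div hHm.aemeasurable (by simpa using hc0) ENNReal.ofReal_ne_top).trans ?_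
    refine (ENNReal.div_le_div_right (hHint.trans (mul_le_mul_right hint _)) _).trans ?_
    rw [← ENNReal.ofReal_mul (by positivity), ← ENNReal.ofReal_mul (by positivity),
      ← ENNReal.ofReal_div_of_pos hc0]
    refine ENNReal.ofReal_le_ofReal ?_
    have hXp : (X : ℝ) ^ (7 / 2 : ℝ) ≤ T ^ (7 / 8 : ℝ) := by
      calc (X : ℝ) ^ (7 / 2 : ℝ) ≤ (T ^ (1 / 4 : ℝ)) ^ (7 / 2 : ℝ) := by gcongr
        _ = _ := by rw [← Real.rpow_mul hT0.le]; norm_num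
    rw [div_mul_eq_mul_div, div_mul_eq_mul_div]
    refine div_le_div_of_nonneg_right ?_ hc0.le
    calc 2 * (Y + 1) * (C * (X : ℝ) ^ (7 / 2 : ℝ) * (1.05 - 0.95))
        ≤ 2 * (Y + Y) * (C * T ^ (7 / 8 : ℝ) * (1.05 - 0.95)) := by gcongr
      _ = _ := by ring
  · intro t ht hE s hs1 hs2 hz
    apply hE
    have hs3 : s.re < 1 := by
      by_contra hcon
      exact riemannZeta_ne_zero_of_one_le_re (not_lt.1 hcon) hz
    have hball : ∀ w ∈ Metric.ball s 0.02, w ∈ R ∧ |w.im - t| ≤ Y + 1 := by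
      intro w hw
      rw [Metric.mem_ball, Complex.dist_eq] at hw
      have h1 := abs_lt.1 ((Complex.abs_re_le_norm (w - s)).trans_lt hw)
      have h2 := abs_lt.1 ((Complex.abs_im_le_norm (w - s)).trans_lt hw)
      rw [Complex.sub_re] at h1
      rw [Complex.sub_im] at h2
      have h3 := abs_le.1 hs2
      have h4 := ht.1
      have h5 := ht.2
      refine ⟨Complex.mem_reProdIm.2 ⟨⟨?_, ?_⟩, ⟨?_, ?_⟩⟩, abs_le.2 ⟨?_, ?_⟩⟩ <;> linarith
    have hd : DifferentiableOn ℂ (fun s => Q s ^ 2) (Metric.ball s 0.02) :=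
      hQd.mono fun w hw => hRne (hball w hw).1
    have hmv := enorm_mul_le_lintegral_ball (by norm_num) hd
    -- At a zero of `ζ` the function ζM - 1 takes the value -1, so the disc of radius 0.02 alone
    -- contributes at least its area to `H t`.
    have hQs : Q s ^ 2 = 1 := by simp [hQ, hz]
    rw [hQs, enorm_one, one_mul] at hmv
    refine hmv.trans ?_
    rw [← lintegral_indicator Metric.isOpen_ball.measurableSet]
    refine lintegral_mono fun w => ?_
    by_cases hw : w ∈ Metric.ball s 0.02
    · rw [Set.indicator_of_mem hw, hF, Set.indicator_of_mem (show (t, w) ∈ D from (hball w hw).2), hh,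
        Set.indicator_of_mem (hball w hw).1]
    · rw [Set.indicator_of_notMem hw]
      exact zero_le

end ExceptionalSet

/-! ### The three circles theorem -/

section ThreeCircles

/-- The three lines theorem for w ↦ g(c + exp w), whose strip log r₁ ≤ Re w ≤ log r₃ covers the
annulus. -/
lemma norm_le_of_three_circles {g : ℂ → ℂ} {c z : ℂ} {R r₁ r₃ m₁ m₃ : ℝ} (h1 : 0 < r₁)
    (h13 : r₁ < r₃) (h3 : r₃ < R) (hg : DifferentiableOn ℂ g (Metric.ball c R))
    (hm1 : ∀ w, ‖w - c‖ = r₁ → ‖g w‖ ≤ m₁) (hm3 : ∀ w, ‖w - c‖ = r₃ → ‖g w‖ ≤ m₃)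
    (hz1 : r₁ ≤ ‖z - c‖) (hz3 : ‖z - c‖ ≤ r₃) :
    ‖g z‖ ≤ m₁ ^ (1 - (Real.log ‖z - c‖ - Real.log r₁) / (Real.log r₃ - Real.log r₁)) *
      m₃ ^ ((Real.log ‖z - c‖ - Real.log r₁) / (Real.log r₃ - Real.log r₁)) := by
  have h30 : 0 < r₃ := h1.trans h13
  have hz0 : 0 < ‖z - c‖ := h1.trans_le hz1
  set f : ℂ → ℂ := fun w => g (c + Complex.exp w) with hf
  have hnorm : ∀ w : ℂ, ‖(c + Complex.exp w) - c‖ = Real.exp w.re := fun w => by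
    rw [add_sub_cancel_left, Complex.norm_exp]
  have hclosed : ∀ w ∈ HadamardThreeLines.verticalClosedStrip (Real.log r₁) (Real.log r₃),
      c + Complex.exp w ∈ Metric.closedBall c r₃ := by
    intro w hw
    rw [Metric.mem_closedBall, dist_eq_norm, hnorm]
    exact (Real.le_log_iff_exp_le h30).1 hw.2
  have hd : DiffContOnCl ℂ f (HadamardThreeLines.verticalStrip (Real.log r₁) (Real.log r₃)) := by
    refine DifferentiableOn.diffContOnCl fun w hw => ?_
    have hw' : w ∈ HadamardThreeLines.verticalClosedStrip (Real.log r₁) (Real.log r₃) := by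
      refine closure_minimal (fun x hx => ?_)
        (isClosed_Icc.preimage Complex.continuous_re) hw
      exact ⟨hx.1.le, hx.2.le⟩
    have hmem : c + Complex.exp w ∈ Metric.ball c R :=
      Metric.closedBall_subset_ball h3 (hclosed w hw')
    have hga := hg.differentiableAt (Metric.isOpen_ball.mem_nhds hmem)
    exact (hga.comp w (by fun_prop)).differentiableWithinAt
  have hB : BddAbove ((norm ∘ f) '' HadamardThreeLines.verticalClosedStrip (Real.log r₁) (Real.log r₃)) := by
    have hb := ((isCompact_closedBall c r₃).image_of_continuousOn
      ((hg.continuousOn.mono (Metric.closedBall_subset_ball h3)).norm)).bddAbove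
    refine hb.mono ?_
    rintro _ ⟨w, hw, rfl⟩
    exact ⟨_, hclosed w hw, rfl⟩
  have hzc : z - c ≠ 0 := norm_pos_iff.1 hz0
  have hfz : f (Complex.log (z - c)) = g z := by
    simp only [hf, Complex.exp_log hzc, add_sub_cancel]
  have := HadamardThreeLines.norm_le_interp_of_mem_verticalClosedStrip' (f := f)
    (z := Complex.log (z - c)) (a := m₁) (b := m₃) (Real.log_lt_log h1 h13)
    (by
      refine ⟨?_, ?_⟩ <;> simp only [Complex.log_re]
      · exact Real.log_le_log h1 hz1
      · exact Real.log_le_log hz0 hz3) hd hB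
    (fun w hw => hm1 _ (by rw [hnorm, show w.re = Real.log r₁ from hw, Real.exp_log h1]))
    (fun w hw => hm3 _ (by rw [hnorm, show w.re = Real.log r₃ from hw, Real.exp_log h30]))
  rwa [hfz, Complex.log_re] at this

end ThreeCircles

/-! ### The logarithm of `ζ` to the left of Re s = 1 -/

section LogZeta

/-- `log ζ(s)`, by continuous variation along the horizontal line from `2 + i Im s`. -/
noncomputable def logZetaHorizontal (s : ℂ) : ℂ :=
  logZetaEuler (2 + s.im * I) - ∫ x in s.re..2, logDeriv riemannZeta (x + s.im * I)

lemma differentiableAt_logDeriv_riemannZeta {s : ℂ} (h1 : s ≠ 1) (h0 : riemannZeta s ≠ 0) :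
    DifferentiableAt ℂ (logDeriv riemannZeta) s := by
  have han : AnalyticAt ℂ riemannZeta s :=
    (DifferentiableOn.analyticOnNhd (s := {w : ℂ | w ≠ 1})
      (fun x hx => (differentiableAt_riemannZeta hx).differentiableWithinAt) isOpen_ne) s h1
  exact han.deriv.differentiableAt.div han.differentiableAt h0

lemma logZetaHorizontal_eq_logZetaEuler {s : ℂ} (hs : 1 < s.re) :
    logZetaHorizontal s = logZetaEuler s := by
  have hre : ∀ x : ℝ, x ∈ Set.uIcc s.re 2 → 1 < ((x : ℂ) + s.im * I).re := by
    intro x hx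
    have := (Set.mem_uIcc.1 hx)
    simp
    rcases this with h | h <;> linarith
  have h := intervalIntegral.integral_eq_sub_of_hasDerivAt (a := s.re) (b := 2)
    (f := fun x : ℝ => logZetaEuler (x + s.im * I))
    (f' := fun x : ℝ => logDeriv riemannZeta (x + s.im * I))
    (fun x hx => by
      have := (hasDerivAt_logZetaEuler (hre x hx)).comp_of_eq x
        ((Complex.ofRealCLM.hasDerivAt (x := x)).add_const (s.im * I : ℂ)) rfl
      simpa [Function.comp_def] using this)
    (ContinuousOn.intervalIntegrable fun x hx => by
      have h1 := hre x hx
      have hc := logDeriv_riemannZeta_continuousAt (s := x + s.im * I)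
        (fun h => by rw [h] at h1; simp at h1) (riemannZeta_ne_zero_of_one_lt_re h1)
      exact (ContinuousAt.comp (f := fun x : ℝ => (x : ℂ) + s.im * I) hc
        (by fun_prop)).continuousWithinAt)
  rw [logZetaHorizontal, h, Complex.re_add_im]
  simp

lemma logZetaHorizontal_one_add {t : ℝ} (ht : t ≠ 0) :
    logZetaHorizontal (1 + t * I) = logZetaOneLine t := by
  rw [logZetaOneLine_eq ht (σ := 2) (by norm_num), logZetaHorizontal]
  simp

/-- On a disc without zeros of `ζ`, horizontal continuation gives a holomorphic logarithm. -/
lemma exists_log_riemannZeta_on_ball {t r : ℝ} (hr1 : 1 < r) (hr2 : r ≤ 2) (ht : 2 ≤ |t|)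
    (hz : ∀ s ∈ Metric.ball (2 + t * I : ℂ) r, riemannZeta s ≠ 0) :
    ∃ g : ℂ → ℂ, DifferentiableOn ℂ g (Metric.ball (2 + t * I : ℂ) r) ∧
      ∀ s ∈ Metric.ball (2 + t * I : ℂ) r, Complex.exp (g s) = riemannZeta s ∧
        g s = logZetaHorizontal s := by
  have hne : ∀ s ∈ Metric.ball (2 + t * I : ℂ) r, s ≠ 1 := by
    rintro s hs rfl
    rw [Metric.mem_ball, Complex.dist_eq] at hs
    have := Complex.abs_im_le_norm (1 - (2 + t * I : ℂ))
    simp at this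
    linarith
  have hdl : DifferentiableOn ℂ (logDeriv riemannZeta) (Metric.ball (2 + t * I : ℂ) r) :=
    fun s hs => (differentiableAt_logDeriv_riemannZeta (hne s hs) (hz s hs)).differentiableWithinAt
  obtain ⟨g, hgc, hg⟩ := hdl.isExactOn_ball.with_val_at (2 + t * I) (logZetaEuler (2 + t * I))
  have hc : (2 + t * I : ℂ) ∈ Metric.ball (2 + t * I : ℂ) r := Metric.mem_ball_self (by linarith)
  refine ⟨g, fun s hs => (hg s hs).differentiableAt.differentiableWithinAt, fun s hs => ⟨?_, ?_⟩⟩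
  · have hconst := Metric.isOpen_ball.is_const_of_deriv_eq_zero
      (f := fun w => riemannZeta w * Complex.exp (-g w)) (s := Metric.ball (2 + t * I : ℂ) r)
      (convex_ball _ _).isPreconnected
      (fun w hw => ((differentiableAt_riemannZeta (hne w hw)).mul
        (hg w hw).differentiableAt.neg.cexp).differentiableWithinAt)
      (fun w hw => by
        have h1 := (differentiableAt_riemannZeta (hne w hw)).hasDerivAt.mul
          (hg w hw).neg.cexp
        refine h1.deriv.trans ?_
        have := hz w hw
        simp only [logDeriv, Pi.div_apply, Pi.zero_apply]
        field_simp
        ring) hs hc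
    simp only [hgc] at hconst
    rw [← exp_logZetaEuler (s := 2 + t * I) (by simp), ← Complex.exp_add, add_neg_cancel,
      Complex.exp_zero, Complex.exp_neg] at hconst
    field_simp at hconst
    exact hconst.symm
  · have him : |s.im - t| < r := by
      rw [Metric.mem_ball, Complex.dist_eq] at hs
      have := Complex.abs_im_le_norm (s - (2 + t * I : ℂ))
      simp at this
      linarith
    have hp : (2 + s.im * I : ℂ) ∈ Metric.ball (2 + t * I : ℂ) r := by
      rw [Metric.mem_ball, Complex.dist_eq, add_sub_add_left_eq_sub, ← sub_mul, ← Complex.ofReal_sub,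
        norm_mul, Complex.norm_I, mul_one, Complex.norm_real]
      exact him
    -- On the convex part of the disc with Re w > 1, the primitive and the sum over primes both have
    -- derivative ζ'/ζ, and they agree at the centre.
    have hvert : g (2 + s.im * I) = logZetaEuler (2 + s.im * I) := by
      have hconv : Convex ℝ (Metric.ball (2 + t * I : ℂ) r ∩ {w | 1 < w.re}) :=
        (convex_ball _ _).inter (convex_halfSpace_re_gt 1)
      have hopen : IsOpen (Metric.ball (2 + t * I : ℂ) r ∩ {w | 1 < w.re}) :=
        Metric.isOpen_ball.inter (isOpen_lt continuous_const Complex.continuous_re)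
      have hconst := hopen.is_const_of_deriv_eq_zero (f := fun w => g w - logZetaEuler w)
        hconv.isPreconnected
        (fun w hw => ((hg w hw.1).differentiableAt.sub
          (hasDerivAt_logZetaEuler hw.2).differentiableAt).differentiableWithinAt)
        (fun w hw => ((hg w hw.1).sub (hasDerivAt_logZetaEuler hw.2)).deriv.trans (sub_self _))
        (x := 2 + s.im * I) (y := 2 + t * I) ⟨hp, by simp⟩ ⟨hc, by simp⟩
      simp only [hgc, sub_self] at hconst
      exact sub_eq_zero.1 hconst
    have hseg : ∀ x ∈ Set.uIcc s.re 2, ((x : ℂ) + s.im * I) ∈ Metric.ball (2 + t * I : ℂ) r := by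
      intro x hx
      have hsub := (convex_ball (2 + t * I : ℂ) r).segment_subset hs hp
      apply hsub
      rw [← Set.image_id (Set.uIcc s.re 2), ← segment_eq_uIcc] at hx
      obtain ⟨y, ⟨a, b, ha, hb, hab, rfl⟩, rfl⟩ := hx
      refine ⟨a, b, ha, hb, hab, ?_⟩
      apply Complex.ext
      · simp
      · simp
        rw [← add_mul, hab, one_mul]
    have h := intervalIntegral.integral_eq_sub_of_hasDerivAt (a := s.re) (b := 2)
      (f := fun x : ℝ => g (x + s.im * I))
      (f' := fun x : ℝ => logDeriv riemannZeta (x + s.im * I))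
      (fun x hx => by
        have := (hg _ (hseg x hx)).comp_of_eq x
          ((Complex.ofRealCLM.hasDerivAt (x := x)).add_const (s.im * I : ℂ)) rfl
        simpa [Function.comp_def] using this)
      (ContinuousOn.intervalIntegrable (hdl.continuousOn.comp (by fun_prop) hseg))
    rw [logZetaHorizontal, h, Complex.re_add_im, ← hvert]
    simp

/-- A bound for `log ζ` slightly to the left of the line `Re s = 1`, at heights near which there are
no zeros. -/
lemma differentiableAt_and_norm_logZetaHorizontal_le {T t σ : ℝ} (hT : Real.exp (Real.exp 400) ≤ T)
    (ht : 4 ≤ |t|) (htT : |t| ≤ 4 * T)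
    (hz : ∀ s ∈ Metric.ball (2 + t * I : ℂ) 1.03, riemannZeta s ≠ 0)
    (hσ : 1 - 4 / Real.log (Real.log T) ≤ σ) :
    DifferentiableAt ℂ logZetaHorizontal (σ + t * I) ∧
      ‖logZetaHorizontal (σ + t * I)‖ ≤ Real.exp 1100 * Real.log (1 + Real.log (Real.log T)) := by
  have hL : Real.exp 400 ≤ Real.log T := by
    rw [← Real.log_exp (Real.exp 400)]; exact Real.log_le_log (Real.exp_pos _) hT
  have hL2 : 400 ≤ Real.log (Real.log T) := by
    rw [← Real.log_exp 400]; exact Real.log_le_log (Real.exp_pos _) hL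
  have hL0 : 0 < Real.log T := (Real.exp_pos _).trans_le hL
  have hT0 : 0 < T := (Real.exp_pos _).trans_le hT
  set L := Real.log T with hLdef
  set l := Real.log L with hl
  have hl0 : 0 < l := by linarith
  have hL1 : 400 ≤ L := by
    have := Real.add_one_le_exp 400; linarith
  have hT1 : 400 ≤ T := by
    have := Real.add_one_le_exp L
    rw [hLdef, Real.exp_log hT0] at this
    linarith
  have h4l : 4 / l ≤ 0.01 := by rw [div_le_iff₀ hl0]; linarith
  have h1l : 1 / l ≤ 0.01 := by rw [div_le_iff₀ hl0]; linarith
  have h1l0 : 0 < 1 / l := by positivity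
  have hlog1 : 1 ≤ Real.log (1 + l) := by
    rw [Real.le_log_iff_exp_le (by linarith)]
    have := Real.exp_one_lt_d9
    linarith
  have he : 1 ≤ Real.exp 1100 := Real.one_le_exp (by norm_num)
  have hEuler : ∀ s : ℂ, 1 + 1 / l ≤ s.re → ‖logZetaEuler s‖ ≤ Real.log (1 + l) := by
    intro s hs
    refine (norm_logZetaEuler_le (by linarith)).trans ?_
    refine (logZetaReal_antitone (by linarith) hs).trans ((logZetaReal_le_log (by linarith)).trans ?_)
    simp
  set c : ℂ := 2 + t * I with hc
  obtain ⟨g, hgd, hg⟩ := exists_log_riemannZeta_on_ball (r := 1.03) (by norm_num) (by norm_num)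
    (by linarith) hz
  have hsc : ((σ : ℂ) + t * I) - c = ((σ - 2 : ℝ) : ℂ) := by rw [hc]; push_cast; ring
  have hnsc : ‖((σ : ℂ) + t * I) - c‖ = |σ - 2| := by rw [hsc, Complex.norm_real, Real.norm_eq_abs]
  constructor
  · rcases lt_or_ge 1 σ with h | h
    · have hev : logZetaHorizontal =ᶠ[𝓝 (σ + t * I)] logZetaEuler := by
        have : {w : ℂ | 1 < w.re} ∈ 𝓝 ((σ : ℂ) + t * I) :=
          (isOpen_lt continuous_const Complex.continuous_re).mem_nhds (by simpa using h)
        filter_upwards [this] with w hw using logZetaHorizontal_eq_logZetaEuler hw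
      exact ((hasDerivAt_logZetaEuler (s := σ + t * I) (by simpa using h)).differentiableAt).congr_of_eventuallyEq hev
    · have hmem : ((σ : ℂ) + t * I) ∈ Metric.ball c 1.03 := by
        rw [Metric.mem_ball, dist_eq_norm, hnsc, abs_lt]
        constructor <;> linarith
      have hev : logZetaHorizontal =ᶠ[𝓝 (σ + t * I)] g := by
        filter_upwards [Metric.isOpen_ball.mem_nhds hmem] with w hw using (hg w hw).2.symm
      exact (hgd.differentiableAt (Metric.isOpen_ball.mem_nhds hmem)).congr_of_eventuallyEq hev
  rcases le_or_gt (1 + 1 / l) σ with h | h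
  · rw [logZetaHorizontal_eq_logZetaEuler (by simp; linarith)]
    refine (hEuler _ (by simpa using h)).trans ?_
    nlinarith
  have hmem : ((σ : ℂ) + t * I) ∈ Metric.ball c 1.03 := by
    rw [Metric.mem_ball, dist_eq_norm, hnsc, abs_lt]
    constructor <;> linarith
  rw [← (hg _ hmem).2]
  -- the size of `ζ` on the disc
  have hbox : ∀ s ∈ Metric.ball c 1.03, 0.97 ≤ s.re ∧ 2 ≤ |s.im| ∧ |s.im| ≤ 5 * T := by
    intro s hs
    rw [Metric.mem_ball, dist_eq_norm] at hs
    have h1 := (Complex.abs_re_le_norm (s - c)).trans hs.le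
    have h2 := (Complex.abs_im_le_norm (s - c)).trans hs.le
    have e1 : (s - c).re = s.re - 2 := by simp [hc]
    have e2 : (s - c).im = s.im - t := by simp [hc]
    rw [e1] at h1
    rw [e2] at h2
    have h3 := abs_sub_abs_le_abs_sub s.im t
    have h4 := abs_sub_abs_le_abs_sub t s.im
    rw [abs_sub_comm t] at h4
    have h5 := (abs_le.1 h1).1
    exact ⟨by linarith, by linarith, by linarith⟩
  have hsize : ∀ s ∈ Metric.ball c 1.03, ‖riemannZeta s‖ ≤ 100 * T := by
    intro s hs
    obtain ⟨b1, b2, b3⟩ := hbox s hs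
    rcases le_or_gt s.re 2 with h2 | h2
    · have hs1 : s ≠ 1 := fun h => by rw [h] at b2; norm_num at b2
      have hb := norm_riemannZeta_sub_le (N := 1) le_rfl (s := s) (by linarith) h2 hs1
      simp only [Finset.Icc_self, Finset.sum_singleton, Nat.cast_one, Complex.one_cpow,
        Real.one_rpow, mul_one] at hb
      have h3 : 1 ≤ ‖s - 1‖ := by
        have := Complex.abs_im_le_norm (s - 1)
        simp at this
        linarith
      have h4 : ‖s‖ ≤ 6 * T := by
        have := Complex.norm_le_abs_re_add_abs_im s
        rw [abs_of_nonneg (by linarith)] at this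
        linarith
      have h5 : 1 / ‖s - 1‖ ≤ 1 := by rw [div_le_one (by linarith)]; exact h3
      have h6 : 8 / s.re ≤ 9 := by rw [div_le_iff₀ (by linarith)]; linarith
      have h7 : 8 / s.re * ‖s‖ ≤ 9 * (6 * T) := by gcongr
      have h8 := norm_sub_norm_le (riemannZeta s) 1
      rw [norm_one] at h8
      linarith
    · rw [← exp_logZetaEuler (by linarith), Complex.norm_exp]
      calc Real.exp (logZetaEuler s).re ≤ Real.exp (logZetaReal s.re) := by
            gcongr
            exact (Complex.re_le_norm _).trans (norm_logZetaEuler_le (by linarith))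
        _ ≤ 1 + 1 / (s.re - 1) := exp_logZetaReal_le (by linarith)
        _ ≤ 1 + 1 := by
            gcongr
            rw [div_le_one (by linarith)]; linarith
        _ ≤ _ := by linarith
  have hlogM : Real.log (100 * T) ≤ 2 * L := by
    rw [Real.log_mul (by norm_num) hT0.ne', ← hLdef]
    have : Real.log 100 ≤ 99 := by
      have := Real.log_le_sub_one_of_pos (x := 100) (by norm_num); linarith
    linarith
  -- Borel–Carathéodory: Re g = log |ζ| ≤ 2L on the disc of radius 1.03 bounds |g| on the circle of
  -- radius 1.02.
  have hBC : ∀ w, ‖w - c‖ = 1.02 → ‖g w‖ ≤ 700 * L := by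
    intro w hw
    have hre : ∀ s ∈ Metric.ball c 1.03, (g s).re ≤ 2 * L := by
      intro s hs
      refine le_trans ?_ hlogM
      rw [Real.le_log_iff_exp_le (by positivity), ← Complex.norm_exp, (hg s hs).1]
      exact hsize s hs
    have hshift : ∀ x ∈ Metric.ball (0 : ℂ) 1.03, c + x ∈ Metric.ball c 1.03 := by
      intro x hx
      simpa using hx
    have hb := Complex.borelCaratheodory (f := fun x => g (c + x)) (M := 2 * L) (R := 1.03)
      (z := w - c) (by linarith)
      (hgd.comp (by fun_prop) hshift) (fun x hx => hre _ (hshift x hx)) (by norm_num)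
      (by rw [mem_ball_zero_iff, hw]; norm_num)
    simp only [hw, add_sub_cancel, add_zero] at hb
    have hgc : ‖g c‖ ≤ 1 := by
      rw [(hg c (Metric.mem_ball_self (by norm_num))).2,
        logZetaHorizontal_eq_logZetaEuler (by simp [hc])]
      refine (norm_logZetaEuler_le (by simp [hc])).trans ?_
      refine (logZetaReal_le_log (by simp [hc])).trans ?_
      have : c.re = 2 := by simp [hc]
      rw [this]
      have := Real.log_le_sub_one_of_pos (x := 1 + 1 / (2 - 1)) (by norm_num)
      norm_num at this ⊢
      linarith
    refine hb.trans ?_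
    norm_num
    linarith
  -- The inner circle lies in Re w ≥ 1 + 1/l, where |log ζ| ≤ log ζ(1 + 1/l) ≤ log(1 + l).
  have h1 : ∀ w, ‖w - c‖ = 1 - 1 / l → ‖g w‖ ≤ Real.log (1 + l) := by
    intro w hw
    have hre : 1 + 1 / l ≤ w.re := by
      have := (abs_le.1 ((Complex.abs_re_le_norm (w - c)).trans hw.le)).1
      have e1 : (w - c).re = w.re - 2 := by simp [hc]
      rw [e1] at this
      linarith
    rw [(hg w (by rw [Metric.mem_ball, dist_eq_norm, hw]; linarith)).2,
      logZetaHorizontal_eq_logZetaEuler (by linarith)]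
    exact hEuler w hre
  have hr : ‖((σ : ℂ) + t * I) - c‖ = 2 - σ := by
    rw [hnsc, abs_sub_comm, abs_of_pos (by linarith)]
  have h3c := norm_le_of_three_circles (z := σ + t * I) (by linarith) (by linarith) (by norm_num) hgd h1 hBC
    (by rw [hr]; linarith) (by rw [hr]; linarith)
  rw [hr] at h3c
  -- The radii 2 - σ ≤ 1 + 4/l and 1 - 1/l differ by O(1/l), so a ≤ 550/l. As log(700 L) ≤ 2l, the
  -- outer bound 700 L enters only as (700 L)^a ≤ e^1100; this is the source of that constant.
  set a := (Real.log (2 - σ) - Real.log (1 - 1 / l)) / (Real.log 1.02 - Real.log (1 - 1 / l)) with ha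
  have hden : 0.019 ≤ Real.log 1.02 - Real.log (1 - 1 / l) := by
    have e1 := Real.log_le_sub_one_of_pos (x := 1 - 1 / l) (by linarith)
    have e2 := Real.one_sub_inv_le_log_of_pos (x := 1.02) (by norm_num)
    norm_num at e2 ⊢
    norm_num at e1
    linarith [inv_pos.2 hl0]
  have hnum0 : 0 ≤ Real.log (2 - σ) - Real.log (1 - 1 / l) :=
    sub_nonneg.2 (Real.log_le_log (by linarith) (by linarith))
  have hnum : Real.log (2 - σ) - Real.log (1 - 1 / l) ≤ 10 / l := by
    rw [← Real.log_div (by linarith) (by linarith)]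
    have e1 := Real.log_le_sub_one_of_pos (x := (2 - σ) / (1 - 1 / l))
      (div_pos (by linarith) (by linarith))
    refine e1.trans ?_
    rw [div_sub_one (by linarith), div_le_iff₀ (by linarith)]
    have e2 : 10 / l = 2 * (4 / l + 1 / l) := by ring
    rw [e2]
    nlinarith
  have ha0 : 0 ≤ a := div_nonneg hnum0 (by linarith)
  have ha1 : a ≤ 550 / l := by
    rw [ha, div_le_iff₀ (by linarith)]
    refine hnum.trans ?_
    have : 550 / l * 0.019 ≤ 550 / l * (Real.log 1.02 - Real.log (1 - 1 / l)) := by gcongr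
    refine le_trans ?_ this
    rw [div_mul_eq_mul_div]
    gcongr
    norm_num
  have hL700 : 700 ≤ L := by
    have := Real.quadratic_le_exp_of_nonneg (x := 400) (by norm_num)
    linarith
  have hm3 : (700 * L) ^ a ≤ Real.exp 1100 := by
    rw [Real.rpow_def_of_pos (by positivity)]
    gcongr
    have e1 : Real.log (700 * L) ≤ 2 * l := by
      rw [two_mul, hl, ← Real.log_mul hL0.ne' hL0.ne']
      gcongr
    calc Real.log (700 * L) * a ≤ 2 * l * (550 / l) := by gcongr
      _ = 1100 := by field_simp; norm_num
  have hm1 : Real.log (1 + l) ^ (1 - a) ≤ Real.log (1 + l) := by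
    conv_rhs => rw [← Real.rpow_one (Real.log (1 + l))]
    exact Real.rpow_le_rpow_of_exponent_le hlog1 (by linarith)
  calc ‖g (σ + t * I)‖ ≤ _ := h3c
    _ ≤ Real.log (1 + l) * Real.exp 1100 := by gcongr
    _ = _ := mul_comm _ _

end LogZeta

/-! ### Cauchy's integral formula for a rectangle -/

section RectangleCauchy

/-- The left side of a rectangle around 0 crosses the branch cut of the logarithm. Multiplication by
-1 carries that side to the right half plane; the corners shift by ±πi, and the two shifts make up
the 2πi. -/
lemma log_neg_of_im_pos {x : ℂ} (hx : 0 < x.im) : Complex.log (-x) = Complex.log x - π * I := by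
  apply Complex.ext
  · simp [Complex.log_re]
  · simp [Complex.log_im, Complex.arg_neg_eq_arg_sub_pi_of_im_pos hx]

lemma log_neg_of_im_neg {x : ℂ} (hx : x.im < 0) : Complex.log (-x) = Complex.log x + π * I := by
  apply Complex.ext
  · simp [Complex.log_re]
  · simp [Complex.log_im, Complex.arg_neg_eq_arg_add_pi_of_im_neg hx]

lemma integral_inv_horizontal (a b : ℝ) {y : ℝ} (hy : y ≠ 0) :
    ∫ x in a..b, ((x : ℂ) + y * I)⁻¹ = Complex.log (b + y * I) - Complex.log (a + y * I) := by
  have hne : ∀ x : ℝ, (x : ℂ) + y * I ∈ slitPlane := fun x => Or.inr (by simpa using hy)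
  refine intervalIntegral.integral_eq_sub_of_hasDerivAt
    (f := fun x : ℝ => Complex.log (x + y * I)) (fun x _ => ?_)
    ((Continuous.inv₀ (by fun_prop) fun x =>
      Complex.slitPlane_ne_zero (hne x)).intervalIntegrable _ _)
  have := ((Complex.ofRealCLM.hasDerivAt (x := x)).add_const (y * I : ℂ)).clog_real (hne x)
  simpa using this

lemma integral_inv_vertical {c : ℝ} (hc : 0 < c) (a b : ℝ) :
    I • ∫ y in a..b, ((c : ℂ) + y * I)⁻¹ = Complex.log (c + b * I) - Complex.log (c + a * I) := by
  have hne : ∀ y : ℝ, (c : ℂ) + y * I ∈ slitPlane := fun y => Or.inl (by simpa using hc)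
  rw [← intervalIntegral.integral_smul]
  refine intervalIntegral.integral_eq_sub_of_hasDerivAt
    (f := fun y : ℝ => Complex.log (c + y * I)) (fun y _ => ?_)
    (((Continuous.inv₀ (by fun_prop) fun y =>
      Complex.slitPlane_ne_zero (hne y)).const_smul I).intervalIntegrable _ _)
  have := (((Complex.ofRealCLM.hasDerivAt (x := y)).mul_const I).const_add (c : ℂ)).clog_real (hne y)
  simpa [div_eq_mul_inv] using this

/-- The integral of `1 / w` along the boundary of a rectangle around `0`. -/
lemma integral_boundary_rect_inv {b c Y : ℝ} (hb : 0 < b) (hc : 0 < c) (hY : 0 < Y) :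
    (∫ x in (-b)..c, ((x : ℂ) + (-Y : ℝ) * I)⁻¹) - (∫ x in (-b)..c, ((x : ℂ) + Y * I)⁻¹) +
      I • (∫ y in (-Y)..Y, ((c : ℂ) + y * I)⁻¹) - I • (∫ y in (-Y)..Y, (((-b : ℝ) : ℂ) + y * I)⁻¹) =
      2 * π * I := by
  have hleft : I • (∫ y in (-Y)..Y, (((-b : ℝ) : ℂ) + y * I)⁻¹) =
      Complex.log (b + (-Y : ℝ) * I) - Complex.log (b + Y * I) := by
    have h := integral_inv_vertical hb Y (-Y)
    have h2 := intervalIntegral.integral_comp_neg (a := -Y) (b := Y)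
      (fun y : ℝ => -((b : ℂ) + y * I)⁻¹)
    rw [neg_neg] at h2
    rw [← h, intervalIntegral.integral_symm (-Y) Y, ← intervalIntegral.integral_neg, ← h2]
    congr 1
    refine intervalIntegral.integral_congr fun y _ => ?_
    rw [← inv_neg]
    congr 1
    push_cast
    ring
  rw [integral_inv_horizontal _ _ (by simpa using hY.ne'), integral_inv_horizontal _ _ hY.ne',
    integral_inv_vertical hc, hleft]
  have e1 : ((-b : ℝ) : ℂ) + (-Y : ℝ) * I = -((b : ℂ) + Y * I) := by push_cast; ring
  have e2 : ((-b : ℝ) : ℂ) + Y * I = -((b : ℂ) + (-Y : ℝ) * I) := by push_cast; ring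
  rw [e1, e2, log_neg_of_im_pos (by simpa using hY), log_neg_of_im_neg (by simpa using hY)]
  ring

/-- Cauchy's integral formula at `0` for a rectangle. -/
lemma integral_boundary_rect_div {F : ℂ → ℂ} {b c Y : ℝ} (hb : 0 < b) (hc : 0 < c) (hY : 0 < Y)
    (hF : DifferentiableOn ℂ F (Set.Icc (-b) c ×ℂ Set.Icc (-Y) Y)) :
    (∫ x in (-b)..c, F ((x : ℂ) + (-Y : ℝ) * I) / ((x : ℂ) + (-Y : ℝ) * I)) -
      (∫ x in (-b)..c, F ((x : ℂ) + Y * I) / ((x : ℂ) + Y * I)) +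
      I • (∫ y in (-Y)..Y, F ((c : ℂ) + y * I) / ((c : ℂ) + y * I)) -
      I • (∫ y in (-Y)..Y, F (((-b : ℝ) : ℂ) + y * I) / (((-b : ℝ) : ℂ) + y * I)) =
      2 * π * I * F 0 := by
  have hmem : ∀ x y : ℝ, x ∈ Set.Icc (-b) c → y ∈ Set.Icc (-Y) Y →
      (x : ℂ) + y * I ∈ Set.Icc (-b) c ×ℂ Set.Icc (-Y) Y := fun x y hx hy => by
    rw [Complex.mem_reProdIm]
    simpa using ⟨hx, hy⟩
  have hnhds : Set.Icc (-b) c ×ℂ Set.Icc (-Y) Y ∈ 𝓝 (0 : ℂ) := by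
    have h1 : Set.Icc (-b) c ∈ 𝓝 (0 : ℂ).re := Icc_mem_nhds (by simpa using hb) (by simpa using hc)
    have h2 : Set.Icc (-Y) Y ∈ 𝓝 (0 : ℂ).im := Icc_mem_nhds (by simpa using hY) (by simpa using hY)
    exact Filter.inter_mem (Complex.continuous_re.continuousAt.preimage_mem_nhds h1)
      (Complex.continuous_im.continuousAt.preimage_mem_nhds h2)
  have hbc : -b ≤ c := by linarith
  have hYY : -Y ≤ Y := by linarith
  -- `dslope F 0` is holomorphic and equals (F w - F 0)/w away from 0, so its boundary integral
  -- vanishes and only F 0 times the integral of 1/w remains.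
  have hd := (Complex.differentiableOn_dslope hnhds).2 hF
  have key := Complex.integral_boundary_rect_eq_zero_of_differentiableOn (dslope F 0)
    (((-b : ℝ) : ℂ) + (-Y : ℝ) * I) ((c : ℂ) + Y * I) (by
      simpa [Set.uIcc_of_le hbc, Set.uIcc_of_le hYY] using hd)
  have hre : ∀ x y : ℝ, ((x : ℂ) + y * I).re = x := fun x y => by simp
  have him : ∀ x y : ℝ, ((x : ℂ) + y * I).im = y := fun x y => by simp
  simp only [hre, him] at key
  have hsl : ∀ w : ℂ, w ≠ 0 → dslope F 0 w = F w / w - F 0 * w⁻¹ := fun w hw => by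
    rw [dslope_of_ne _ hw, slope_def_field, sub_zero]
    ring
  have hH : ∀ y : ℝ, y ≠ 0 → y ∈ Set.Icc (-Y) Y → (∫ x in (-b)..c, dslope F 0 ((x : ℂ) + y * I)) =
      (∫ x in (-b)..c, F ((x : ℂ) + y * I) / ((x : ℂ) + y * I)) -
        F 0 * ∫ x in (-b)..c, ((x : ℂ) + y * I)⁻¹ := by
    intro y hy0 hy
    have hne : ∀ x : ℝ, (x : ℂ) + y * I ≠ 0 := fun x h => hy0 (by simpa using congrArg Complex.im h)
    have hci : Continuous fun x : ℝ => ((x : ℂ) + y * I)⁻¹ := Continuous.inv₀ (by fun_prop) hne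
    rw [← intervalIntegral.integral_const_mul, ← intervalIntegral.integral_sub]
    · exact intervalIntegral.integral_congr fun x _ => hsl _ (hne x)
    · refine ContinuousOn.intervalIntegrable ?_
      rw [Set.uIcc_of_le hbc]
      simp only [div_eq_mul_inv]
      exact (hF.continuousOn.comp (f := fun x : ℝ => (x : ℂ) + y * I) (by fun_prop)
        fun x hx => hmem x y hx hy).mul hci.continuousOn
    · exact (continuous_const.mul hci).intervalIntegrable _ _
  have hV : ∀ x : ℝ, x ≠ 0 → x ∈ Set.Icc (-b) c → (∫ y in (-Y)..Y, dslope F 0 ((x : ℂ) + y * I)) =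
      (∫ y in (-Y)..Y, F ((x : ℂ) + y * I) / ((x : ℂ) + y * I)) -
        F 0 * ∫ y in (-Y)..Y, ((x : ℂ) + y * I)⁻¹ := by
    intro x hx0 hx
    have hne : ∀ y : ℝ, (x : ℂ) + y * I ≠ 0 := fun y h => hx0 (by simpa using congrArg Complex.re h)
    have hci : Continuous fun y : ℝ => ((x : ℂ) + y * I)⁻¹ := Continuous.inv₀ (by fun_prop) hne
    rw [← intervalIntegral.integral_const_mul, ← intervalIntegral.integral_sub]
    · exact intervalIntegral.integral_congr fun y _ => hsl _ (hne y)
    · refine ContinuousOn.intervalIntegrable ?_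
      rw [Set.uIcc_of_le hYY]
      simp only [div_eq_mul_inv]
      exact (hF.continuousOn.comp (f := fun y : ℝ => (x : ℂ) + y * I) (by fun_prop)
        fun y hy => hmem x y hx hy).mul hci.continuousOn
    · exact (continuous_const.mul hci).intervalIntegrable _ _
  rw [hH (-Y) (by simpa using hY.ne') ⟨le_rfl, hYY⟩, hH Y hY.ne' ⟨hYY, le_rfl⟩,
    hV c hc.ne' ⟨hbc, le_rfl⟩, hV (-b) (by simpa using hb.ne') ⟨le_rfl, hbc⟩] at key
  rw [← integral_boundary_rect_inv hb hc hY]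
  simp only [smul_eq_mul] at key ⊢
  linear_combination key

end RectangleCauchy

/-! ### Smoothed truncation with a Gaussian kernel -/

section Smoothing

/-- A smoothed cutoff, close to `1` for large positive and to `0` for large negative `u`. -/
noncomputable def smoothCutoff (Y u : ℝ) : ℂ :=
  (2 * π : ℂ)⁻¹ * ∫ v in (-Y)..Y, Complex.exp (((3 / 2 : ℝ) + v * I : ℂ) ^ 2 + u * ((3 / 2 : ℝ) + v * I)) /
    ((3 / 2 : ℝ) + v * I)

lemma norm_exp_sq_add_mul (u x v : ℝ) :
    ‖Complex.exp ((x + v * I : ℂ) ^ 2 + u * (x + v * I))‖ = Real.exp (x ^ 2 - v ^ 2 + u * x) := by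
  rw [Complex.norm_exp]
  congr 1
  simp [pow_two]

lemma intervalIntegral_exp_neg_sq_le (Y : ℝ) (hY : 0 ≤ Y) :
    ∫ v in (-Y)..Y, Real.exp (-v ^ 2) ≤ 2 := by
  have h := integral_gaussian 1
  have hi := integrable_exp_neg_mul_sq (b := 1) one_pos
  simp only [div_one, neg_mul, one_mul] at h hi
  rw [intervalIntegral.integral_of_le (by linarith)]
  refine (setIntegral_le_integral hi (Eventually.of_forall fun v => (Real.exp_pos _).le)).trans ?_
  rw [h, Real.sqrt_le_left (by norm_num)]
  linarith [Real.pi_le_four]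

/-- Truncated smoothing: the value of a bounded holomorphic function at `0` is close to a smoothed
integral to the right. -/
lemma norm_sub_integral_smoothing_le {F : ℂ → ℂ} {b u Y B : ℝ} (hb : 0 < b) (hb1 : b ≤ 1)
    (hu : 0 ≤ u) (hY : 1 ≤ Y) (huY : 5 / 2 * u + 9 / 4 ≤ Y ^ 2)
    (hF : DifferentiableOn ℂ F (Set.Icc (-b) (3 / 2) ×ℂ Set.Icc (-Y) Y))
    (hB : ∀ w ∈ Set.Icc (-b) (3 / 2) ×ℂ Set.Icc (-Y) Y, ‖F w‖ ≤ B) :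
    ‖F 0 - (2 * π : ℂ)⁻¹ * ∫ v in (-Y)..Y,
      Complex.exp (((3 / 2 : ℝ) + v * I : ℂ) ^ 2 + u * ((3 / 2 : ℝ) + v * I)) *
        F ((3 / 2 : ℝ) + v * I) / ((3 / 2 : ℝ) + v * I)‖ ≤ 6 / b * Real.exp (-(b * u)) * B := by
  have hmem : ∀ x y : ℝ, x ∈ Set.Icc (-b) (3 / 2) → y ∈ Set.Icc (-Y) Y →
      (x : ℂ) + y * I ∈ Set.Icc (-b) (3 / 2) ×ℂ Set.Icc (-Y) Y := fun x y hx hy => by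
    rw [Complex.mem_reProdIm]
    simpa using ⟨hx, hy⟩
  have hY0 : 0 < Y := by linarith
  have hB0 : 0 ≤ B := (norm_nonneg _).trans (hB (((-b : ℝ) : ℂ) + Y * I)
    (hmem _ _ ⟨le_rfl, by linarith⟩ ⟨by linarith, le_rfl⟩))
  set G : ℂ → ℂ := fun w => Complex.exp (w ^ 2 + u * w) * F w with hG
  have hGd : DifferentiableOn ℂ G (Set.Icc (-b) (3 / 2) ×ℂ Set.Icc (-Y) Y) :=
    DifferentiableOn.mul (by fun_prop) hF
  have hC := integral_boundary_rect_div hb (by norm_num : (0 : ℝ) < 3 / 2) hY0 hGd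
  have hG0 : G 0 = F 0 := by simp [hG]
  rw [hG0] at hC
  -- For -b ≤ x ≤ 3/2 one has x² - Y² + ux ≤ -bu, because x² ≤ 9/4 and u(x + b) ≤ 5u/2; this is
  -- where the lower bound for Y² comes from.
  have hhor : ∀ y : ℝ, |y| = Y →
      ‖∫ x in (-b)..(3 / 2 : ℝ), G ((x : ℂ) + y * I) / ((x : ℂ) + y * I)‖ ≤
        3 * (Real.exp (-(b * u)) * B) := by
    intro y hy
    have hyI : y ∈ Set.Icc (-Y) Y := abs_le.1 hy.le
    have hy2 : y ^ 2 = Y ^ 2 := by rw [← hy, sq_abs]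
    have hbd := intervalIntegral.norm_integral_le_of_norm_le_const (a := -b) (b := 3 / 2)
      (C := Real.exp (-(b * u)) * B) (f := fun x : ℝ => G ((x : ℂ) + y * I) / ((x : ℂ) + y * I))
      (fun x hx => by
        rw [Set.uIoc_of_le (by linarith)] at hx
        have hx1 : -b ≤ x := hx.1.le
        have hx2 : x ≤ 3 / 2 := hx.2
        rw [norm_div, hG, norm_mul, norm_exp_sq_add_mul]
        have h1 : 1 ≤ ‖(x : ℂ) + y * I‖ := by
          have := Complex.abs_im_le_norm ((x : ℂ) + y * I)
          simp only [Complex.add_im, Complex.ofReal_im, Complex.mul_im, Complex.ofReal_re,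
            Complex.I_im, Complex.I_re, mul_one, mul_zero, add_zero, zero_add] at this
          linarith
        refine (div_le_self (by positivity) h1).trans ?_
        gcongr
        · nlinarith
        · exact hB _ (hmem x y ⟨hx1, hx2⟩ hyI))
    refine hbd.trans ?_
    rw [abs_of_nonneg (by linarith), mul_comm]
    gcongr
    linarith
  -- On Re w = -b the factor exp(uw) gives exp(-bu), the Gaussian bounds the integral independently
  -- of Y, and |w| ≥ b.
  have hleft : ‖∫ y in (-Y)..Y, G (((-b : ℝ) : ℂ) + y * I) / (((-b : ℝ) : ℂ) + y * I)‖ ≤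
      6 / b * (Real.exp (-(b * u)) * B) := by
    have hbd := intervalIntegral.norm_integral_le_of_norm_le (a := -Y) (b := Y) (μ := volume)
      (g := fun v => Real.exp 1 * Real.exp (-(b * u)) * B / b * Real.exp (-v ^ 2))
      (f := fun y : ℝ => G (((-b : ℝ) : ℂ) + y * I) / (((-b : ℝ) : ℂ) + y * I)) (by linarith)
      (Eventually.of_forall fun v hv => by
        rw [norm_div, hG, norm_mul, norm_exp_sq_add_mul]
        have h1 : b ≤ ‖((-b : ℝ) : ℂ) + v * I‖ := by
          have := Complex.abs_re_le_norm (((-b : ℝ) : ℂ) + v * I)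
          simp only [Complex.add_re, Complex.ofReal_re, Complex.mul_re, Complex.ofReal_im,
            Complex.I_im, Complex.I_re, mul_one, mul_zero, sub_zero, add_zero, abs_neg,
            abs_of_pos hb] at this
          exact this
        have h2 : Real.exp ((-b) ^ 2 - v ^ 2 + u * -b) ≤
            Real.exp 1 * Real.exp (-(b * u)) * Real.exp (-v ^ 2) := by
          rw [← Real.exp_add, ← Real.exp_add]
          exact Real.exp_le_exp.2 (by nlinarith)
        calc _ ≤ (Real.exp 1 * Real.exp (-(b * u)) * Real.exp (-v ^ 2)) * B / b := by
              gcongr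
              exact hB _ (hmem _ _ ⟨le_rfl, by linarith⟩ ⟨hv.1.le, hv.2⟩)
          _ = _ := by ring)
      (Continuous.intervalIntegrable (by fun_prop) _ _)
    refine hbd.trans ?_
    rw [intervalIntegral.integral_const_mul]
    have h3 := intervalIntegral_exp_neg_sq_le Y hY0.le
    have h4 := Real.exp_one_lt_d9.le
    calc _ ≤ Real.exp 1 * Real.exp (-(b * u)) * B / b * 2 := by gcongr
      _ ≤ 3 * Real.exp (-(b * u)) * B / b * 2 := by gcongr; linarith
      _ = _ := by ring
  have hpi : (2 * π : ℂ) ≠ 0 := by exact_mod_cast (by positivity : (2 * π : ℝ) ≠ 0)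
  have hb1' := hhor (-Y) (by rw [abs_neg, abs_of_pos hY0])
  have ht1' := hhor Y (abs_of_pos hY0)
  set Bo := ∫ x in (-b)..(3 / 2 : ℝ), G ((x : ℂ) + (-Y : ℝ) * I) / ((x : ℂ) + (-Y : ℝ) * I)
  set To := ∫ x in (-b)..(3 / 2 : ℝ), G ((x : ℂ) + Y * I) / ((x : ℂ) + Y * I)
  set Le := ∫ y in (-Y)..Y, G (((-b : ℝ) : ℂ) + y * I) / (((-b : ℝ) : ℂ) + y * I)
  set Ri := ∫ y in (-Y)..Y, G (((3 / 2 : ℝ) : ℂ) + y * I) / (((3 / 2 : ℝ) : ℂ) + y * I) with hRi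
  have heq : F 0 - (2 * π : ℂ)⁻¹ * Ri = (2 * π : ℂ)⁻¹ * (-I * (Bo - To) - Le) := by
    field_simp
    simp only [smul_eq_mul] at hC
    linear_combination (I : ℂ) * hC - (Ri - Le - 2 * π * F 0) * Complex.I_sq
  have hpi2 : ‖(2 * π : ℂ)⁻¹‖ ≤ 1 / 6 := by
    rw [norm_inv, norm_mul, Complex.norm_real, Real.norm_of_nonneg Real.pi_pos.le,
      Complex.norm_ofNat, ← one_div]
    exact one_div_le_one_div_of_le (by norm_num) (by linarith [Real.pi_gt_three])
  rw [heq, norm_mul]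
  have h6 : ‖-I * (Bo - To) - Le‖ ≤ 6 / b * (Real.exp (-(b * u)) * B) * 2 := by
    refine (norm_sub_le _ _).trans ?_
    rw [norm_mul, norm_neg, Complex.norm_I, one_mul]
    have h7 := norm_sub_le Bo To
    have h8 : 6 * (Real.exp (-(b * u)) * B) ≤ 6 / b * (Real.exp (-(b * u)) * B) := by
      gcongr
      rw [le_div_iff₀ hb]; linarith
    linarith
  calc _ ≤ 1 / 6 * (6 / b * (Real.exp (-(b * u)) * B) * 2) := by gcongr
    _ ≤ _ := by
      have : 0 ≤ 6 / b * Real.exp (-(b * u)) * B := by positivity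
      linarith

/-- The trivial bound on the line Re w = 3/2. At u = U - log n it decays like n^(-3/2), which makes
the smoothed series converge absolutely even with a weight n. -/
lemma norm_smoothCutoff_le (u : ℝ) {Y : ℝ} (hY : 0 ≤ Y) :
    ‖smoothCutoff Y u‖ ≤ 3 * Real.exp (3 / 2 * u) := by
  have hbd := intervalIntegral.norm_integral_le_of_norm_le (a := -Y) (b := Y) (μ := volume)
    (g := fun v => Real.exp (9 / 4) * Real.exp (3 / 2 * u) / (3 / 2) * Real.exp (-v ^ 2))
    (f := fun v : ℝ => Complex.exp (((3 / 2 : ℝ) + v * I : ℂ) ^ 2 + u * ((3 / 2 : ℝ) + v * I)) /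
      ((3 / 2 : ℝ) + v * I)) (by linarith)
    (Eventually.of_forall fun v hv => by
      rw [norm_div, norm_exp_sq_add_mul]
      have h1 : 3 / 2 ≤ ‖((3 / 2 : ℝ) : ℂ) + v * I‖ := by
        have := Complex.re_le_norm (((3 / 2 : ℝ) : ℂ) + v * I)
        simp only [Complex.add_re, Complex.ofReal_re, Complex.mul_re, Complex.ofReal_im,
          Complex.I_im, Complex.I_re, mul_one, mul_zero, sub_zero, add_zero] at this
        exact this
      have h2 : Real.exp ((3 / 2) ^ 2 - v ^ 2 + u * (3 / 2)) =
          Real.exp (9 / 4) * Real.exp (3 / 2 * u) * Real.exp (-v ^ 2) := by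
        rw [← Real.exp_add, ← Real.exp_add]
        congr 1
        ring
      rw [h2]
      calc _ ≤ Real.exp (9 / 4) * Real.exp (3 / 2 * u) * Real.exp (-v ^ 2) / (3 / 2) := by gcongr
        _ = _ := by ring)
    (Continuous.intervalIntegrable (by fun_prop) _ _)
  rw [intervalIntegral.integral_const_mul] at hbd
  have h3 := intervalIntegral_exp_neg_sq_le Y hY
  have hpi2 : ‖(2 * π : ℂ)⁻¹‖ ≤ 1 / 6 := by
    rw [norm_inv, norm_mul, Complex.norm_real, Real.norm_of_nonneg Real.pi_pos.le,
      Complex.norm_ofNat, ← one_div]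
    exact one_div_le_one_div_of_le (by norm_num) (by linarith [Real.pi_gt_three])
  have h4 : Real.exp (9 / 4) ≤ 12 := by
    have e : Real.exp (9 / 4) = Real.exp 1 ^ 2 * Real.exp (1 / 4) := by
      rw [← Real.exp_nat_mul, ← Real.exp_add]; norm_num
    have e1 := Real.exp_one_lt_d9.le
    have e2 : Real.exp (1 / 4) ≤ 4 / 3 := by
      have := Real.exp_bound_div_one_sub_of_interval (x := 1 / 4) (by norm_num) (by norm_num)
      norm_num at this ⊢
      linarith
    rw [e]
    calc _ ≤ (2.7182818286 : ℝ) ^ 2 * (4 / 3) := by gcongr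
      _ ≤ 12 := by norm_num
  rw [smoothCutoff, norm_mul]
  calc _ ≤ 1 / 6 * (Real.exp (9 / 4) * Real.exp (3 / 2 * u) / (3 / 2) * 2) := by
        gcongr
        exact hbd.trans (by gcongr)
    _ ≤ 1 / 6 * (12 * Real.exp (3 / 2 * u) / (3 / 2) * 2) := by gcongr
    _ ≤ _ := by linarith [Real.exp_pos (3 / 2 * u)]

/-- For u ≥ 0 this is the smoothing estimate for the constant function 1; for u < 0 the right side
already exceeds 6. -/
lemma norm_one_sub_smoothCutoff_le {b u Y : ℝ} (hb : 0 < b) (hb1 : b ≤ 1) (hY : 1 ≤ Y)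
    (huY : 5 / 2 * u + 9 / 4 ≤ Y ^ 2) :
    ‖1 - smoothCutoff Y u‖ ≤ 6 / b * Real.exp (-(b * u)) := by
  rcases le_or_gt 0 u with hu | hu
  · have h := norm_sub_integral_smoothing_le (F := fun _ => 1) (B := 1) hb hb1 hu hY huY
      (differentiableOn_const _) (fun w _ => by simp)
    simpa [smoothCutoff] using h
  · have h1 := norm_smoothCutoff_le u (Y := Y) (by linarith)
    have h2 : Real.exp (3 / 2 * u) ≤ 1 := Real.exp_le_one_iff.2 (by linarith)
    have h3 : 1 ≤ Real.exp (-(b * u)) := Real.one_le_exp (by nlinarith)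
    have h4 : 6 ≤ 6 / b := by rw [le_div_iff₀ hb]; linarith
    calc ‖1 - smoothCutoff Y u‖ ≤ 1 + 3 := by
          refine (norm_sub_le _ _).trans ?_
          rw [norm_one]; linarith
      _ ≤ 6 * 1 := by norm_num
      _ ≤ _ := by gcongr

/-- For u ≥ 0 the cutoff is at most 1 + 6/b ≤ 7/b. For u < 0 the trivial bound suffices, as
exp(3u/2) ≤ exp(bu). Only the small exponent b is spent, so that U is multiplied by b and not by
3/2. -/
lemma norm_smoothCutoff_le_exp {b u Y : ℝ} (hb : 0 < b) (hb1 : b ≤ 1) (hY : 1 ≤ Y)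
    (huY : 5 / 2 * u + 9 / 4 ≤ Y ^ 2) :
    ‖smoothCutoff Y u‖ ≤ 7 / b * Real.exp (b * u) := by
  have h5 : 7 ≤ 7 / b := by rw [le_div_iff₀ hb]; linarith
  rcases le_or_gt 0 u with hu | hu
  · have h1 := norm_one_sub_smoothCutoff_le hb hb1 hY huY
    have h2 : Real.exp (-(b * u)) ≤ 1 := Real.exp_le_one_iff.2 (by nlinarith)
    have h3 : 1 ≤ Real.exp (b * u) := Real.one_le_exp (by positivity)
    have h4 := norm_sub_norm_le (smoothCutoff Y u) 1
    rw [norm_one, norm_sub_rev] at h4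
    have h6 : 1 ≤ 1 / b := by rw [le_div_iff₀ hb]; linarith
    calc ‖smoothCutoff Y u‖ ≤ 1 + 6 / b * 1 := by
          have : 6 / b * Real.exp (-(b * u)) ≤ 6 / b * 1 := by gcongr
          linarith
      _ ≤ 7 / b * 1 := by
          have : 7 / b = 1 / b + 6 / b := by ring
          linarith
      _ ≤ _ := by gcongr
  · have h1 := norm_smoothCutoff_le u (Y := Y) (by linarith)
    refine h1.trans (mul_le_mul (by linarith) (Real.exp_le_exp.2 (by nlinarith))
      (Real.exp_pos _).le (by positivity))

end Smoothing

/-! ### Mean values of products of absolutely convergent Dirichlet series -/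

section DirichletSeries

/-- The gap is at least 1/max(m, n). The wasteful product m n separates the variables, so that the
off-diagonal double sum factors; the shortness of the series pays for it. -/
lemma inv_abs_log_sub_log_le {m n : ℕ} (hm : 1 ≤ m) (hn : 1 ≤ n) (hmn : m ≠ n) :
    |Real.log n - Real.log m|⁻¹ ≤ m * n := by
  wlog h : m < n generalizing m n
  · rw [abs_sub_comm, mul_comm]
    exact this hn hm hmn.symm (by omega)
  have hm0 : (1 : ℝ) ≤ m := by exact_mod_cast hm
  have hn0 : (0 : ℝ) < n := by exact_mod_cast hn
  have h' : (m : ℝ) + 1 ≤ n := by exact_mod_cast h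
  have hlog : 1 / (n : ℝ) ≤ Real.log n - Real.log m := by
    have := Real.log_le_sub_one_of_pos (x := (m : ℝ) / n) (by positivity)
    rw [Real.log_div (by linarith) hn0.ne'] at this
    have e : (1 : ℝ) / n ≤ 1 - m / n := by
      rw [div_le_iff₀ hn0, sub_mul, div_mul_cancel₀ _ hn0.ne']
      linarith
    linarith
  have hpos : 0 < 1 / (n : ℝ) := by positivity
  rw [abs_of_pos (hpos.trans_le hlog)]
  calc (Real.log n - Real.log m)⁻¹ ≤ (1 / (n : ℝ))⁻¹ := inv_anti₀ hpos hlog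
    _ = 1 * n := by simp
    _ ≤ m * n := by gcongr

/-- The mean value of a product of two absolutely convergent Dirichlet series. -/
lemma norm_integral_dirichletSeries_mul_sub_le {c d : ℕ → ℂ} (hc0 : c 0 = 0) (hd0 : d 0 = 0)
    (hc : Summable fun n : ℕ => ‖c n‖ * n) (hd : Summable fun n : ℕ => ‖d n‖ * n) (a b : ℝ) :
    ‖(∫ t in a..b, (∑' m : ℕ, c m * Complex.exp (-(Real.log m * I * t))) *
        ∑' n : ℕ, d n * Complex.exp (Real.log n * I * t)) - (b - a) * ∑' n : ℕ, c n * d n‖ ≤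
      2 * (∑' n : ℕ, ‖c n‖ * n) * ∑' n : ℕ, ‖d n‖ * n := by
  have hsum : ∀ {f : ℕ → ℂ}, f 0 = 0 → (Summable fun n : ℕ => ‖f n‖ * n) →
      Summable fun n => ‖f n‖ := by
    intro f hf0 hf
    refine Summable.of_nonneg_of_le (fun n => norm_nonneg _) (fun n => ?_) hf
    rcases Nat.eq_zero_or_pos n with rfl | hn
    · simp [hf0]
    · exact le_mul_of_one_le_right (norm_nonneg _) (by exact_mod_cast hn)
  have hc' := hsum hc0 hc
  have hd' := hsum hd0 hd
  have hne : ∀ x t : ℝ, ‖Complex.exp (x * I * t)‖ = 1 := fun x t => by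
    rw [show (x : ℂ) * I * t = ((x * t : ℝ) : ℂ) * I by push_cast; ring, Complex.norm_exp_ofReal_mul_I]
  have hne' : ∀ x t : ℝ, ‖Complex.exp (-(x * I * t))‖ = 1 := fun x t => by
    rw [Complex.exp_neg, norm_inv, hne, inv_one]
  have hprod := hc'.mul_of_nonneg hd' (fun _ => norm_nonneg _) (fun _ => norm_nonneg _)
  set E : ℕ × ℕ → ℂ := fun p => ∫ t in a..b, Complex.exp ((Real.log p.2 - Real.log p.1 : ℝ) * I * t)
    with hE
  have hint : HasSum (fun p : ℕ × ℕ => c p.1 * d p.2 * E p)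
      (∫ t in a..b, (∑' m : ℕ, c m * Complex.exp (-(Real.log m * I * t))) *
        ∑' n : ℕ, d n * Complex.exp (Real.log n * I * t)) := by
    have := intervalIntegral.hasSum_integral_of_dominated_convergence (ι := ℕ × ℕ) (μ := volume)
      (a := a) (b := b)
      (F := fun p t => c p.1 * d p.2 * Complex.exp ((Real.log p.2 - Real.log p.1 : ℝ) * I * t))
      (f := fun t => (∑' m : ℕ, c m * Complex.exp (-(Real.log m * I * t))) *
        ∑' n : ℕ, d n * Complex.exp (Real.log n * I * t))
      (fun p _ => ‖c p.1‖ * ‖d p.2‖)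
      (fun p => Continuous.aestronglyMeasurable (by fun_prop))
      (fun p => Eventually.of_forall fun t _ => by rw [norm_mul, hne, mul_one, norm_mul])
      (Eventually.of_forall fun t _ => hprod) (by simp)
      (Eventually.of_forall fun t _ => by
        have h1 : Summable fun m : ℕ => ‖c m * Complex.exp (-(Real.log m * I * t))‖ := by
          simpa only [norm_mul, hne', mul_one] using hc'
        have h2 : Summable fun m : ℕ => ‖d m * Complex.exp (Real.log m * I * t)‖ := by
          simpa only [norm_mul, hne, mul_one] using hd'
        have h3 := (summable_mul_of_summable_norm h1 h2).hasSum
        rw [← tsum_mul_tsum_of_summable_norm h1 h2] at h3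
        convert! h3 using 2 with p
        rw [mul_mul_mul_comm, ← Complex.exp_add, Complex.ofReal_sub]
        congr 2
        ring)
    simpa only [intervalIntegral.integral_const_mul] using this
  have hdiag : HasSum (fun p : ℕ × ℕ => c p.1 * d p.2 * if p.1 = p.2 then ((b : ℂ) - a) else 0)
      ((b - a) * ∑' n : ℕ, c n * d n) := by
    have hinj : Function.Injective fun n : ℕ => (n, n) := fun x y h => (Prod.mk.inj h).1
    rw [← hinj.hasSum_iff]
    · have h1 : Summable fun n => c n * d n := by
        have := (summable_mul_of_summable_norm hc' hd').comp_injective hinj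
        exact this
      have := h1.hasSum.mul_left ((b : ℂ) - a)
      convert! this using 2 with n
      simp [mul_comm]
    · rintro ⟨x, y⟩ h
      have : x ≠ y := fun e => h ⟨x, by simp [e]⟩
      simp [this]
  have hW := hc.mul_of_nonneg hd (fun _ => by positivity) (fun _ => by positivity)
  have hterm : ∀ p : ℕ × ℕ, ‖c p.1 * d p.2 * E p - c p.1 * d p.2 * (if p.1 = p.2 then ((b : ℂ) - a) else 0)‖ ≤
      2 * ((‖c p.1‖ * p.1) * (‖d p.2‖ * p.2)) := by
    rintro ⟨m, n⟩
    simp only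
    rcases Nat.eq_zero_or_pos m with rfl | hm
    · simp [hc0]
    rcases Nat.eq_zero_or_pos n with rfl | hn
    · simp [hd0]
    by_cases hmn : m = n
    · subst hmn
      simp only [hE, sub_self, Complex.ofReal_zero, zero_mul, Complex.exp_zero,
        intervalIntegral.integral_const, if_true]
      simp
      positivity
    · have h0 : Real.log n - Real.log m ≠ 0 := fun h => hmn (by
        have := Real.log_injOn_pos (show (0 : ℝ) < n by exact_mod_cast hn)
          (show (0 : ℝ) < m by exact_mod_cast hm) (sub_eq_zero.1 h)
        exact_mod_cast this.symm)
      have h1 := norm_integral_exp_le (a := a) (b := b) h0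
      have h2 := inv_abs_log_sub_log_le hm hn hmn
      rw [if_neg hmn, mul_zero, sub_zero, norm_mul, norm_mul]
      calc ‖c m‖ * ‖d n‖ * ‖E (m, n)‖ ≤ ‖c m‖ * ‖d n‖ * (2 * (m * n)) := by
            gcongr
            refine h1.trans ?_
            rw [div_eq_mul_inv]
            gcongr
        _ = _ := by ring
  rw [← (hint.sub hdiag).tsum_eq]
  refine (tsum_of_norm_bounded (hW.mul_left 2).hasSum hterm).trans (le_of_eq ?_)
  rw [tsum_mul_left, mul_assoc]
  congr 1
  exact (hc.tsum_mul_tsum hd hW).symm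

end DirichletSeries

/-! ### The smoothed Dirichlet series for ζ(1 + it)^z -/

section SmoothedSeries

/-- The coefficients of the smoothed Dirichlet series approximating `ζ(1 + it) ^ z`. -/
noncomputable def smoothedCoeff (Y U : ℝ) (z : ℂ) (n : ℕ) : ℂ :=
  divisorFun z n * ((n : ℝ)⁻¹ : ℝ) * smoothCutoff Y (U - Real.log n)

lemma smoothedCoeff_zero (Y U : ℝ) (z : ℂ) : smoothedCoeff Y U z 0 = 0 := by
  simp [smoothedCoeff]

lemma exp_mul_log_eq_rpow {n : ℕ} (hn : 1 ≤ n) (x : ℝ) :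
    Real.exp (x * Real.log n) = (n : ℝ) ^ x := by
  rw [Real.rpow_def_of_pos (by exact_mod_cast hn), mul_comm]

/-- The weight n required by the off-diagonal terms cancels the 1/n in the coefficient, and the
cutoff supplies exp(3U/2) n^(-3/2). -/
lemma norm_smoothedCoeff_mul_le {Y k : ℝ} (hY : 0 ≤ Y) (U : ℝ) {z : ℂ} (hz : ‖z‖ ≤ k) (n : ℕ) :
    ‖smoothedCoeff Y U z n‖ * n ≤
      3 * Real.exp (3 / 2 * U) * (divisorFunReal k n * (n : ℝ) ^ (-(3 / 2) : ℝ)) := by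
  rcases Nat.eq_zero_or_pos n with rfl | hn
  · simp [smoothedCoeff_zero]
  have hn0 : (0 : ℝ) < n := by exact_mod_cast hn
  have h1 := norm_divisorFun_le hz n
  have h2 := norm_smoothCutoff_le (U - Real.log n) hY
  have h3 : Real.exp (3 / 2 * (U - Real.log n)) = Real.exp (3 / 2 * U) * (n : ℝ) ^ (-(3 / 2) : ℝ) := by
    rw [← exp_mul_log_eq_rpow hn, ← Real.exp_add]
    congr 1
    ring
  have hd := (norm_nonneg _).trans h1
  rw [smoothedCoeff, norm_mul, norm_mul, Complex.norm_real, Real.norm_of_nonneg (by positivity)]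
  calc ‖divisorFun z n‖ * (n : ℝ)⁻¹ * ‖smoothCutoff Y (U - Real.log n)‖ * n
      = ‖divisorFun z n‖ * ‖smoothCutoff Y (U - Real.log n)‖ := by field_simp
    _ ≤ divisorFunReal k n * (3 * (Real.exp (3 / 2 * U) * (n : ℝ) ^ (-(3 / 2) : ℝ))) := by
        rw [← h3]; gcongr
    _ = _ := by ring

lemma summable_norm_smoothedCoeff_mul {Y k : ℝ} (hY : 0 ≤ Y) (U : ℝ) {z : ℂ} (hz : ‖z‖ ≤ k) :
    (Summable fun n : ℕ => ‖smoothedCoeff Y U z n‖ * n) ∧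
      ∑' n : ℕ, ‖smoothedCoeff Y U z n‖ * n ≤
        3 * Real.exp (3 / 2 * U) * Real.exp (k * logZetaReal (3 / 2)) := by
  have h := summable_and_tsum_divisorFunReal_le ((norm_nonneg z).trans hz) (σ := 3 / 2) (by norm_num)
  have h1 := h.1.mul_left (3 * Real.exp (3 / 2 * U))
  have h2 : Summable fun n : ℕ => ‖smoothedCoeff Y U z n‖ * n :=
    Summable.of_nonneg_of_le (fun n => by positivity) (norm_smoothedCoeff_mul_le hY U hz) h1
  refine ⟨h2, (h2.tsum_le_tsum (norm_smoothedCoeff_mul_le hY U hz) h1).trans ?_⟩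
  rw [tsum_mul_left]
  gcongr
  exact h.2

/-- The smoothed Dirichlet series approximating `ζ(1 + it) ^ z`. -/
noncomputable def smoothedSeries (Y U : ℝ) (z : ℂ) (t : ℝ) : ℂ :=
  ∑' n : ℕ, smoothedCoeff Y U z n * Complex.exp (-(Real.log n * I * t))

/-- A bound valid for every t, for use on the exceptional set: the cutoff contributes exp(bU)
n^(-b), which moves the abscissa from 1 to 1 + b. -/
lemma norm_smoothedSeries_le {b k U Y : ℝ} (hb : 0 < b) (hb1 : b ≤ 1) (hY : 1 ≤ Y)
    (hUY : 5 / 2 * U + 9 / 4 ≤ Y ^ 2) {z : ℂ} (hz : ‖z‖ ≤ k) (t : ℝ) :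
    ‖smoothedSeries Y U z t‖ ≤ 7 / b * Real.exp (b * U) * Real.exp (k * logZetaReal (1 + b)) := by
  have h := summable_and_tsum_divisorFunReal_le ((norm_nonneg z).trans hz) (σ := 1 + b) (by linarith)
  have h1 := h.1.mul_left (7 / b * Real.exp (b * U))
  refine (tsum_of_norm_bounded h1.hasSum fun n => ?_).trans ?_
  · rcases Nat.eq_zero_or_pos n with rfl | hn
    · simp [smoothedCoeff_zero]
    have hn0 : (0 : ℝ) < n := by exact_mod_cast hn
    have hlog : 0 ≤ Real.log n := Real.log_natCast_nonneg _
    have e1 : ‖Complex.exp (-(Real.log n * I * t))‖ = 1 := by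
      rw [show -((Real.log n : ℂ) * I * t) = ((-(Real.log n * t) : ℝ) : ℂ) * I by push_cast; ring,
        Complex.norm_exp_ofReal_mul_I]
    have h2 := norm_smoothCutoff_le_exp (u := U - Real.log n) hb hb1 hY (by linarith)
    have h3 : Real.exp (b * (U - Real.log n)) = Real.exp (b * U) * (n : ℝ) ^ (-b : ℝ) := by
      rw [← exp_mul_log_eq_rpow hn, ← Real.exp_add]
      congr 1
      ring
    have h4 := norm_divisorFun_le hz n
    have hd := (norm_nonneg _).trans h4
    rw [norm_mul, e1, mul_one, smoothedCoeff, norm_mul, norm_mul, Complex.norm_real,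
      Real.norm_of_nonneg (by positivity)]
    calc _ ≤ divisorFunReal k n * (n : ℝ)⁻¹ * (7 / b * (Real.exp (b * U) * (n : ℝ) ^ (-b : ℝ))) := by
          rw [← h3]; gcongr
      _ = _ := by
          rw [neg_add, Real.rpow_add hn0, Real.rpow_neg_one]
          ring
  · rw [tsum_mul_left]
    gcongr
    exact h.2

end SmoothedSeries

/-! ### Symmetry under complex conjugation -/

section Conjugation

lemma logZetaEuler_conj {s : ℂ} (hs : 1 < s.re) : logZetaEuler (conj s) = conj (logZetaEuler s) := by
  rw [logZetaEuler, logZetaEuler, Complex.conj_tsum]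
  refine tsum_congr fun p => ?_
  have h1 : ((p : ℕ) : ℂ) ^ (-conj s) = conj (((p : ℕ) : ℂ) ^ (-s)) := by
    rw [← map_neg, Complex.cpow_conj _ _ (by rw [Complex.natCast_arg]; exact Real.pi_pos.ne)]
    simp
  have h2 : ‖((p : ℕ) : ℂ) ^ (-s)‖ < 1 := by
    rw [norm_prime_cpow]
    exact Real.rpow_lt_one_of_one_lt_of_neg (by exact_mod_cast p.2.one_lt) (by linarith)
  have h3 : (1 - ((p : ℕ) : ℂ) ^ (-s)).arg ≠ π := by
    refine (Complex.mem_slitPlane_iff_arg.1 (Or.inl ?_)).1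
    have := (Complex.re_le_norm _).trans_lt h2
    simp only [Complex.sub_re, Complex.one_re]
    linarith
  rw [h1, map_neg, ← Complex.log_conj _ h3]
  simp

lemma logDeriv_riemannZeta_conj (s : ℂ) :
    logDeriv riemannZeta (conj s) = conj (logDeriv riemannZeta s) := by
  have h : conj ∘ riemannZeta ∘ conj = riemannZeta := by
    funext w
    simp [riemannZeta_conj]
  have hd := congrFun (deriv_conj_conj (f := riemannZeta)) (conj s)
  rw [h] at hd
  simp only [Function.comp_apply, Complex.conj_conj] at hd
  simp only [logDeriv, Pi.div_apply]
  rw [hd, riemannZeta_conj, map_div₀]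

lemma logZetaOneLine_neg {t : ℝ} (ht : t ≠ 0) : logZetaOneLine (-t) = conj (logZetaOneLine t) := by
  rw [logZetaOneLine_eq ht (σ := 2) (by norm_num), logZetaOneLine_eq (neg_ne_zero.2 ht) (σ := 2) (by norm_num),
    map_sub, ← logZetaEuler_conj (by simp)]
  congr 1
  · congr 1
    rw [map_add, map_mul, Complex.conj_ofReal, Complex.conj_ofReal, Complex.conj_I]
    push_cast
    ring
  · rw [intervalIntegral.integral_of_le (by norm_num), intervalIntegral.integral_of_le (by norm_num),
      ← integral_conj]
    refine integral_congr_ae (Eventually.of_forall fun x => ?_)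
    simp only
    rw [← logDeriv_riemannZeta_conj]
    congr 1
    simp

/-- Reduces ζ(1 - it)^{z₂} to the conjugate of a power of ζ(1 + it), so that only positive heights
have to be approximated. -/
lemma zetaOneLinePow_neg {t : ℝ} (ht : t ≠ 0) (z : ℂ) :
    zetaOneLinePow (-t) z = conj (zetaOneLinePow t (conj z)) := by
  rw [zetaOneLinePow, zetaOneLinePow, logZetaOneLine_neg ht, ← Complex.exp_conj, map_mul, Complex.conj_conj]

end Conjugation

/-! ### Continuity of t ↦ log ζ(1 + it) -/

section Continuity

/-- The closed unit disc about 2 + it lies in Re s ≥ 1, so by compactness a slightly larger disc is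
free of zeros too. Near t the function then coincides with a holomorphic logarithm on that disc,
restricted to the line. -/
lemma continuousAt_logZetaOneLine {t : ℝ} (ht : 2 ≤ |t|) : ContinuousAt logZetaOneLine t := by
  have hopen : IsOpen {s : ℂ | s ≠ 1 ∧ riemannZeta s ≠ 0} := by
    have hc : ContinuousOn riemannZeta {s | s ≠ 1} := fun s hs =>
      (differentiableAt_riemannZeta hs).continuousAt.continuousWithinAt
    have := hc.isOpen_inter_preimage isOpen_ne (isOpen_ne (x := (0 : ℂ)))
    exact this
  have hsub : Metric.closedBall (2 + t * I : ℂ) 1 ⊆ {s : ℂ | s ≠ 1 ∧ riemannZeta s ≠ 0} := by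
    intro s hs
    rw [Metric.mem_closedBall, dist_eq_norm] at hs
    have h1 := (abs_le.1 ((Complex.abs_re_le_norm _).trans hs)).1
    have h2 := (Complex.abs_im_le_norm _).trans hs
    have e1 : (s - (2 + t * I : ℂ)).re = s.re - 2 := by simp
    have e2 : (s - (2 + t * I : ℂ)).im = s.im - t := by simp
    rw [e1] at h1
    rw [e2] at h2
    refine ⟨?_, riemannZeta_ne_zero_of_one_le_re (by linarith)⟩
    rintro rfl
    simp at h2
    linarith
  obtain ⟨δ, hδ, hδs⟩ := (isCompact_closedBall (2 + t * I : ℂ) 1).exists_thickening_subset_open hopen hsub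
  rw [thickening_closedBall hδ zero_le_one] at hδs
  set r := min (δ + 1) 2 with hr
  have hr1 : 1 < r := lt_min (by linarith) (by norm_num)
  obtain ⟨g, hgd, hg⟩ := exists_log_riemannZeta_on_ball hr1 (min_le_right _ _) ht
    (fun s hs => (hδs (Metric.ball_subset_ball (min_le_left _ _) hs)).2)
  have hmem : (1 + t * I : ℂ) ∈ Metric.ball (2 + t * I : ℂ) r := by
    rw [Metric.mem_ball, dist_eq_norm]
    norm_num
    exact hr1
  have hline : ContinuousAt (fun u : ℝ => (1 + u * I : ℂ)) t := by fun_prop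
  have hcg : ContinuousAt (fun u : ℝ => g (1 + u * I)) t :=
    ContinuousAt.comp (f := fun u : ℝ => (1 + u * I : ℂ))
      (hgd.differentiableAt (Metric.isOpen_ball.mem_nhds hmem)).continuousAt hline
  refine hcg.congr ?_
  have ht0 : t ≠ 0 := fun h => by rw [h] at ht; norm_num at ht
  filter_upwards [hline.preimage_mem_nhds (Metric.isOpen_ball.mem_nhds hmem),
    isOpen_ne.mem_nhds ht0] with u hu hu0
  rw [(hg _ hu).2, logZetaHorizontal_one_add hu0]

lemma continuousAt_zetaOneLinePow {t : ℝ} (ht : 2 ≤ |t|) (z : ℂ) :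
    ContinuousAt (fun t => zetaOneLinePow t z) t :=
  (continuousAt_const.mul (continuousAt_logZetaOneLine ht)).cexp

end Continuity

/-! ### Approximation of ζ(1 + it)^z by the smoothed series -/

section Approximation

/-- Where `log ζ` is bounded to the left of the line `Re s = 1`, `ζ(1 + it) ^ z` is close to a
smoothed Dirichlet series. -/
lemma norm_zetaOneLinePow_sub_smoothedSeries_le {b k M U Y t : ℝ} (hb : 0 < b) (hb1 : b ≤ 1)
    (hU : 0 ≤ U) (hY : 1 ≤ Y) (hUY : 5 / 2 * U + 9 / 4 ≤ Y ^ 2) (ht : t ≠ 0) {z : ℂ} (hz : ‖z‖ ≤ k)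
    (h : ∀ σ v : ℝ, 1 - b ≤ σ → |v| ≤ Y → DifferentiableAt ℂ logZetaHorizontal (σ + (t + v : ℝ) * I) ∧
      ‖logZetaHorizontal (σ + (t + v : ℝ) * I)‖ ≤ M) :
    ‖zetaOneLinePow t z - smoothedSeries Y U z t‖ ≤ 6 / b * Real.exp (-(b * U)) * Real.exp (k * M) := by
  set F : ℂ → ℂ := fun w => Complex.exp (z * logZetaHorizontal (1 + t * I + w)) with hF
  have hbox : ∀ w ∈ Set.Icc (-b) (3 / 2) ×ℂ Set.Icc (-Y) Y,
      DifferentiableAt ℂ logZetaHorizontal (1 + t * I + w) ∧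
        ‖logZetaHorizontal (1 + t * I + w)‖ ≤ M := by
    intro w hw
    rw [Complex.mem_reProdIm] at hw
    have := h (1 + w.re) w.im (by linarith [hw.1.1]) (abs_le.2 hw.2)
    have e : ((1 + w.re : ℝ) : ℂ) + (t + w.im : ℝ) * I = 1 + t * I + w := by
      apply Complex.ext <;> simp
    rwa [e] at this
  have hmain := norm_sub_integral_smoothing_le (F := F) (B := Real.exp (k * M)) hb hb1 hU hY hUY
    (fun w hw => by
      have h1 : DifferentiableAt ℂ (fun w => logZetaHorizontal (1 + t * I + w)) w :=
        DifferentiableAt.comp (g := logZetaHorizontal) (f := fun w => 1 + t * I + w) w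
          (hbox w hw).1 (by fun_prop)
      exact ((h1.const_mul z).cexp).differentiableWithinAt)
    (fun w hw => by
      rw [hF, Complex.norm_exp]
      gcongr
      refine (Complex.re_le_norm _).trans ?_
      rw [norm_mul]
      exact mul_le_mul hz (hbox w hw).2 (norm_nonneg _) ((norm_nonneg _).trans hz))
  have hF0 : F 0 = zetaOneLinePow t z := by
    simp only [hF, add_zero, logZetaHorizontal_one_add ht, zetaOneLinePow]
  have hsumm := summable_and_tsum_divisorFunReal_le ((norm_nonneg z).trans hz) (σ := 5 / 2) (by norm_num)
  have hre : ∀ v : ℝ, ((5 / 2 : ℝ) + (t + v : ℝ) * I : ℂ).re = 5 / 2 := fun v => by simp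
  have hs0 : ∀ v : ℝ, ((3 / 2 : ℝ) : ℂ) + v * I ≠ 0 := fun v h => by
    have := congrArg Complex.re h
    norm_num at this
  have hs1 : ∀ v : ℝ, 1 ≤ ‖((3 / 2 : ℝ) : ℂ) + v * I‖ := fun v => by
    have := Complex.re_le_norm (((3 / 2 : ℝ) : ℂ) + v * I)
    simp only [Complex.add_re, Complex.ofReal_re, Complex.mul_re, Complex.ofReal_im,
      Complex.I_im, Complex.I_re, mul_one, mul_zero, sub_zero, add_zero] at this
    linarith
  have hFs : ∀ v : ℝ, F ((3 / 2 : ℝ) + v * I) =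
      Complex.exp (z * logZetaEuler ((5 / 2 : ℝ) + (t + v : ℝ) * I)) := fun v => by
    have e : (1 + t * I + ((3 / 2 : ℝ) + v * I) : ℂ) = (5 / 2 : ℝ) + (t + v : ℝ) * I := by
      push_cast; ring
    rw [hF, ← logZetaHorizontal_eq_logZetaEuler (by rw [hre]; norm_num), ← e]
  set a : ℕ → ℂ := fun n => divisorFun z n * ((n : ℝ)⁻¹ : ℝ) * Complex.exp (-(Real.log n * I * t)) with ha
  -- On Re w = 3/2 the Dirichlet series of ζ^z is evaluated at abscissa 5/2 and converges
  -- absolutely. The factor n^(-w) merges with exp(Uw), so the n-th term carries the cutoff at U -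
  -- log n.
  set f : ℕ → ℝ → ℂ := fun n v => a n *
    (Complex.exp (((3 / 2 : ℝ) + v * I : ℂ) ^ 2 + (U - Real.log n : ℝ) * ((3 / 2 : ℝ) + v * I)) /
      ((3 / 2 : ℝ) + v * I)) with hf
  have hfeq : ∀ n v, f n v = divisorFun z n * (n : ℂ) ^ (-((5 / 2 : ℝ) + (t + v : ℝ) * I : ℂ)) *
      (Complex.exp (((3 / 2 : ℝ) + v * I : ℂ) ^ 2 + U * ((3 / 2 : ℝ) + v * I)) /
        ((3 / 2 : ℝ) + v * I)) := by
    intro n v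
    rcases Nat.eq_zero_or_pos n with rfl | hn
    · simp [hf, ha]
    have hn0 : (0 : ℝ) < n := by exact_mod_cast hn
    have hnc : (n : ℂ) ≠ 0 := by exact_mod_cast hn.ne'
    have e1 : (((n : ℝ)⁻¹ : ℝ) : ℂ) = Complex.exp (-(Real.log n : ℂ)) := by
      rw [← Complex.ofReal_neg, ← Complex.ofReal_exp, Real.exp_neg, Real.exp_log hn0]
    have e2 : (n : ℂ) ^ (-((5 / 2 : ℝ) + (t + v : ℝ) * I : ℂ)) =
        Complex.exp (-(Real.log n : ℂ)) * Complex.exp (-(Real.log n * I * t)) *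
          Complex.exp (-(Real.log n * ((3 / 2 : ℝ) + v * I))) := by
      rw [Complex.cpow_def_of_ne_zero hnc, ← Complex.natCast_log, ← Complex.exp_add, ← Complex.exp_add]
      congr 1
      push_cast
      ring
    have e3 : Complex.exp (((3 / 2 : ℝ) + v * I : ℂ) ^ 2 + (U - Real.log n : ℝ) * ((3 / 2 : ℝ) + v * I)) =
        Complex.exp (-(Real.log n * ((3 / 2 : ℝ) + v * I))) *
          Complex.exp (((3 / 2 : ℝ) + v * I : ℂ) ^ 2 + U * ((3 / 2 : ℝ) + v * I)) := by
      rw [← Complex.exp_add, Complex.ofReal_sub]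
      congr 1
      ring
    simp only [hf, ha]
    rw [e1, e2, e3]
    ring
  have hbound : ∀ n v, ‖f n v‖ ≤ Real.exp (9 / 4 + U * (3 / 2)) *
      (divisorFunReal k n * (n : ℝ) ^ (-(5 / 2) : ℝ)) := by
    intro n v
    rcases Nat.eq_zero_or_pos n with rfl | hn
    · simp [hf, ha]
    rw [hfeq, norm_mul, norm_mul, norm_div, norm_exp_sq_add_mul, norm_natCast_cpow_neg hn, hre]
    have h1 := norm_divisorFun_le hz n
    have hd := (norm_nonneg _).trans h1
    have h2 : Real.exp ((3 / 2) ^ 2 - v ^ 2 + U * (3 / 2)) / ‖((3 / 2 : ℝ) : ℂ) + v * I‖ ≤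
        Real.exp (9 / 4 + U * (3 / 2)) := by
      refine (div_le_self (Real.exp_pos _).le (hs1 v)).trans ?_
      gcongr
      nlinarith [sq_nonneg v]
    calc _ ≤ divisorFunReal k n * (n : ℝ) ^ (-(5 / 2) : ℝ) * Real.exp (9 / 4 + U * (3 / 2)) := by
          gcongr
      _ = _ := by ring
  have hint : HasSum (fun n : ℕ => ∫ v in (-Y)..Y, f n v)
      (∫ v in (-Y)..Y, Complex.exp (((3 / 2 : ℝ) + v * I : ℂ) ^ 2 + U * ((3 / 2 : ℝ) + v * I)) *
        F ((3 / 2 : ℝ) + v * I) / ((3 / 2 : ℝ) + v * I)) := by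
    refine intervalIntegral.hasSum_integral_of_dominated_convergence
      (fun n _ => Real.exp (9 / 4 + U * (3 / 2)) * (divisorFunReal k n * (n : ℝ) ^ (-(5 / 2) : ℝ)))
      (fun n => Continuous.aestronglyMeasurable ?_)
      (fun n => Eventually.of_forall fun v _ => hbound n v)
      (Eventually.of_forall fun v _ => hsumm.1.mul_left _) (by simp)
      (Eventually.of_forall fun v _ => ?_)
    · exact continuous_const.mul (Continuous.div (by fun_prop) (by fun_prop) hs0)
    · have h1 := (hasSum_divisorFun_cpow z (s := (5 / 2 : ℝ) + (t + v : ℝ) * I)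
        (by rw [hre]; norm_num)).mul_right
        (Complex.exp (((3 / 2 : ℝ) + v * I : ℂ) ^ 2 + U * ((3 / 2 : ℝ) + v * I)) /
          ((3 / 2 : ℝ) + v * I))
      simp only [← hfeq] at h1
      rw [← hFs] at h1
      convert! h1 using 1
      ring
  have hpi : (2 * π : ℂ) ≠ 0 := by exact_mod_cast (by positivity : (2 * π : ℝ) ≠ 0)
  have hseries : smoothedSeries Y U z t = (2 * π : ℂ)⁻¹ * ∫ v in (-Y)..Y,
      Complex.exp (((3 / 2 : ℝ) + v * I : ℂ) ^ 2 + U * ((3 / 2 : ℝ) + v * I)) *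
        F ((3 / 2 : ℝ) + v * I) / ((3 / 2 : ℝ) + v * I) := by
    rw [smoothedSeries, ← (hint.mul_left (2 * π : ℂ)⁻¹).tsum_eq]
    refine tsum_congr fun n => ?_
    simp only [hf]
    rw [intervalIntegral.integral_const_mul, smoothedCoeff, smoothCutoff, ha]
    ring
  rw [hF0, ← hseries] at hmain
  exact hmain

end Approximation

/-! ### The mean value of a product of two smoothed series -/

section Diagonal

/-- 1 - W conj W = (1 - W) + W conj(1 - W), with |W| ≤ 7/b; the constant is (1 + 7) · 6 = 48. -/
lemma norm_one_sub_smoothCutoff_mul_conj_le {b u Y : ℝ} (hb : 0 < b) (hb1 : b ≤ 1) (hY : 1 ≤ Y)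
    (huY : 5 / 2 * u + 9 / 4 ≤ Y ^ 2) :
    ‖1 - smoothCutoff Y u * conj (smoothCutoff Y u)‖ ≤ 48 / b ^ 2 * Real.exp (-(b * u)) := by
  set W := smoothCutoff Y u
  have h1 : ‖1 - W‖ ≤ 6 / b * Real.exp (-(b * u)) := norm_one_sub_smoothCutoff_le hb hb1 hY huY
  have h2 : ‖W‖ ≤ 7 / b := by
    have h6 : 1 ≤ 1 / b := by rw [le_div_iff₀ hb]; linarith
    rcases le_or_gt 0 u with hu | hu
    · have h3 : Real.exp (-(b * u)) ≤ 1 := Real.exp_le_one_iff.2 (by nlinarith)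
      have h4 := norm_sub_norm_le W 1
      rw [norm_one, norm_sub_rev] at h4
      have h5 : 6 / b * Real.exp (-(b * u)) ≤ 6 / b * 1 := by gcongr
      have h7 : 7 / b = 1 / b + 6 / b := by ring
      linarith
    · have h3 : Real.exp (b * u) ≤ 1 := Real.exp_le_one_iff.2 (by nlinarith)
      calc ‖W‖ ≤ 7 / b * Real.exp (b * u) := norm_smoothCutoff_le_exp hb hb1 hY huY
        _ ≤ 7 / b * 1 := by gcongr
        _ = _ := mul_one _
  have heq : 1 - W * conj W = (1 - W) + W * conj (1 - W) := by
    rw [map_sub, map_one]; ring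
  rw [heq]
  have h3 : 1 ≤ 1 / b := by rw [le_div_iff₀ hb]; linarith
  calc ‖(1 - W) + W * conj (1 - W)‖ ≤ ‖1 - W‖ + ‖W‖ * ‖1 - W‖ := by
        refine (norm_add_le _ _).trans ?_
        rw [norm_mul, Complex.norm_conj]
    _ = (1 + ‖W‖) * ‖1 - W‖ := by ring
    _ ≤ (1 / b + 7 / b) * (6 / b * Real.exp (-(b * u))) := by gcongr
    _ = _ := by ring

lemma divisorFun_conj (z : ℂ) (n : ℕ) : divisorFun (conj z) n = conj (divisorFun z n) := by
  have h : ∀ a : ℕ, negBinomCoeff (conj z) a = conj (negBinomCoeff z a) := by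
    intro a
    induction a with
    | zero => simp
    | succ a ih => rw [negBinomCoeff_succ, negBinomCoeff_succ, ih]; simp
  rw [divisorFun_eq_primePowFun, divisorFun_eq_primePowFun, primePowFun, primePowFun]
  split_ifs
  · simp
  · simp [h, map_prod]

/-- The diagonal terms in the mean value of the smoothed series. -/
lemma norm_tsum_smoothedCoeff_sub_le {b k r U Y : ℝ} (hb : 0 < b) (hb1 : b ≤ 1) (hk : 1 ≤ k)
    (hr1 : 1 ≤ r) (hr2 : r ≤ 2) (hrb : 1 < r * (1 - b / 2)) (hY : 1 ≤ Y)
    (hUY : 5 / 2 * U + 9 / 4 ≤ Y ^ 2) {z₁ z₂ : ℂ} (hz₁ : ‖z₁‖ ≤ k) (hz₂ : ‖z₂‖ ≤ k) :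
    ‖(∑' n : ℕ, smoothedCoeff Y U z₁ n * conj (smoothedCoeff Y U (conj z₂) n)) -
      ∑' n : ℕ, divisorFun z₁ n * divisorFun z₂ n / (n : ℂ) ^ 2‖ ≤
      48 / b ^ 2 * Real.exp (-(b * U)) * Real.exp (8 * k ^ r * logZetaReal (r * (1 - b / 2))) := by
  have hsq := summable_and_tsum_divisorFunReal_sq_le (k := k) (σ := 1 - b / 2) (r := r) hk
    (by linarith) hr1 hr2 hrb
  have hz₂' : ‖conj z₂‖ ≤ k := by rwa [Complex.norm_conj]
  have hs1 : Summable fun n : ℕ => divisorFun z₁ n * divisorFun z₂ n / (n : ℂ) ^ 2 :=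
    (summable_norm_divisorFun_mul_divisorFun z₁ z₂).of_norm
  have heq : ∀ n : ℕ, divisorFun z₁ n * divisorFun z₂ n / (n : ℂ) ^ 2 -
      smoothedCoeff Y U z₁ n * conj (smoothedCoeff Y U (conj z₂) n) =
      divisorFun z₁ n * divisorFun z₂ n / (n : ℂ) ^ 2 *
        (1 - smoothCutoff Y (U - Real.log n) * conj (smoothCutoff Y (U - Real.log n))) := by
    intro n
    rw [smoothedCoeff, smoothedCoeff, map_mul, map_mul, divisorFun_conj, Complex.conj_conj,
      Complex.conj_ofReal]
    push_cast
    ring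
  have hterm : ∀ n : ℕ, ‖divisorFun z₁ n * divisorFun z₂ n / (n : ℂ) ^ 2 -
      smoothedCoeff Y U z₁ n * conj (smoothedCoeff Y U (conj z₂) n)‖ ≤
      48 / b ^ 2 * Real.exp (-(b * U)) *
        (divisorFunReal k n ^ 2 * ((n : ℝ) ^ (-(1 - b / 2))) ^ 2) := by
    intro n
    rw [heq]
    rcases Nat.eq_zero_or_pos n with rfl | hn
    · simp
    have hn0 : (0 : ℝ) < n := by exact_mod_cast hn
    have hlog : 0 ≤ Real.log n := Real.log_natCast_nonneg _
    have h1 := norm_one_sub_smoothCutoff_mul_conj_le (u := U - Real.log n) hb hb1 hY (by linarith)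
    have h2 : Real.exp (-(b * (U - Real.log n))) = Real.exp (-(b * U)) * (n : ℝ) ^ b := by
      rw [← exp_mul_log_eq_rpow hn, ← Real.exp_add]
      congr 1
      ring
    -- Rankin's trick: the factor n^b in the cutoff error is absorbed by lowering the abscissa from
    -- 1 to 1 - b/2.
    have h3 : ((n : ℝ) ^ (-(1 - b / 2))) ^ 2 = (n : ℝ) ^ b / (n : ℝ) ^ 2 := by
      rw [← Real.rpow_natCast, ← Real.rpow_mul hn0.le, ← Real.rpow_natCast (n : ℝ) 2,
        ← Real.rpow_sub hn0]
      congr 1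
      push_cast
      ring
    have d1 := norm_divisorFun_le hz₁ n
    have d2 := norm_divisorFun_le hz₂ n
    have hd := (norm_nonneg _).trans d1
    rw [norm_mul, norm_div, norm_mul, norm_pow, Complex.norm_natCast, h3]
    rw [h2] at h1
    calc _ ≤ divisorFunReal k n * divisorFunReal k n / (n : ℝ) ^ 2 *
          (48 / b ^ 2 * (Real.exp (-(b * U)) * (n : ℝ) ^ b)) := by gcongr
      _ = _ := by ring
  have hs2 : Summable fun n : ℕ => divisorFun z₁ n * divisorFun z₂ n / (n : ℂ) ^ 2 -
      smoothedCoeff Y U z₁ n * conj (smoothedCoeff Y U (conj z₂) n) :=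
    Summable.of_norm_bounded (hsq.1.mul_left _) hterm
  have hs3 : Summable fun n : ℕ => smoothedCoeff Y U z₁ n * conj (smoothedCoeff Y U (conj z₂) n) := by
    have := hs1.sub hs2
    simpa using this
  rw [norm_sub_rev, ← hs1.tsum_sub hs3]
  refine (tsum_of_norm_bounded (hsq.1.mul_left _).hasSum hterm).trans ?_
  rw [tsum_mul_left]
  gcongr
  exact hsq.2

/-- The mean value of a product of two smoothed series. -/
lemma norm_integral_smoothedSeries_sub_le {b k r T U Y : ℝ} (hb : 0 < b) (hb1 : b ≤ 1) (hk : 1 ≤ k)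
    (hr1 : 1 ≤ r) (hr2 : r ≤ 2) (hrb : 1 < r * (1 - b / 2)) (hT : 0 < T) (hY : 1 ≤ Y)
    (hUY : 5 / 2 * U + 9 / 4 ≤ Y ^ 2) {z₁ z₂ : ℂ} (hz₁ : ‖z₁‖ ≤ k) (hz₂ : ‖z₂‖ ≤ k) :
    ‖1 / (T : ℂ) * (∫ t in T..(2 * T), smoothedSeries Y U z₁ t * conj (smoothedSeries Y U (conj z₂) t)) -
      ∑' n : ℕ, divisorFun z₁ n * divisorFun z₂ n / (n : ℂ) ^ 2‖ ≤
      18 / T * Real.exp (3 * U) * Real.exp (2 * (k * logZetaReal (3 / 2))) +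
      48 / b ^ 2 * Real.exp (-(b * U)) * Real.exp (8 * k ^ r * logZetaReal (r * (1 - b / 2))) := by
  have hz₂' : ‖conj z₂‖ ≤ k := by rwa [Complex.norm_conj]
  have hY0 : 0 ≤ Y := by linarith
  have hs1 := summable_norm_smoothedCoeff_mul hY0 U hz₁
  have hs2 := summable_norm_smoothedCoeff_mul hY0 U hz₂'
  have hconj : ∀ t : ℝ, conj (smoothedSeries Y U (conj z₂) t) =
      ∑' n : ℕ, conj (smoothedCoeff Y U (conj z₂) n) * Complex.exp (Real.log n * I * t) := by
    intro t
    rw [smoothedSeries, Complex.conj_tsum]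
    refine tsum_congr fun n => ?_
    rw [map_mul, ← Complex.exp_conj, map_neg, map_mul, map_mul, Complex.conj_ofReal,
      Complex.conj_ofReal, Complex.conj_I]
    congr 2
    ring
  have hmain := norm_integral_dirichletSeries_mul_sub_le (c := smoothedCoeff Y U z₁)
    (d := fun n => conj (smoothedCoeff Y U (conj z₂) n)) (smoothedCoeff_zero _ _ _)
    (by simp [smoothedCoeff_zero]) hs1.1 (by simpa only [Complex.norm_conj] using hs2.1) T (2 * T)
  have hdiag := norm_tsum_smoothedCoeff_sub_le hb hb1 hk hr1 hr2 hrb hY hUY hz₁ hz₂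
  simp only [← hconj, Complex.norm_conj] at hmain
  set J := ∫ t in T..(2 * T), smoothedSeries Y U z₁ t * conj (smoothedSeries Y U (conj z₂) t) with hJ
  have hJ' : ∫ t in T..(2 * T), (∑' m : ℕ, smoothedCoeff Y U z₁ m * Complex.exp (-(Real.log m * I * t))) *
      conj (smoothedSeries Y U (conj z₂) t) = J := rfl
  rw [hJ'] at hmain
  set D := ∑' n : ℕ, smoothedCoeff Y U z₁ n * conj (smoothedCoeff Y U (conj z₂) n) with hD
  set S := ∑' n : ℕ, divisorFun z₁ n * divisorFun z₂ n / (n : ℂ) ^ 2 with hS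
  have hTc : (T : ℂ) ≠ 0 := by exact_mod_cast hT.ne'
  have heq : 1 / (T : ℂ) * J - S = 1 / (T : ℂ) * (J - (((2 * T : ℝ) : ℂ) - T) * D) + (D - S) := by
    field_simp
    push_cast
    ring
  rw [heq]
  refine (norm_add_le _ _).trans (add_le_add ?_ hdiag)
  rw [norm_mul, norm_div, norm_one, Complex.norm_real, Real.norm_of_nonneg hT.le]
  have hpos : 0 ≤ ∑' n : ℕ, ‖smoothedCoeff Y U (conj z₂) n‖ * n := tsum_nonneg fun n => by positivity
  calc _ ≤ 1 / T * (2 * (3 * Real.exp (3 / 2 * U) * Real.exp (k * logZetaReal (3 / 2))) *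
        (3 * Real.exp (3 / 2 * U) * Real.exp (k * logZetaReal (3 / 2)))) := by
        gcongr
        refine hmain.trans ?_
        gcongr
        · exact hs1.2
        · exact hs2.2
    _ = 18 / T * (Real.exp (3 / 2 * U) * Real.exp (3 / 2 * U)) *
        (Real.exp (k * logZetaReal (3 / 2)) * Real.exp (k * logZetaReal (3 / 2))) := by ring
    _ = _ := by
        rw [← Real.exp_add, ← Real.exp_add]
        congr 3
        · ring
        · ring

end Diagonal

/-! ### Comparison of the moments of `ζ` with those of the smoothed series -/

section MeanValueComparison

/-- For most `t` in `[T, 2 T]`, `log ζ` is small in a region around `1 + it`. -/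
lemma exists_measurableSet_norm_logZetaHorizontal_le :
    ∃ C : ℝ, 0 ≤ C ∧ ∀ T : ℝ, Real.exp (Real.exp 400) ≤ T → ∃ E : Set ℝ, MeasurableSet E ∧
      volume E ≤ ENNReal.ofReal (C * Real.log T * T ^ (7 / 8 : ℝ)) ∧
      ∀ t ∈ Set.Icc T (2 * T), t ∉ E → ∀ σ v : ℝ, 1 - 4 / Real.log (Real.log T) ≤ σ →
        |v| ≤ Real.log T → DifferentiableAt ℂ logZetaHorizontal (σ + (t + v : ℝ) * I) ∧
          ‖logZetaHorizontal (σ + (t + v : ℝ) * I)‖ ≤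
            Real.exp 1100 * Real.log (1 + Real.log (Real.log T)) := by
  obtain ⟨C, hC0, hC⟩ := exists_measurableSet_riemannZeta_ne_zero
  refine ⟨2 * C, by positivity, fun T hT => ?_⟩
  have hT0 : 0 < T := (Real.exp_pos _).trans_le hT
  have hL : Real.exp 400 ≤ Real.log T := by
    rw [← Real.log_exp (Real.exp 400)]; exact Real.log_le_log (Real.exp_pos _) hT
  have hL1 : 401 ≤ Real.log T := by
    have := Real.add_one_le_exp 400; linarith
  have hTL : Real.log T ^ 2 / 2 ≤ T := by
    have := Real.quadratic_le_exp_of_nonneg (x := Real.log T) (by linarith)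
    rw [Real.exp_log hT0] at this
    linarith
  have hTL2 : 4 * (Real.log T + 2) ≤ T := by nlinarith
  -- The extra 2 covers the radius 1.03 of the zero-free disc about 2 + i(t + v) for every |v| ≤ log
  -- T.
  obtain ⟨E, hE, hEv, hEz⟩ := hC T (Real.log T + 2) (by linarith) (by linarith) (by linarith)
  refine ⟨E, hE, hEv.trans (ENNReal.ofReal_le_ofReal ?_), fun t ht htE σ v hσ hv => ?_⟩
  · have : Real.log T + 2 ≤ 2 * Real.log T := by linarith
    calc C * (Real.log T + 2) * T ^ (7 / 8 : ℝ) ≤ C * (2 * Real.log T) * T ^ (7 / 8 : ℝ) := by gcongr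
      _ = _ := by ring
  · have hv' := abs_le.1 hv
    have htv : 4 ≤ t + v := by linarith [ht.1]
    refine differentiableAt_and_norm_logZetaHorizontal_le hT ?_ ?_ (fun s hs => ?_) hσ
    · exact htv.trans (le_abs_self _)
    · rw [abs_of_nonneg (by linarith)]
      linarith [ht.2]
    · rw [Metric.mem_ball, dist_eq_norm] at hs
      have h1 := abs_le.1 ((Complex.abs_re_le_norm _).trans hs.le)
      have h2 := abs_le.1 ((Complex.abs_im_le_norm _).trans hs.le)
      have e1 : (s - (2 + (t + v : ℝ) * I : ℂ)).re = s.re - 2 := by simp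
      have e2 : (s - (2 + (t + v : ℝ) * I : ℂ)).im = s.im - (t + v) := by simp
      rw [e1] at h1
      rw [e2] at h2
      refine hEz t ht htE s (by linarith [h1.1]) (abs_le.2 ⟨?_, ?_⟩) <;> linarith [h2.1, h2.2]

lemma continuous_smoothedSeries {Y : ℝ} (hY : 0 ≤ Y) (U : ℝ) (z : ℂ) :
    Continuous (smoothedSeries Y U z) := by
  have h := (summable_norm_smoothedCoeff_mul hY U (le_refl ‖z‖)).1
  refine continuous_tsum (fun n => by fun_prop) h fun n t => ?_
  rcases Nat.eq_zero_or_pos n with rfl | hn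
  · simp [smoothedCoeff_zero]
  have e1 : ‖Complex.exp (-(Real.log n * I * t))‖ = 1 := by
    rw [show -((Real.log n : ℂ) * I * t) = ((-(Real.log n * t) : ℝ) : ℂ) * I by push_cast; ring,
      Complex.norm_exp_ofReal_mul_I]
  rw [norm_mul, e1, mul_one]
  exact le_mul_of_one_le_right (norm_nonneg _) (by exact_mod_cast hn)

lemma norm_zetaOneLinePow_le {t k R : ℝ} {z : ℂ} (hz : ‖z‖ ≤ k) (h : ‖logZetaOneLine t‖ ≤ R) :
    ‖zetaOneLinePow t z‖ ≤ Real.exp (k * R) := by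
  rw [zetaOneLinePow, Complex.norm_exp]
  gcongr
  refine (Complex.re_le_norm _).trans ?_
  rw [norm_mul]
  exact mul_le_mul hz h (norm_nonneg _) ((norm_nonneg _).trans hz)

lemma continuousOn_zetaOneLinePow_mul {T : ℝ} (hT : 2 ≤ T) (z₁ z₂ : ℂ) :
    ContinuousOn (fun t : ℝ => zetaOneLinePow t z₁ * zetaOneLinePow (-t) z₂) (Set.uIcc T (2 * T)) := by
  intro t ht
  rw [Set.uIcc_of_le (by linarith)] at ht
  have ht2 : 2 ≤ |t| := (hT.trans ht.1).trans (le_abs_self t)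
  have h2 : ContinuousAt (fun t => zetaOneLinePow (-t) z₂) t :=
    ContinuousAt.comp (g := fun t => zetaOneLinePow t z₂) (f := fun t : ℝ => -t)
      (continuousAt_zetaOneLinePow (by rwa [abs_neg]) z₂) (by fun_prop)
  exact ((continuousAt_zetaOneLinePow ht2 z₁).mul h2).continuousWithinAt

/-- Comparison of the mean values of `ζ(1 + it) ^ z₁ ζ(1 - it) ^ z₂` and of its smoothed version. -/
lemma norm_integral_zetaOneLinePow_sub_le {b k M R T U V Y : ℝ} {E : Set ℝ} (hb : 0 < b) (hb1 : b ≤ 1)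
    (hU : 0 ≤ U) (hY : 1 ≤ Y) (hUY : 5 / 2 * U + 9 / 4 ≤ Y ^ 2) (hT : 2 ≤ T) (hV : 0 ≤ V)
    (hE : MeasurableSet E) (hEV : volume E ≤ ENNReal.ofReal V)
    (hR : ∀ t ∈ Set.Icc T (2 * T), ‖logZetaOneLine t‖ ≤ R)
    (h : ∀ t ∈ Set.Icc T (2 * T), t ∉ E → ∀ σ v : ℝ, 1 - b ≤ σ → |v| ≤ Y →
      DifferentiableAt ℂ logZetaHorizontal (σ + (t + v : ℝ) * I) ∧
        ‖logZetaHorizontal (σ + (t + v : ℝ) * I)‖ ≤ M)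
    {z₁ z₂ : ℂ} (hz₁ : ‖z₁‖ ≤ k) (hz₂ : ‖z₂‖ ≤ k) :
    ‖1 / (T : ℂ) * (∫ t in T..(2 * T), zetaOneLinePow t z₁ * zetaOneLinePow (-t) z₂) -
      1 / (T : ℂ) * (∫ t in T..(2 * T),
        smoothedSeries Y U z₁ t * conj (smoothedSeries Y U (conj z₂) t))‖ ≤
      48 / b ^ 2 * Real.exp (-(b * U)) * Real.exp (2 * (k * M)) +
      (Real.exp (2 * (k * R)) +
        (7 / b * Real.exp (b * U) * Real.exp (k * logZetaReal (1 + b))) ^ 2) * (V / T) := by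
  have hT0 : 0 < T := by linarith
  have hTT : T ≤ 2 * T := by linarith
  have hz₂' : ‖conj z₂‖ ≤ k := by rwa [Complex.norm_conj]
  have hk : 0 ≤ k := (norm_nonneg _).trans hz₁
  set D := 48 / b ^ 2 * Real.exp (-(b * U)) * Real.exp (2 * (k * M)) with hD
  set B := Real.exp (2 * (k * R)) +
    (7 / b * Real.exp (b * U) * Real.exp (k * logZetaReal (1 + b))) ^ 2 with hB
  have hB0 : 0 ≤ B := by positivity
  have hD0 : 0 ≤ D := by positivity
  set S := fun t : ℝ => smoothedSeries Y U z₁ t * conj (smoothedSeries Y U (conj z₂) t) with hS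
  have hSc : Continuous S := (continuous_smoothedSeries (by linarith) U z₁).mul
    (Complex.continuous_conj.comp (continuous_smoothedSeries (by linarith) U (conj z₂)))
  have hpt : ∀ t ∈ Set.Icc T (2 * T), ‖zetaOneLinePow t z₁ * zetaOneLinePow (-t) z₂ - S t‖ ≤
      D + E.indicator (fun _ => B) t := by
    intro t ht
    have ht0 : t ≠ 0 := by have := ht.1; intro h; linarith
    rw [zetaOneLinePow_neg ht0]
    by_cases htE : t ∈ E
    · rw [Set.indicator_of_mem htE]
      refine (norm_sub_le _ _).trans (le_trans ?_ (le_add_of_nonneg_left hD0))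
      rw [hS, norm_mul, norm_mul, Complex.norm_conj, Complex.norm_conj, hB, pow_two,
        two_mul (k * R), Real.exp_add]
      have p1 := norm_zetaOneLinePow_le hz₁ (hR t ht)
      have p2 := norm_zetaOneLinePow_le hz₂' (hR t ht)
      have s1 := norm_smoothedSeries_le hb hb1 hY hUY hz₁ t
      have s2 := norm_smoothedSeries_le hb hb1 hY hUY hz₂' t
      gcongr
    · rw [Set.indicator_of_notMem htE, add_zero]
      have g1 := norm_zetaOneLinePow_sub_smoothedSeries_le hb hb1 hU hY hUY ht0 hz₁ (h t ht htE)
      have g2 := norm_zetaOneLinePow_sub_smoothedSeries_le hb hb1 hU hY hUY ht0 hz₂' (h t ht htE)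
      -- The point σ = 1, v = 0 of the region gives the sharper bound at 1 + it itself, available
      -- only off `E`.
      have hM : ‖logZetaOneLine t‖ ≤ M := by
        have := (h t ht htE 1 0 (by linarith) (by rw [abs_zero]; linarith)).2
        rwa [add_zero, Complex.ofReal_one, logZetaHorizontal_one_add ht0] at this
      have p1 := norm_zetaOneLinePow_le hz₁ hM
      have p2 := norm_zetaOneLinePow_le hz₂' hM
      set P₁ := zetaOneLinePow t z₁
      set P₂ := zetaOneLinePow t (conj z₂)
      set S₁ := smoothedSeries Y U z₁ t
      set S₂ := smoothedSeries Y U (conj z₂) t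
      have hex : Real.exp (-(b * U)) ≤ 1 := Real.exp_le_one_iff.2 (by
        have := mul_nonneg hb.le hU; linarith)
      have hS1 : ‖S₁‖ ≤ 7 / b * Real.exp (k * M) := by
        have h4 := norm_sub_norm_le S₁ P₁
        rw [norm_sub_rev] at h4
        have h5 : 6 / b * Real.exp (-(b * U)) * Real.exp (k * M) ≤ 6 / b * 1 * Real.exp (k * M) := by
          gcongr
        have h6 : 1 ≤ 1 / b := by rw [le_div_iff₀ hb]; linarith
        have h7 : 7 / b * Real.exp (k * M) = 1 / b * Real.exp (k * M) + 6 / b * Real.exp (k * M) := by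
          ring
        have h8 : 1 * Real.exp (k * M) ≤ 1 / b * Real.exp (k * M) := by gcongr
        linarith
      -- One factor is replaced at a time. The errors 6/b · 1/b and 7/b · 6/b, the 1/b being
      -- inserted for uniformity, add up to 48/b².
      have heq : P₁ * conj P₂ - S t = (P₁ - S₁) * conj P₂ + S₁ * conj (P₂ - S₂) := by
        simp only [hS, map_sub]
        ring
      rw [heq]
      have h6 : 1 ≤ 1 / b := by rw [le_div_iff₀ hb]; linarith
      calc _ ≤ ‖P₁ - S₁‖ * ‖P₂‖ + ‖S₁‖ * ‖P₂ - S₂‖ := by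
            refine (norm_add_le _ _).trans ?_
            rw [norm_mul, norm_mul, Complex.norm_conj, Complex.norm_conj]
        _ ≤ (6 / b * Real.exp (-(b * U)) * Real.exp (k * M)) * (1 / b * Real.exp (k * M)) +
            (7 / b * Real.exp (k * M)) * (6 / b * Real.exp (-(b * U)) * Real.exp (k * M)) := by
            gcongr
            exact p2.trans (le_mul_of_one_le_left (Real.exp_pos _).le h6)
        _ = D := by
            rw [hD, two_mul, Real.exp_add]
            ring
  have hfi := (continuousOn_zetaOneLinePow_mul hT z₁ z₂).intervalIntegrable (μ := volume)
  rw [← mul_sub, ← intervalIntegral.integral_sub hfi (hSc.intervalIntegrable _ _), norm_mul, norm_div,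
    norm_one, Complex.norm_real, Real.norm_of_nonneg hT0.le]
  have hind : IntervalIntegrable (E.indicator fun _ : ℝ => B) volume T (2 * T) := by
    rw [intervalIntegrable_iff, Set.uIoc_of_le hTT]
    exact (integrable_const B).indicator hE
  have hint := intervalIntegral.norm_integral_le_of_norm_le (a := T) (b := 2 * T) (μ := volume)
    (g := fun t => D + E.indicator (fun _ => B) t) hTT
    (Eventually.of_forall fun t ht => hpt t ⟨ht.1.le, ht.2⟩) (by
      exact (intervalIntegrable_const (c := D)).add hind)
  have hval : ∫ t in T..(2 * T), (D + E.indicator (fun _ => B) t) ≤ T * D + V * B := by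
    rw [intervalIntegral.integral_add intervalIntegrable_const hind, intervalIntegral.integral_const,
      smul_eq_mul, intervalIntegral.integral_of_le hTT, setIntegral_indicator hE, setIntegral_const,
      smul_eq_mul]
    have h1 : (volume.real (Set.Ioc T (2 * T) ∩ E)) ≤ V :=
      ENNReal.toReal_le_of_le_ofReal hV ((measure_mono Set.inter_subset_right).trans hEV)
    have h2 : (2 * T - T) = T := by ring
    rw [h2]
    gcongr
  calc _ ≤ 1 / T * (T * D + V * B) := by
        gcongr
        exact hint.trans hval
    _ = D + B * (V / T) := by field_simp

end MeanValueComparison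

/-! ### Choice of parameters and the final estimate -/

section Moments

lemma exists_mul_log_one_add_le {K : ℝ} (hK : 0 < K) : ∃ l₀ : ℝ, ∀ l ≥ l₀, K * Real.log (1 + l) ≤ l := by
  have h1 : Tendsto (fun l : ℝ => 1 + l) atTop atTop := tendsto_atTop_add_const_left _ _ tendsto_id
  have h2 := (Real.isLittleO_log_id_atTop.comp_tendsto h1).bound (c := 1 / (2 * K)) (by positivity)
  obtain ⟨l₀, hl₀⟩ := eventually_atTop.1 h2
  refine ⟨max l₀ 1, fun l hl => ?_⟩
  have h3 := hl₀ l ((le_max_left _ _).trans hl)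
  have hl1 : 1 ≤ l := (le_max_right _ _).trans hl
  simp only [Function.comp_apply, id, Real.norm_eq_abs] at h3
  rw [abs_of_nonneg (Real.log_nonneg (by linarith)), abs_of_nonneg (by linarith)] at h3
  calc K * Real.log (1 + l) ≤ K * (1 / (2 * K) * (1 + l)) := by gcongr
    _ = (1 + l) / 2 := by field_simp
    _ ≤ l := by linarith

lemma mul_pow_three_le_exp {l : ℝ} (hl : 1000 ≤ l) : 41 * l ^ 3 ≤ Real.exp l := by
  have hl0 : 0 < l := by linarith
  refine le_trans ?_ (Real.pow_div_factorial_le_exp l hl0.le 4)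
  rw [le_div_iff₀ (by positivity)]
  norm_num [Nat.factorial]
  rw [show l ^ 4 = l * l ^ 3 by ring]
  have : 0 < l ^ 3 := by positivity
  have : 1000 * l ^ 3 ≤ l * l ^ 3 := by gcongr
  linarith

/-- For b = 4/l the polynomial factor 48/b² = 3l² is at most e^(q/4). Together with e^(q/25) it uses
less than half of the saving e^(-q). -/
lemma div_sq_mul_exp_le {l q x : ℝ} (hl : 0 < l) (hq : 41 * l ^ 2 ≤ q) (hx : x ≤ q / 25) :
    48 / (4 / l) ^ 2 * Real.exp (-q) * Real.exp x ≤ Real.exp (-(q / 2)) := by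
  have hb2 : 48 / (4 / l) ^ 2 = 3 * l ^ 2 := by field_simp; norm_num
  have h0 : 0 ≤ l ^ 2 := by positivity
  have h3l : 3 * l ^ 2 ≤ Real.exp (q / 4) := by
    have := Real.add_one_le_exp (q / 4)
    linarith
  rw [hb2]
  calc 3 * l ^ 2 * Real.exp (-q) * Real.exp x
      ≤ Real.exp (q / 4) * Real.exp (-q) * Real.exp (q / 25) := by gcongr
    _ = Real.exp (q / 4 + -q + q / 25) := by rw [Real.exp_add, Real.exp_add]
    _ ≤ _ := Real.exp_le_exp.2 (by linarith)

/-- Since log k ≤ l, the excess exponent 4/l costs at most e⁴ < 81. -/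
lemma rpow_le_mul_of_le_exp {k l r : ℝ} (hl : 0 < l) (hk1 : 1 ≤ k) (hk : k ≤ Real.exp l)
    (hr : r ≤ 1 + 4 / l) : k ^ r ≤ k * 81 := by
  have hk0 : 0 < k := by linarith
  calc k ^ r ≤ k ^ (1 + 4 / l) := Real.rpow_le_rpow_of_exponent_le hk1 hr
    _ = k * k ^ (4 / l) := by rw [Real.rpow_add hk0, Real.rpow_one]
    _ ≤ k * Real.exp l ^ (4 / l) := by gcongr
    _ = k * Real.exp 4 := by
        rw [← Real.exp_mul, mul_div_cancel₀ _ hl.ne']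
    _ ≤ k * 81 := by
        gcongr
        have e : Real.exp 4 = Real.exp 1 ^ 4 := by rw [← Real.exp_nat_mul]; norm_num
        rw [e]
        calc Real.exp 1 ^ 4 ≤ (3 : ℝ) ^ 4 := by
              gcongr
              linarith [Real.exp_one_lt_d9]
          _ = 81 := by norm_num

/-- With U = L/4 the off-diagonal terms carry e^(3U)/T = T^(-1/4), which dominates both e^(4k) and
e^(q/2) because k and q are small fractions of L. -/
lemma off_diagonal_error_le {L T k q : ℝ} (hT : Real.exp L = T) (hk : 0 ≤ k)
    (hkq : k * 1000 ≤ q) (hqL : q * 1000 ≤ L) :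
    18 / T * Real.exp (3 * (L / 4)) * Real.exp (2 * (k * logZetaReal (3 / 2))) ≤
      18 * Real.exp (-(q / 2)) := by
  have hT0 : 0 < T := hT ▸ Real.exp_pos L
  have h32 : logZetaReal (3 / 2) ≤ 2 := by
    refine (logZetaReal_le_log (by norm_num)).trans ?_
    have := Real.log_le_sub_one_of_pos (x := 1 + 1 / (3 / 2 - 1)) (by norm_num)
    norm_num at this ⊢
    linarith
  calc _ ≤ 18 / T * Real.exp (3 * (L / 4)) * Real.exp (2 * (k * 2)) := by gcongr
    _ = 18 * Real.exp (-L + 3 * (L / 4) + 2 * (k * 2)) := by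
        rw [Real.exp_add, Real.exp_add, Real.exp_neg, hT]
        ring
    _ ≤ _ := by
        gcongr
        linarith

/-- The integrand contributes at most 5 l² e^(3q) and the relative measure C L T^(-1/8). As l² L ≤
e^(L/10), what remains is 5C e^(3q - L/40), and q ≤ L/1000 closes the estimate. -/
lemma exceptional_error_le {C L T l q x y : ℝ} (hC : 0 ≤ C) (hT : Real.exp L = T)
    (hl : 1000 ≤ l) (hlL : l ^ 2 ≤ L) (hL : 41000 ≤ L) (hq : 0 ≤ q) (hqL : q * 1000 ≤ L)
    (hx : x ≤ 3 * q) (hy : y ≤ q / 50) :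
    (Real.exp x + (7 / (4 / l) * Real.exp q * Real.exp y) ^ 2) * (C * L * T ^ (7 / 8 : ℝ) / T) ≤
      5 * C * Real.exp (-(q / 2)) := by
  have hT0 : 0 < T := hT ▸ Real.exp_pos L
  have hl0 : 0 < l := by linarith
  have e1 : T ^ (7 / 8 : ℝ) / T = Real.exp (-(L / 8)) := by
    rw [← Real.rpow_sub_one hT0.ne', ← hT, ← Real.exp_mul]
    congr 1
    ring
  have e3 : 7 / (4 / l) = 7 / 4 * l := by field_simp
  have e4 : (7 / 4 * l * Real.exp q * Real.exp y) ^ 2 ≤ 4 * l ^ 2 * Real.exp (3 * q) := by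
    calc _ ≤ (7 / 4 * l * Real.exp q * Real.exp (q / 50)) ^ 2 := by gcongr
      _ = 49 / 16 * l ^ 2 * Real.exp (2 * q + q / 25) := by
          rw [Real.exp_add, mul_pow, mul_pow, mul_pow, ← Real.exp_nat_mul, ← Real.exp_nat_mul]
          push_cast
          rw [show 2 * (q / 50) = q / 25 by ring]
          ring
      _ ≤ _ := by
          gcongr
          · norm_num
          · linarith
  have e5 : Real.exp x ≤ l ^ 2 * Real.exp (3 * q) := by
    calc Real.exp x ≤ 1 * Real.exp (3 * q) := by
          rw [one_mul]
          gcongr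
      _ ≤ _ := by
          gcongr
          exact one_le_pow₀ (by linarith)
  have e6 : l ^ 2 * L ≤ Real.exp (L / 10) := by
    have h1 := Real.pow_div_factorial_le_exp (L / 10) (by positivity) 3
    norm_num [Nat.factorial] at h1
    have h3 : L ^ 2 * 6000 ≤ L ^ 2 * L := by gcongr; linarith
    calc l ^ 2 * L ≤ L * L := by gcongr
      _ ≤ (L / 10) ^ 3 / 6 := by
          rw [le_div_iff₀ (by norm_num)]
          linarith [show (L / 10) ^ 3 = L ^ 2 * L / 1000 by ring, show L * L * 6 = L ^ 2 * 6 by ring]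
      _ ≤ _ := h1
  rw [e3, mul_div_assoc, e1]
  calc _ ≤ (l ^ 2 * Real.exp (3 * q) + 4 * l ^ 2 * Real.exp (3 * q)) *
        (C * L * Real.exp (-(L / 8))) := by gcongr
    _ = 5 * C * (l ^ 2 * L) * (Real.exp (3 * q) * Real.exp (-(L / 8))) := by ring
    _ ≤ 5 * C * Real.exp (L / 10) * (Real.exp (3 * q) * Real.exp (-(L / 8))) := by gcongr
    _ = 5 * C * Real.exp (L / 10 + (3 * q + -(L / 8))) := by
        rw [Real.exp_add, Real.exp_add]; ring
    _ ≤ _ := by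
        gcongr
        linarith

/-- The complex moments of `ζ(1 + it)`, in terms of divisor sums. -/
lemma exists_norm_integral_zetaOneLinePow_sub_tsum_le :
    ∃ C T₀ : ℝ, ∀ T : ℝ, T₀ ≤ T → ∀ z₁ z₂ : ℂ,
      ‖z₁‖ ≤ Real.log T / (50 * Real.log (Real.log T) ^ 2) →
      ‖z₂‖ ≤ Real.log T / (50 * Real.log (Real.log T) ^ 2) →
      IntervalIntegrable (fun t : ℝ => zetaOneLinePow t z₁ * zetaOneLinePow (-t) z₂)
        volume T (2 * T) ∧
      ‖1 / (T : ℂ) * (∫ t in T..(2 * T), zetaOneLinePow t z₁ * zetaOneLinePow (-t) z₂)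
          - ∑' n : ℕ, divisorFun z₁ n * divisorFun z₂ n / (n : ℂ) ^ 2‖
        ≤ C * Real.exp (-(Real.log T / (2 * Real.log (Real.log T)))) := by
  obtain ⟨C, hC0, hC⟩ := exists_measurableSet_norm_logZetaHorizontal_le
  -- For l ≥ l₀ the bound e^1100 log(1 + l) for `log ζ` is at most l, so powers with exponent up to
  -- k cost at most e^(kl) = e^(q/50).
  obtain ⟨l₀, hl₀⟩ := exists_mul_log_one_add_le (Real.exp_pos 1100)
  refine ⟨20 + 5 * C, Real.exp (Real.exp (max l₀ 1000)), fun T hT z₁ z₂ hz₁ hz₂ => ?_⟩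
  have hT0 : 0 < T := (Real.exp_pos _).trans_le hT
  have hLlow : Real.exp (max l₀ 1000) ≤ Real.log T := by
    rw [← Real.log_exp (Real.exp (max l₀ 1000))]; exact Real.log_le_log (Real.exp_pos _) hT
  have hL0 : 0 < Real.log T := (Real.exp_pos _).trans_le hLlow
  have hllow : max l₀ 1000 ≤ Real.log (Real.log T) := by
    rw [← Real.log_exp (max l₀ 1000)]; exact Real.log_le_log (Real.exp_pos _) hLlow
  have hT400 : Real.exp (Real.exp 400) ≤ T := by
    refine le_trans ?_ hT
    gcongr
    exact le_trans (by norm_num) (le_max_right _ _)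
  obtain ⟨E, hE, hEV, hgood⟩ := hC T hT400
  set L := Real.log T with hLdef
  set l := Real.log L with hldef
  have hl : 1000 ≤ l := (le_max_right _ _).trans hllow
  have hl0 : 0 < l := by linarith
  have hlog := hl₀ l ((le_max_left _ _).trans hllow)
  have hK : 1100 ≤ Real.exp 1100 := by have := Real.add_one_le_exp (1100 : ℝ); linarith
  have hexpl : Real.exp l = L := Real.exp_log hL0
  have hexpL : Real.exp L = T := Real.exp_log hT0
  have hlogpos : 0 ≤ Real.log (1 + l) := Real.log_nonneg (by linarith)
  have hlog' : Real.log (1 + l) * 1100 ≤ l := by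
    calc Real.log (1 + l) * 1100 ≤ Real.log (1 + l) * Real.exp 1100 := by gcongr
      _ ≤ l := by linarith
  have hL3 : 41 * l ^ 3 ≤ L := by rw [← hexpl]; exact mul_pow_three_le_exp hl
  have hl23 : 1000 * l ^ 2 ≤ l ^ 3 := by
    rw [show l ^ 3 = l * l ^ 2 by ring]
    gcongr
  have hl12 : 1000 * l ≤ l ^ 2 := by
    rw [show l ^ 2 = l * l by ring]
    gcongr
  have hL1 : 41000 ≤ L := by linarith
  -- The saving of the contour shift is e^(-q); the theorem claims e^(-q/2).
  obtain ⟨q, hq⟩ : ∃ q, q = L / l := ⟨_, rfl⟩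
  have hql : q * l = L := by rw [hq, div_mul_cancel₀ _ hl0.ne']
  have hq0 : 0 < q := by rw [hq]; positivity
  have hqL : q * 1000 ≤ L := by rw [← hql]; gcongr
  have hq2 : 41 * l ^ 2 ≤ q := by
    rw [hq, le_div_iff₀ hl0]
    linarith [show 41 * l ^ 2 * l = 41 * l ^ 3 by ring]
  obtain ⟨k, hk⟩ : ∃ k, k = L / (50 * l ^ 2) := ⟨_, rfl⟩
  rw [← hk] at hz₁ hz₂
  have hkq : k * (50 * l) = q := by rw [hk, hq]; field_simp
  have hk1 : 1 ≤ k := by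
    rw [hk, le_div_iff₀ (by positivity)]
    linarith
  have hk0 : 0 < k := by linarith
  have hkq' : k * 1000 ≤ q := by
    rw [← hkq]
    gcongr
    linarith
  have hkl : k * l * 50 = q := by rw [← hkq]; ring
  have hkL : k ≤ Real.exp l := by rw [hexpl]; linarith
  have hT2 : 2 ≤ T := by
    have := Real.add_one_le_exp L
    rw [hexpL] at this
    linarith
  have hfin : Real.exp (-(L / (2 * l))) = Real.exp (-(q / 2)) := by
    rw [hq]; congr 2; field_simp
  rw [hfin]
  refine ⟨(continuousOn_zetaOneLinePow_mul hT2 z₁ z₂).intervalIntegrable, ?_⟩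
  -- the parameters
  have hb : 0 < 4 / l := by positivity
  have hb1 : 4 / l ≤ 1 := by rw [div_le_one hl0]; linarith
  have hbU : 4 / l * (L / 4) = q := by rw [hq]; field_simp
  have hUY : 5 / 2 * (L / 4) + 9 / 4 ≤ L ^ 2 := by
    rw [pow_two]
    have : 41000 * L ≤ L * L := by gcongr
    linarith
  have hR : ∀ t ∈ Set.Icc T (2 * T), ‖logZetaOneLine t‖ ≤ 10 * l := by
    intro t ht
    have ht0 : 0 < t := hT0.trans_le ht.1
    -- The parameter is 2L because 2t ≤ 4T ≤ T² = e^(2L).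
    have h1 := norm_logZetaOneLine_le (L := 2 * L) (t := t) (by linarith)
      (by rw [abs_of_pos ht0]; linarith [ht.1]) (by
        rw [abs_of_pos ht0, two_mul L, Real.exp_add, hexpL]
        have hT4 : 4 ≤ T := by
          have := Real.add_one_le_exp L
          rw [hexpL] at this
          linarith
        have : 4 * T ≤ T * T := by gcongr
        linarith [ht.2])
    rw [Real.log_mul (by norm_num) hL0.ne', ← hldef] at h1
    have := Real.log_two_lt_d9
    linarith
  have hV : 0 ≤ C * L * T ^ (7 / 8 : ℝ) := by positivity
  have hcomp := norm_integral_zetaOneLinePow_sub_le (Y := L) (V := C * L * T ^ (7 / 8 : ℝ)) hb hb1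
    (by positivity : 0 ≤ L / 4) (by linarith) hUY hT2 hV hE hEV hR hgood hz₁ hz₂
  have hden : 0 < 1 - 4 / l / 2 := by linarith
  -- This r puts the diagonal bound at ζ(1 + 1/l) ≤ 1 + l while keeping r ≤ 1 + 4/l, so k^r is still
  -- at most 81k.
  obtain ⟨r, hr⟩ : ∃ r, r = (1 + 1 / l) / (1 - 4 / l / 2) := ⟨_, rfl⟩
  have hrb : r * (1 - 4 / l / 2) = 1 + 1 / l := by rw [hr, div_mul_cancel₀ _ hden.ne']
  have hl1 : 0 < 1 / l := by positivity
  have hl1' : 1 / l ≤ 1 / 1000 := one_div_le_one_div_of_le (by norm_num) hl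
  have h4l : 4 / l = 4 * (1 / l) := by ring
  have hr1 : 1 ≤ r := by rw [hr, le_div_iff₀ hden, h4l]; linarith
  have hr4 : r ≤ 1 + 4 / l := by
    rw [hr, div_le_iff₀ hden, h4l,
      show (1 + 4 * (1 / l)) * (1 - 4 * (1 / l) / 2) = 1 + 1 / l + 1 / l * (1 - 8 * (1 / l)) by ring]
    have : 0 ≤ 1 / l * (1 - 8 * (1 / l)) := mul_nonneg hl1.le (by linarith)
    linarith
  have hmean := norm_integral_smoothedSeries_sub_le (Y := L) (U := L / 4) hb hb1 hk1 hr1 (by linarith)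
    (by rw [hrb]; linarith) hT0 (by linarith) hUY hz₁ hz₂
  rw [hrb, hbU] at hmean
  rw [hbU] at hcomp
  -- sizes of the four error terms
  have hA := div_sq_mul_exp_le hl0 hq2 (x := 2 * (k * (Real.exp 1100 * Real.log (1 + l)))) (by
    have : k * (Real.exp 1100 * Real.log (1 + l)) ≤ k * l := by gcongr
    linarith)
  have hkr := rpow_le_mul_of_le_exp hl0 hk1 hkL hr4
  have hz1l : logZetaReal (1 + 1 / l) ≤ Real.log (1 + l) := by
    refine (logZetaReal_le_log (by linarith)).trans (le_of_eq ?_)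
    simp
  have hz1l0 : 0 ≤ logZetaReal (1 + 1 / l) := logZetaReal_nonneg (by linarith)
  have hz4l : logZetaReal (1 + 4 / l) ≤ Real.log (1 + l) := by
    refine (logZetaReal_antitone (by linarith) ?_).trans hz1l
    rw [h4l]; linarith
  have hD := div_sq_mul_exp_le hl0 hq2 (x := 8 * k ^ r * logZetaReal (1 + 1 / l)) (by
    calc 8 * k ^ r * logZetaReal (1 + 1 / l) ≤ 8 * (k * 81) * Real.log (1 + l) := by gcongr
      _ = k * (648 * Real.log (1 + l)) := by ring
      _ ≤ k * l := by gcongr; linarith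
      _ ≤ q / 25 := by linarith)
  have hCt := off_diagonal_error_le hexpL hk0.le hkq' hqL
  have hBt := exceptional_error_le (x := 2 * (k * (10 * l))) (y := k * logZetaReal (1 + 4 / l)) hC0
    hexpL hl (by linarith) hL1 hq0.le hqL (by linarith) (by
      have : k * logZetaReal (1 + 4 / l) ≤ k * l := by
        gcongr
        linarith
      linarith)
  refine (norm_sub_le_norm_sub_add_norm_sub _ _ _).trans
    ((add_le_add (hcomp.trans (add_le_add hA hBt)) (hmean.trans (add_le_add hCt hD))).trans
      (le_of_eq (by ring)))

end Moments

theorem theorem2 :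
    ∃ C T₀ : ℝ, ∀ (Ω : Type*) [MeasurableSpace Ω] (P : Measure Ω) [IsProbabilityMeasure P]
      (X : Nat.Primes → Ω → ℂ),
      (∀ p, Measurable (X p)) → (∀ p, P.map (X p) = uniformCircle) → iIndepFun X P →
      -- the random Euler product and its logarithm converge with probability one
      (∀ᵐ ω ∂P,
        Tendsto (eulerProductUpTo fun p => X p ω) atTop (𝓝 (eulerL fun p => X p ω)) ∧
        Tendsto (logEulerProductUpTo fun p => X p ω) atTop (𝓝 (logEulerL fun p => X p ω)) ∧
        Complex.exp (logEulerL fun p => X p ω) = eulerL fun p => X p ω) ∧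
      -- the complex moments of the random Euler product
      (∀ z₁ z₂ : ℂ,
        Integrable (fun ω => eulerLPow (fun p => X p ω) z₁ * eulerLConjPow (fun p => X p ω) z₂) P ∧
        HasSum (fun n : ℕ => divisorFun z₁ n * divisorFun z₂ n / (n : ℂ) ^ 2)
          (∫ ω, eulerLPow (fun p => X p ω) z₁ * eulerLConjPow (fun p => X p ω) z₂ ∂P)) ∧
      -- the complex moments of `ζ(1 + it)`
      (∀ T : ℝ, T₀ ≤ T → ∀ z₁ z₂ : ℂ,
        ‖z₁‖ ≤ Real.log T / (50 * Real.log (Real.log T) ^ 2) →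
        ‖z₂‖ ≤ Real.log T / (50 * Real.log (Real.log T) ^ 2) →
        IntervalIntegrable (fun t : ℝ => zetaOneLinePow t z₁ * zetaOneLinePow (-t) z₂)
          volume T (2 * T) ∧
        ‖1 / (T : ℂ) * (∫ t in T..(2 * T), zetaOneLinePow t z₁ * zetaOneLinePow (-t) z₂)
            - ∫ ω, eulerLPow (fun p => X p ω) z₁ * eulerLConjPow (fun p => X p ω) z₂ ∂P‖
          ≤ C * Real.exp (-(Real.log T / (2 * Real.log (Real.log T))))) := by
  -- The constants come from the estimate against the divisor series, so they do not depend on the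
  -- probability space; the expectation is then replaced by that series.
  obtain ⟨C, T₀, h⟩ := exists_norm_integral_zetaOneLinePow_sub_tsum_le
  refine ⟨C, T₀, fun Ω _ P _ X hX hlaw hind => ⟨ae_tendsto_eulerProductUpTo hX hlaw hind,
    fun z₁ z₂ => integrable_and_hasSum_moment hX hlaw hind z₁ z₂, fun T hT z₁ z₂ hz₁ hz₂ => ?_⟩⟩
  rw [← (integrable_and_hasSum_moment hX hlaw hind z₁ z₂).2.tsum_eq]
  exact h T hT z₁ z₂ hz₁ hz₂
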